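/- Let $M$ be a non-empty compact smooth Riemannian manifold without boundary, of positive dimension (not necessarily connected), let $d$ be its Riemannian distance (with $d=+\infty$ between different connected components), and let $f:M\to M$ be a topologically transitive $C^1$ map that is $\lambda$-expanding for some $\lambda>1$, i.e. $|Df(v)|\ge\lambda|v|$ for all tangent vectors $v$. Put $L=\sup_{x\in M}\sup_{0\ne v\in T_xM}|Df(v)|/|v|$. For $j\ge 1$ let $\varphi_j:\mathbb N\to(0,1]$, let $\mathcal Z_j=(z_j^i)_{i\ge0}$ be a sequence of points of $M$, and let $S_j=(s_j^i)_{i\ge0}$ be a sequence of natural numbers with $\lim_i s_j^i=\infty$. Let $$\mathfrak S_j=\{x\in M: d(f^n(x),z_j^n)<\varphi_j(n)\text{ for infinitely many }n\in S_j\},\qquad \mathfrak S=\bigcap_{j\ge1}\mathfrak S_j,$$ $$\overline\tau=\sup_j\limsup_{n\to\infty}-\frac{\ln\varphi_j(n)}{n},\qquad \underline\tau=\sup_j\liminf_{n\to\infty}-\frac{\ln\varphi_j(n)}{n}\qquad(\text{in }[0,+\infty]).$$ Let $h_{top}(f,Z)$ be Bowen's topological entropy of $f$ on a subset $Z\subseteq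 M$, let $h_{top}(f,M)$ be the classical topological entropy of $f$, and let $\dim_H$ be the Hausdorff dimension; a fraction with denominator $+\infty$ is $0$. Consider pairs $(Y,N)$ of a non-empty compact set $Y\subseteq M$ and an integer $N\ge1$ such that $f^N(Y)=Y$, $M=\bigcup_{l=0}^{N-1}f^l(Y)$, and $g=f^N|_Y$ has the exponential specification property with respect to the exponent $(+\infty,N\ln\lambda)$ at every scale, i.e. for each $\varepsilon>0$ there is $p\ge1$ such that for all $x_1,\dots,x_k\in Y$, $n_1,\dots,n_k\ge1$ and $p_1,\dots,p_k\ge p$ there is $y\in Y$ with $d\big(g^{m_i+t}(y),g^t(x_i)\big)<\varepsilon e^{-(n_i-1-t)N\ln\lambda}$ for $1\le i\le k$, $0\le t<n_i$, where $m_i=\sum_{r<i}(n_r+p_r)$. Such a pair exists. For such a pair let $\mathrm{Ind}'_j\subset\mathbb Z$ be the set of all $I_1-I_2$ with $0\le I_1,I_2<N$ such that $z_j^{s_j^i}\in f^{I_1}(Y)$ and $N\mid s_j^i-I_2$ for infinitely many $i$. (1) If $\bigcap_{j\ge1}\mathrm{Ind}'_j\ne\emptyset$ for some such pair $(Y,N)$,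 then $\mathfrak S\neq\emptyset$ and $$\frac{\ln\lambda}{\ln\lambda+\overline\tau}h_{top}(f,M)\le h_{top}(f,\mathfrak S)\le\frac{\ln L}{\ln L+\underline\tau}h_{top}(f,M),$$ $$\frac1{\ln L}\frac{\ln\lambda}{\ln\lambda+\overline\tau}h_{top}(f,M)\le\dim_H\mathfrak S\le\frac1{\ln\lambda}\frac{\ln L}{\ln L+\underline\tau}h_{top}(f,M).$$ (2) If $f$ is topologically mixing, the conclusions of (1) hold without the condition on the sets $\mathrm{Ind}'_j$. (3) If $f$ is topologically mixing and $S_j=\mathbb N$ for all $j$, the conclusions of (1) hold with $\overline\tau$ replaced by $\underline\tau$. If moreover $L=\lambda$, then $$h_{top}(f,\mathfrak S)=\frac{\ln L}{\ln L+\underline\tau}h_{top}(f,M),\qquad \dim_H\mathfrak S=\frac1{\ln L+\underline\tau}h_{top}(f,M).$$ -/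

import Mathlib

open Set Filter Topology Manifold Bundle
open scoped ENNReal NNReal ContDiff

noncomputable section

namespace ShrinkingTarget

section Dynamics

variable {X : Type*}

/-- Topological transitivity of a self-map. -/
def IsTransitive [TopologicalSpace X] (f : X → X) : Prop :=
  ∀ U V : Set X, IsOpen U → U.Nonempty → IsOpen V → V.Nonempty →
    ∃ n : ℕ, ((f^[n] '' U) ∩ V).Nonempty

/-- Topological mixing of a self-map. -/
def IsMixing [TopologicalSpace X] (f : X → X) : Prop :=
  ∀ U V : Set X, IsOpen U → U.Nonempty → IsOpen V → V.Nonempty →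
    ∃ n₀ : ℕ, ∀ n ≥ n₀, ((f^[n] '' U) ∩ V).Nonempty

/-- The dynamical ball `B_n(x, ε, f)`. -/
def bowenBall [EMetricSpace X] (f : X → X) (n : ℕ) (x : X) (ε : ℝ≥0∞) : Set X :=
  {y | ∀ i < n, edist (f^[i] x) (f^[i] y) < ε}

/-- The infimum of `∑ exp (- s nᵢ)` over the countable covers of `Z` by dynamical balls
`B_{nᵢ}(xᵢ, ε, f)` with `nᵢ ≥ N`. -/
def bowenPreMeasure [EMetricSpace X] (f : X → X) (s : ℝ≥0) (N : ℕ) (ε : ℝ≥0∞) (Z : Set X) :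
    ℝ≥0∞ :=
  ⨅ (C : Set (X × ℕ)) (_ : C.Countable) (_ : ∀ p ∈ C, N ≤ p.2)
    (_ : Z ⊆ ⋃ p ∈ C, bowenBall f p.2 p.1 ε),
    ∑' p : C, ENNReal.ofReal (Real.exp (-(s : ℝ) * (p.1.2 : ℝ)))

/-- The limit of `bowenPreMeasure` as `N → ∞` (it is non-decreasing in `N`). -/
def bowenMeasure [EMetricSpace X] (f : X → X) (s : ℝ≥0) (ε : ℝ≥0∞) (Z : Set X) : ℝ≥0∞ :=
  ⨆ N : ℕ, bowenPreMeasure f s N ε Z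

/-- The Bowen entropy of `Z` at scale `ε`: the critical exponent of `bowenMeasure`. -/
def bowenEntropyAt [EMetricSpace X] (f : X → X) (ε : ℝ≥0∞) (Z : Set X) : ℝ≥0∞ :=
  ⨅ (s : ℝ≥0) (_ : bowenMeasure f s ε Z = 0), (s : ℝ≥0∞)

/-- The Bowen topological entropy of `f` on an arbitrary subset `Z`: the limit as `ε → 0`
of the entropy at scale `ε` (which is non-increasing in `ε`). -/
def bowenEntropy [EMetricSpace X] (f : X → X) (Z : Set X) : ℝ≥0∞ :=
  ⨆ (ε : ℝ≥0∞) (_ : 0 < ε), bowenEntropyAt f ε Z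

/-- The shrinking target set: the points `x` with `d (f^n x, z_n) < φ n` for infinitely many
`n ∈ S`. -/
def targetSet [EMetricSpace X] (f : X → X) (φ : ℕ → ℝ) (z : ℕ → X) (S : Set ℕ) : Set X :=
  {x | {n | n ∈ S ∧ edist (f^[n] x) (z n) < ENNReal.ofReal (φ n)}.Infinite}

/-- The exponential dynamical ball `B_n(x, ε, a, g)`. -/
def expBall [EMetricSpace X] (g : X → X) (a : ℝ) (n : ℕ) (x : X) (ε : ℝ) : Set X :=
  {y | ∀ i < n, edist (g^[i] x) (g^[i] y) <
    ENNReal.ofReal (ε * Real.exp (-((n : ℝ) - 1 - (i : ℝ)) * a))}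

/-- The exponential specification property of `(Y, g)` with respect to the exponent `(+∞, a)`
at scale `ε`. -/
def HasExpSpecification [EMetricSpace X] (g : X → X) (Y : Set X) (a ε : ℝ) : Prop :=
  ∃ p : ℕ, 0 < p ∧ ∀ (k : ℕ) (x : ℕ → X) (n q : ℕ → ℕ),
    (∀ i < k, x i ∈ Y) → (∀ i < k, 0 < n i) → (∀ i < k, p ≤ q i) →
    ∃ z ∈ Y, ∀ i < k, g^[∑ j ∈ Finset.range i, (n j + q j)] z ∈ expBall g a (n i) (x i) ε

/-- `Y` is a non-empty compact set with `f^N(Y) = Y` whose first `N` images cover the space,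
such that `(Y, f^N)` has the exponential specification property with respect to the exponent
`(+∞, N a)` at every scale. -/
structure IsPeriodicPiece [EMetricSpace X] (f : X → X) (a : ℝ) (Y : Set X) (N : ℕ) : Prop where
  nonempty : Y.Nonempty
  isCompact : IsCompact Y
  pos : 0 < N
  image_eq : f^[N] '' Y = Y
  cover : ⋃ l ∈ Finset.range N, f^[l] '' Y = univ
  spec : ∀ ε : ℝ, 0 < ε → HasExpSpecification f^[N] Y (N * a) ε

/-- The index set of pairs `(I₁, I₂)` such that, for infinitely many `i`,
`z_{s_i} ∈ f^{I₁}(Y)` and `N ∣ s_i - I₂`. -/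
def indexSet (f : X → X) (z : ℕ → X) (s : ℕ → ℕ) (Y : Set X) (N : ℕ) : Set (ℕ × ℕ) :=
  {I | I.1 < N ∧ I.2 < N ∧
    {i : ℕ | z (s i) ∈ f^[I.1] '' Y ∧ (N : ℤ) ∣ (s i : ℤ) - (I.2 : ℤ)}.Infinite}

/-- The set of differences `I₁ - I₂` (integers) of the pairs in the index set. -/
def indexDiff (f : X → X) (z : ℕ → X) (s : ℕ → ℕ) (Y : Set X) (N : ℕ) : Set ℤ :=
  {m | ∃ I ∈ indexSet f z s Y N, m = (I.1 : ℤ) - (I.2 : ℤ)}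

end Dynamics

/-- `sup_j limsup_n - ln φ_j(n) / n`. -/
def upperRate (φ : ℕ → ℕ → ℝ) : EReal :=
  ⨆ j : ℕ, limsup (fun n : ℕ => ((-Real.log (φ j n) / n : ℝ) : EReal)) atTop

/-- `sup_j liminf_n - ln φ_j(n) / n`. -/
def lowerRate (φ : ℕ → ℕ → ℝ) : EReal :=
  ⨆ j : ℕ, liminf (fun n : ℕ => ((-Real.log (φ j n) / n : ℝ) : EReal)) atTop

/-- The set `A` is non-empty, and its Bowen entropy and its Hausdorff dimension satisfy the
lower bounds with rate `τ` and the upper bounds with rate `τ'`. The entropy of `f` on the whole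
space is the classical topological entropy. -/
structure TargetBounds {X : Type*} [EMetricSpace X] (f : X → X) (lam L : ℝ) (τ τ' : EReal)
    (A : Set X) : Prop where
  nonempty : A.Nonempty
  entropy_lower :
    (Real.log lam : EReal) / (Real.log lam + τ) * Dynamics.coverEntropy f univ
      ≤ (bowenEntropy f A : EReal)
  entropy_upper :
    (bowenEntropy f A : EReal)
      ≤ (Real.log L : EReal) / (Real.log L + τ') * Dynamics.coverEntropy f univ
  dim_lower :
    1 / (Real.log L : EReal) * ((Real.log lam : EReal) / (Real.log lam + τ))
        * Dynamics.coverEntropy f univ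
      ≤ (dimH A : EReal)
  dim_upper :
    (dimH A : EReal)
      ≤ 1 / (Real.log lam : EReal) * ((Real.log L : EReal) / (Real.log L + τ'))
        * Dynamics.coverEntropy f univ

section Manifold

variable (E : Type*) [NormedAddCommGroup E] [NormedSpace ℝ E]
  {M : Type*} [EMetricSpace M] [ChartedSpace E M]
  [RiemannianBundle (fun x : M => TangentSpace 𝓘(ℝ, E) x)]

/-- `f` is a `C^1` map with `|Df(v)| ≥ lam |v|` for all tangent vectors `v`, where `lam > 1`;
`E` is the model space of the manifold. -/
structure IsExpanding (f : M → M) (lam : ℝ) : Prop where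
  contMDiff : ContMDiff 𝓘(ℝ, E) 𝓘(ℝ, E) 1 f
  one_lt : 1 < lam
  le_norm : ∀ (x : M) (v : TangentSpace 𝓘(ℝ, E) x),
    lam * ‖v‖ ≤ ‖mfderiv 𝓘(ℝ, E) 𝓘(ℝ, E) f x v‖

/-- The supremum of `|Df(v)| / |v|` over all non-zero tangent vectors `v`. -/
def maxStretch (f : M → M) : ℝ :=
  sSup {r : ℝ | ∃ (x : M) (v : TangentSpace 𝓘(ℝ, E) x), v ≠ 0 ∧
    r = ‖mfderiv 𝓘(ℝ, E) 𝓘(ℝ, E) f x v‖ / ‖v‖}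

end Manifold

end ShrinkingTarget

end

/-! Expansion enters only through backward lifting: if `f x` and `y` are at finite distance, then
`y` has a preimage at distance at most `κ * edist (f x) y` from `x`, with `κ = lam⁻¹`, because local
inverses of `f` contract path lengths. With a Lipschitz constant `L` and uniform local injectivity
this forms `HasContractingLifts`; everything after the Riemannian part is metric. Finite distances
are bounded by compactness, so the `n`-fold lift of a point shadows a given orbit with error `κ ^ (n
- t) * D` at time `t`.

Counting: the fibres of `f^[r]` have cardinality `exp (h * r)` up to a factor independent of `r` and
of the base point (`exists_growth`), and `h` is the topological entropy (`coverEntropy_eq`).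

Upper bound: if `f^[n] x` is within `exp (-n τ)` of `z n`, some point of the fibre of `f^[n]` over
`z n` shadows `x` up to time about `n (1 + τ / log L)`. These balls number about `exp (h n)`, and
the resulting series converges for `s > h log L / (log L + τ)`.

Lower bound: choose hitting times `n k` much larger than the preceding starting time `b k`. From `b
k` on, let the orbit follow a freely chosen element of a fibre over the target, and keep following
it for about `-log φ / log lam` steps past `n k`, which makes the hit precise enough
(`exists_tracing_targets`). The uniform Bernoulli measure on the choices gives small mass to Bowen
balls, and the mass distribution principle applies (`le_bowenEntropyAt_range`).

Dimension: Bowen balls of length `n` have diameter at most a constant times `κ ^ n`, and sets of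
diameter comparable to `L ^ (-n)` lie in Bowen balls of length `n`; hence `dimH * log lam ≤ entropy
≤ dimH * log L`.

The index condition, or mixing, serves only to produce one orbit that is infinitely often at finite
distance from each sequence of targets. -/

namespace ShrinkingTarget

/-! ### Local inverses of `C^1` maps with injective derivative -/

section LocalInverse

variable {E : Type*} [NormedAddCommGroup E] [NormedSpace ℝ E]
  {M : Type*} [TopologicalSpace M] [ChartedSpace E M] [IsManifold 𝓘(ℝ, E) 1 M]

/-- The inverse function theorem for a `C^1` self-map of a finite-dimensional manifold whose
derivative is injective at a point. -/
lemma exists_contMDiffAt_local_inverse [FiniteDimensional ℝ E] {f : M → M} {x : M}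
    (hf : ContMDiffAt 𝓘(ℝ, E) 𝓘(ℝ, E) 1 f x)
    (hinj : Function.Injective (mfderiv 𝓘(ℝ, E) 𝓘(ℝ, E) f x)) :
    ∃ g : M → M, g (f x) = x ∧ ContMDiffAt 𝓘(ℝ, E) 𝓘(ℝ, E) 1 g (f x) ∧
      (∀ᶠ y in 𝓝 (f x), f (g y) = y) ∧ ∀ᶠ x' in 𝓝 x, g (f x') = x' := by
  set F : E → E := writtenInExtChartAt 𝓘(ℝ, E) 𝓘(ℝ, E) x f with hF
  set a : E := extChartAt 𝓘(ℝ, E) x x with ha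
  have hFc : ContDiffAt ℝ 1 F a := by
    have := (contMDiffAt_iff.1 hf).2
    rw [modelWithCornersSelf_coe, range_id] at this
    exact this
  have hFa : F a = extChartAt 𝓘(ℝ, E) (f x) (f x) := by
    simp [hF, ha, writtenInExtChartAt]
  have hder : mfderiv 𝓘(ℝ, E) 𝓘(ℝ, E) f x = fderiv ℝ F a := by
    have := hf.mdifferentiableAt one_ne_zero
    simp only [mfderiv, this, hF, ha]
    simp
    rfl
  have hinj' : Function.Injective (fderiv ℝ F a) := by
    rw [← hder]; exact hinj
  let F' : E ≃L[ℝ] E :=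
    (LinearEquiv.ofInjectiveEndo (fderiv ℝ F a : E →ₗ[ℝ] E) hinj').toContinuousLinearEquiv
  have hF' : HasFDerivAt F (F' : E →L[ℝ] E) a := by
    have h1 := (hFc.differentiableAt one_ne_zero).hasFDerivAt
    have h2 : (F' : E →L[ℝ] E) = fderiv ℝ F a := by
      ext v; rfl
    rwa [h2]
  set e := hFc.toOpenPartialHomeomorph F hF' one_ne_zero with he
  have hes : a ∈ e.source := hFc.mem_toOpenPartialHomeomorph_source hF' one_ne_zero
  have het : F a ∈ e.target := hFc.image_mem_toOpenPartialHomeomorph_target hF' one_ne_zero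
  have hecoe : ∀ v, e v = F v := fun v => rfl
  have hesymm : ContDiffAt ℝ 1 e.symm (F a) := hFc.to_localInverse hF' one_ne_zero
  have hinv : e.symm (F a) = a := by
    rw [← hecoe a]; exact e.left_inv hes
  -- A total function, meaningless far from `f x`; only its germ there is used.
  set g : M → M := fun y => (extChartAt 𝓘(ℝ, E) x).symm (e.symm (extChartAt 𝓘(ℝ, E) (f x) y))
    with hg
  have hgx : g (f x) = x := by
    simp only [hg]
    rw [← hFa, hinv]; simp [ha]
  have hgc : ContMDiffAt 𝓘(ℝ, E) 𝓘(ℝ, E) 1 g (f x) := by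
    have h1 : ContMDiffAt 𝓘(ℝ, E) 𝓘(ℝ, E) 1 (extChartAt 𝓘(ℝ, E) (f x)) (f x) :=
      contMDiffAt_extChartAt
    have h2 : ContMDiffAt 𝓘(ℝ, E) 𝓘(ℝ, E) 1 e.symm (extChartAt 𝓘(ℝ, E) (f x) (f x)) := by
      rw [← hFa]; exact hesymm.contMDiffAt
    have h3 : ContMDiffAt 𝓘(ℝ, E) 𝓘(ℝ, E) 1 (extChartAt 𝓘(ℝ, E) x).symm
        (e.symm (extChartAt 𝓘(ℝ, E) (f x) (f x))) := by
      rw [← hFa, hinv]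
      exact (contMDiffOn_extChartAt_symm x).contMDiffAt (extChartAt_target_mem_nhds x)
    exact h3.comp (f x) (h2.comp (f x) h1)
  have hchart : ContinuousAt (extChartAt 𝓘(ℝ, E) (f x)) (f x) := continuousAt_extChartAt (f x)
  refine ⟨g, hgx, hgc, ?_, ?_⟩
  · have e1 : ∀ᶠ y in 𝓝 (f x), extChartAt 𝓘(ℝ, E) (f x) y ∈ e.target :=
      hchart.eventually (by rw [← hFa]; exact e.open_target.mem_nhds het)
    have e2 : ∀ᶠ y in 𝓝 (f x), y ∈ (extChartAt 𝓘(ℝ, E) (f x)).source :=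
      extChartAt_source_mem_nhds (f x)
    have e3 : ∀ᶠ y in 𝓝 (f x), f (g y) ∈ (extChartAt 𝓘(ℝ, E) (f x)).source := by
      have : ContinuousAt (fun y => f (g y)) (f x) := by
        refine ContinuousAt.comp ?_ hgc.continuousAt
        rw [hgx]; exact hf.continuousAt
      refine this.eventually ?_
      simp only [hgx]
      exact extChartAt_source_mem_nhds (f x)
    filter_upwards [e1, e2, e3] with y h1 h2 h3
    have : F (e.symm (extChartAt 𝓘(ℝ, E) (f x) y)) = extChartAt 𝓘(ℝ, E) (f x) y := by
      rw [← hecoe]; exact e.right_inv h1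
    exact (extChartAt 𝓘(ℝ, E) (f x)).injOn h3 h2 this
  · have e1 : ∀ᶠ x' in 𝓝 x, extChartAt 𝓘(ℝ, E) x x' ∈ e.source :=
      (continuousAt_extChartAt x).eventually (e.open_source.mem_nhds hes)
    have e2 : ∀ᶠ y in 𝓝 x, y ∈ (extChartAt 𝓘(ℝ, E) x).source := extChartAt_source_mem_nhds x
    filter_upwards [e1, e2] with x' h1 h2
    have h3 : F (extChartAt 𝓘(ℝ, E) x x') = extChartAt 𝓘(ℝ, E) (f x) (f x') := by
      simp only [hF, writtenInExtChartAt, Function.comp]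
      rw [(extChartAt 𝓘(ℝ, E) x).left_inv h2]
    simp only [hg]
    rw [← h3, ← hecoe, e.left_inv h1, (extChartAt 𝓘(ℝ, E) x).left_inv h2]

end LocalInverse

/-! ### Derivative bounds and path lengths -/

section Riemannian

variable {E : Type*} [NormedAddCommGroup E] [NormedSpace ℝ E]
  {M : Type*} [EMetricSpace M] [ChartedSpace E M]
  [RiemannianBundle (fun x : M => TangentSpace 𝓘(ℝ, E) x)]

/-- All tangent spaces are definitionally `E`, but their norms depend on the base point, so an
equality of base points has to be transported by hand. -/
lemma norm_tangentSpace_congr {a b : M} (h : a = b) (v : E) :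
    ‖(show TangentSpace 𝓘(ℝ, E) a from v)‖ = ‖(show TangentSpace 𝓘(ℝ, E) b from v)‖ := by
  subst h; rfl

/-- The image path competes in the infimum defining the distance, and the chain rule bounds its
speed pointwise. The derivative bound is needed only on an open set containing the path, so the
lemma also serves local inverses. -/
lemma edist_le_mul_pathELength [IsRiemannianManifold 𝓘(ℝ, E) M] {g : M → M} {V : Set M} {c : ℝ≥0}
    (hV : IsOpen V) (hg : ContMDiffOn 𝓘(ℝ, E) 𝓘(ℝ, E) 1 g V)
    (hgc : ∀ y ∈ V, ∀ v : TangentSpace 𝓘(ℝ, E) y,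
      ‖mfderiv 𝓘(ℝ, E) 𝓘(ℝ, E) g y v‖ ≤ c * ‖v‖)
    {γ : ℝ → M} (hγ : ContMDiffOn 𝓘(ℝ, ℝ) 𝓘(ℝ, E) 1 γ (Icc 0 1)) (hγV : MapsTo γ (Icc 0 1) V) :
    edist (g (γ 0)) (g (γ 1)) ≤ c * pathELength 𝓘(ℝ, E) γ 0 1 := by
  rw [IsRiemannianManifold.out (I := 𝓘(ℝ, E)) (g (γ 0)) (g (γ 1))]
  have hcomp : ContMDiffOn 𝓘(ℝ, ℝ) 𝓘(ℝ, E) 1 (g ∘ γ) (Icc 0 1) := hg.comp hγ hγV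
  refine (riemannianEDist_le_pathELength hcomp rfl rfl zero_le_one).trans ?_
  rw [pathELength_eq_lintegral_mfderivWithin_Icc, pathELength_eq_lintegral_mfderivWithin_Icc,
    ← MeasureTheory.lintegral_const_mul' _ _ ENNReal.coe_ne_top]
  refine MeasureTheory.setLIntegral_mono' measurableSet_Icc (fun t ht => ?_)
  have hmem := hγV ht
  have hd : MDifferentiableAt 𝓘(ℝ, E) 𝓘(ℝ, E) g (γ t) :=
    (hg.contMDiffAt (hV.mem_nhds hmem)).mdifferentiableAt one_ne_zero
  have hu : UniqueMDiffWithinAt 𝓘(ℝ, ℝ) (Icc (0 : ℝ) 1) t := by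
    rw [uniqueMDiffWithinAt_iff_uniqueDiffWithinAt]
    exact uniqueDiffOn_Icc zero_lt_one t ht
  have h1 : mfderivWithin 𝓘(ℝ, ℝ) 𝓘(ℝ, E) (g ∘ γ) (Icc 0 1) t =
      (mfderiv 𝓘(ℝ, E) 𝓘(ℝ, E) g (γ t)) ∘L (mfderivWithin 𝓘(ℝ, ℝ) 𝓘(ℝ, E) γ (Icc 0 1) t) :=
    mfderiv_comp_mfderivWithin t hd (hγ.mdifferentiableOn one_ne_zero t ht) hu
  have h2 : mfderivWithin 𝓘(ℝ, ℝ) 𝓘(ℝ, E) (g ∘ γ) (Icc 0 1) t 1 =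
      (mfderiv 𝓘(ℝ, E) 𝓘(ℝ, E) g (γ t)) (mfderivWithin 𝓘(ℝ, ℝ) 𝓘(ℝ, E) γ (Icc 0 1) t 1) :=
    DFunLike.congr_fun h1 1
  rw [h2]
  have h3 := hgc (γ t) hmem (mfderivWithin 𝓘(ℝ, ℝ) 𝓘(ℝ, E) γ (Icc 0 1) t 1)
  rw [enorm_eq_nnnorm, enorm_eq_nnnorm]
  exact_mod_cast h3

lemma exists_path_of_edist_lt [IsRiemannianManifold 𝓘(ℝ, E) M] {x y : M} {r : ℝ≥0∞}
    (h : edist x y < r) :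
    ∃ γ : ℝ → M, γ 0 = x ∧ γ 1 = y ∧ ContMDiffOn 𝓘(ℝ, ℝ) 𝓘(ℝ, E) 1 γ (Icc 0 1) ∧
      pathELength 𝓘(ℝ, E) γ 0 1 < r := by
  rw [IsRiemannianManifold.out (I := 𝓘(ℝ, E)) x y] at h
  exact exists_lt_of_riemannianEDist_lt h

lemma lipschitzWith_of_norm_mfderiv_le [IsRiemannianManifold 𝓘(ℝ, E) M] {f : M → M} {c : ℝ≥0}
    (hc0 : c ≠ 0) (hf : ContMDiff 𝓘(ℝ, E) 𝓘(ℝ, E) 1 f)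
    (hc : ∀ (y : M) (v : TangentSpace 𝓘(ℝ, E) y),
      ‖mfderiv 𝓘(ℝ, E) 𝓘(ℝ, E) f y v‖ ≤ c * ‖v‖) :
    LipschitzWith c f := by
  intro x y
  rw [mul_comm, ← ENNReal.div_le_iff (by simpa using hc0) ENNReal.coe_ne_top]
  refine le_of_forall_gt_imp_ge_of_dense fun r hr => ?_
  obtain ⟨γ, rfl, rfl, hγ, hlen⟩ := exists_path_of_edist_lt (E := E) hr
  rw [ENNReal.div_le_iff (by simpa using hc0) ENNReal.coe_ne_top, mul_comm]
  refine (edist_le_mul_pathELength isOpen_univ hf.contMDiffOn (fun y _ => hc y) hγ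
    (mapsTo_univ _ _)).trans ?_
  gcongr

/-- The derivative of a `C^1` map is locally bounded. -/
lemma eventually_norm_mfderiv_le [IsManifold 𝓘(ℝ, E) 1 M]
    [IsContinuousRiemannianBundle E (fun x : M => TangentSpace 𝓘(ℝ, E) x)] {f : M → M} {x : M}
    (hf : ContMDiffAt 𝓘(ℝ, E) 𝓘(ℝ, E) 1 f x) :
    ∃ C : ℝ, ∀ᶠ y in 𝓝 x, ∀ v : TangentSpace 𝓘(ℝ, E) y,
      ‖mfderiv 𝓘(ℝ, E) 𝓘(ℝ, E) f y v‖ ≤ C * ‖v‖ := by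
  -- The fibre norms vary with the point, so the derivative is read in fixed trivializations, where
  -- it is continuous at `x`; the trivializations themselves are locally bounded operators.
  set T : M → (E →L[ℝ] E) :=
    inTangentCoordinates 𝓘(ℝ, E) 𝓘(ℝ, E) id f (mfderiv 𝓘(ℝ, E) 𝓘(ℝ, E) f) x with hT
  have hTc : ContinuousAt T x :=
    (hf.mfderiv_const (m := 0) (by norm_num)).continuousAt
  obtain ⟨C₁, hC₁, h₁⟩ := eventually_norm_trivializationAt_lt E
    (fun x : M => TangentSpace 𝓘(ℝ, E) x) x
  obtain ⟨C₂, hC₂, h₂⟩ := eventually_norm_symmL_trivializationAt_lt E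
    (fun x : M => TangentSpace 𝓘(ℝ, E) x) (f x)
  have h₃ : ∀ᶠ y in 𝓝 x, ‖T y‖ < ‖T x‖ + 1 := hTc.norm.eventually_lt_const (by linarith)
  have h₄ : ∀ᶠ y in 𝓝 x, y ∈ (trivializationAt E (fun x : M => TangentSpace 𝓘(ℝ, E) x) x).baseSet :=
    (trivializationAt E (fun x : M => TangentSpace 𝓘(ℝ, E) x) x).open_baseSet.mem_nhds
      (FiberBundle.mem_baseSet_trivializationAt' x)
  have h₅ : ∀ᶠ y in 𝓝 x,
      f y ∈ (trivializationAt E (fun x : M => TangentSpace 𝓘(ℝ, E) x) (f x)).baseSet :=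
    hf.continuousAt.eventually
      ((trivializationAt E (fun x : M => TangentSpace 𝓘(ℝ, E) x) (f x)).open_baseSet.mem_nhds
      (FiberBundle.mem_baseSet_trivializationAt' (f x)))
  refine ⟨C₂ * ((‖T x‖ + 1) * C₁), ?_⟩
  filter_upwards [h₁, hf.continuousAt.eventually h₂, h₃, h₄, h₅] with y k₁ k₂ k₃ k₄ k₅ v
  have key : mfderiv 𝓘(ℝ, E) 𝓘(ℝ, E) f y v =
      (trivializationAt E (fun x : M => TangentSpace 𝓘(ℝ, E) x) (f x)).symmL ℝ (f y)
        (T y ((trivializationAt E (fun x : M => TangentSpace 𝓘(ℝ, E) x) x).continuousLinearMapAt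
          ℝ y v)) := by
    simp only [hT, inTangentCoordinates, ContinuousLinearMap.inCoordinates,
      ContinuousLinearMap.comp_apply, id]
    rw [Trivialization.symmL_continuousLinearMapAt _ k₄,
      Trivialization.symmL_continuousLinearMapAt _ k₅]
  rw [key]
  refine (ContinuousLinearMap.le_opNorm _ _).trans ?_
  have := ((T y).le_opNorm ((trivializationAt E (fun x : M => TangentSpace 𝓘(ℝ, E) x)
    x).continuousLinearMapAt ℝ y v))
  have h6 := (((trivializationAt E (fun x : M => TangentSpace 𝓘(ℝ, E) x)
    x).continuousLinearMapAt ℝ y).le_opNorm v)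
  have hv := norm_nonneg v
  calc _ ≤ C₂ * ((‖T x‖ + 1) * (C₁ * ‖v‖)) := by
        refine mul_le_mul k₂.le (this.trans ?_) (norm_nonneg _) hC₂.le
        refine mul_le_mul k₃.le (h6.trans ?_) (norm_nonneg _) (by positivity)
        gcongr
    _ = _ := by ring

lemma exists_norm_mfderiv_le [CompactSpace M] [IsManifold 𝓘(ℝ, E) 1 M]
    [IsContinuousRiemannianBundle E (fun x : M => TangentSpace 𝓘(ℝ, E) x)] {f : M → M}
    (hf : ContMDiff 𝓘(ℝ, E) 𝓘(ℝ, E) 1 f) :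
    ∃ C : ℝ, ∀ (y : M) (v : TangentSpace 𝓘(ℝ, E) y),
      ‖mfderiv 𝓘(ℝ, E) 𝓘(ℝ, E) f y v‖ ≤ C * ‖v‖ := by
  suffices h : ∃ C : ℝ, ∀ y ∈ (univ : Set M), ∀ v : TangentSpace 𝓘(ℝ, E) y,
      ‖mfderiv 𝓘(ℝ, E) 𝓘(ℝ, E) f y v‖ ≤ C * ‖v‖ by simpa using h
  refine isCompact_univ.induction_on (p := fun s => ∃ C : ℝ, ∀ y ∈ s,
    ∀ v : TangentSpace 𝓘(ℝ, E) y, ‖mfderiv 𝓘(ℝ, E) 𝓘(ℝ, E) f y v‖ ≤ C * ‖v‖) ⟨0, by simp⟩ ?_ ?_ ?_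
  · rintro s t hst ⟨C, hC⟩
    exact ⟨C, fun y hy => hC y (hst hy)⟩
  · rintro s t ⟨C, hC⟩ ⟨C', hC'⟩
    refine ⟨max C C', ?_⟩
    rintro y (hy | hy) v
    · exact (hC y hy v).trans (by gcongr; exact le_max_left _ _)
    · exact (hC' y hy v).trans (by gcongr; exact le_max_right _ _)
  · intro x _
    obtain ⟨C, hC⟩ := eventually_norm_mfderiv_le (hf x)
    exact ⟨_, mem_nhdsWithin_of_mem_nhds hC, C, fun y hy => hy⟩

section MaxStretch

variable [CompactSpace M] [IsManifold 𝓘(ℝ, E) 1 M]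
  [IsContinuousRiemannianBundle E (fun x : M => TangentSpace 𝓘(ℝ, E) x)] {f : M → M}

lemma norm_mfderiv_le_maxStretch (hf : ContMDiff 𝓘(ℝ, E) 𝓘(ℝ, E) 1 f)
    (y : M) (v : TangentSpace 𝓘(ℝ, E) y) :
    ‖mfderiv 𝓘(ℝ, E) 𝓘(ℝ, E) f y v‖ ≤ maxStretch E f * ‖v‖ := by
  obtain ⟨C, hC⟩ := exists_norm_mfderiv_le hf
  rcases eq_or_ne v 0 with rfl | hv
  · simp
  have hv' : 0 < ‖v‖ := norm_pos_iff.2 hv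
  rw [← div_le_iff₀ hv']
  -- A real `sSup` is a supremum only for a set bounded above; the bound `C` comes from compactness.
  refine le_csSup ⟨C, ?_⟩ ⟨y, v, hv, rfl⟩
  rintro r ⟨x, w, hw, rfl⟩
  rw [div_le_iff₀ (norm_pos_iff.2 hw)]
  exact hC x w

lemma IsExpanding.le_maxStretch [Nonempty M] [Nontrivial E] {lam : ℝ}
    (hf : IsExpanding E f lam) : lam ≤ maxStretch E f := by
  obtain ⟨x⟩ := ‹Nonempty M›
  obtain ⟨v, hv⟩ := exists_ne (0 : E)
  let v' : TangentSpace 𝓘(ℝ, E) x := v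
  have hv' : 0 < ‖v'‖ := norm_pos_iff.2 hv
  have h := (hf.le_norm x v').trans (norm_mfderiv_le_maxStretch hf.contMDiff x v')
  exact le_of_mul_le_mul_right h hv'

end MaxStretch

/-! ### Lifting through an expanding map -/

section Lift

variable {f : M → M} {lam : ℝ}

lemma IsExpanding.mfderiv_injective (hf : IsExpanding E f lam) (x : M) :
    Function.Injective (mfderiv 𝓘(ℝ, E) 𝓘(ℝ, E) f x) := by
  rw [injective_iff_map_eq_zero]
  intro v hv
  have h := hf.le_norm x v
  rw [hv, norm_zero] at h
  have h1 := hf.one_lt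
  have : ‖v‖ ≤ 0 := by nlinarith [norm_nonneg v]
  exact norm_le_zero_iff.1 this

/-- Subdivide the path so finely that consecutive points are less than `ρ` apart and lift them one
after another. Each piece costs at most `c` times its length, and lengths add up. Only endpoints are
lifted, so no continuous lift of the path is needed. -/
lemma exists_lift_of_path [IsRiemannianManifold 𝓘(ℝ, E) M] {c : ℝ≥0} {ρ : ℝ≥0∞} (hρ : 0 < ρ)
    (hloc : ∀ x y, edist (f x) y < ρ → ∃ w, f w = y ∧ edist x w ≤ c * edist (f x) y)
    {γ : ℝ → M} (hγ : ContMDiffOn 𝓘(ℝ, ℝ) 𝓘(ℝ, E) 1 γ (Icc 0 1)) {x : M} (hx : f x = γ 0) :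
    ∃ w, f w = γ 1 ∧ edist x w ≤ c * pathELength 𝓘(ℝ, E) γ 0 1 := by
  have huc : UniformContinuousOn γ (Icc 0 1) :=
    isCompact_Icc.uniformContinuousOn_of_continuous hγ.continuousOn
  obtain ⟨δ, hδ, h⟩ := EMetric.uniformContinuousOn_iff.1 huc ρ hρ
  obtain ⟨δ', hδ', hδ'2⟩ := ENNReal.lt_iff_exists_nnreal_btwn.1 hδ
  have hδ'0 : (0 : ℝ) < δ' := by exact_mod_cast hδ'
  obtain ⟨n, hn⟩ := exists_nat_one_div_lt hδ'0
  have hn0 : (0 : ℝ) < n + 1 := by positivity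
  have hmem : ∀ i : ℕ, i ≤ n + 1 → ((i : ℝ) / (n + 1)) ∈ Icc (0 : ℝ) 1 := by
    intro i hi
    refine ⟨by positivity, ?_⟩
    rw [div_le_one hn0]
    exact_mod_cast hi
  have key : ∀ i : ℕ, i ≤ n + 1 → ∃ w, f w = γ ((i : ℝ) / (n + 1)) ∧
      edist x w ≤ c * pathELength 𝓘(ℝ, E) γ 0 ((i : ℝ) / (n + 1)) := by
    intro i
    induction i with
    | zero => intro _; exact ⟨x, by simpa using hx, by simp⟩
    | succ i ih =>
      intro hi
      obtain ⟨w, hw, hxw⟩ := ih (by omega)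
      have hle : (i : ℝ) / (n + 1) ≤ ((i + 1 : ℕ) : ℝ) / (n + 1) := by
        gcongr; simp
      have hsub : Icc ((i : ℝ) / (n + 1)) (((i + 1 : ℕ) : ℝ) / (n + 1)) ⊆ Icc 0 1 :=
        Icc_subset_Icc (hmem i (by omega)).1 (hmem (i + 1) hi).2
      have hd : edist (f w) (γ (((i + 1 : ℕ) : ℝ) / (n + 1))) < ρ := by
        rw [hw]
        refine h (hmem i (by omega)) (hmem (i + 1) hi) ?_
        refine lt_of_le_of_lt ?_ hδ'2
        rw [edist_dist, Real.dist_eq, abs_sub_comm, abs_of_nonneg (by linarith)]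
        refine (ENNReal.ofReal_le_ofReal (q := (δ' : ℝ)) ?_).trans (by simp)
        rw [← sub_div]
        push_cast
        rw [add_sub_cancel_left]
        exact hn.le
      obtain ⟨w', hw', hww'⟩ := hloc w _ hd
      refine ⟨w', hw', (edist_triangle x w w').trans ?_⟩
      rw [← pathELength_add (hmem i (by omega)).1 hle, mul_add]
      refine add_le_add hxw (hww'.trans ?_)
      gcongr
      rw [hw, IsRiemannianManifold.out (I := 𝓘(ℝ, E))]
      exact riemannianEDist_le_pathELength (hγ.mono hsub) rfl rfl hle
  have := key (n + 1) le_rfl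
  rwa [show ((n + 1 : ℕ) : ℝ) / (n + 1) = 1 by push_cast; exact div_self hn0.ne'] at this

variable [FiniteDimensional ℝ E] [IsManifold 𝓘(ℝ, E) 1 M]

/-- An expanding map of a compact manifold is uniformly locally injective. -/
lemma IsExpanding.exists_injOn [CompactSpace M] (hf : IsExpanding E f lam) :
    ∃ r : ℝ≥0∞, 0 < r ∧ ∀ x y, edist x y < r → f x = f y → x = y := by
  have hloc : ∀ x : M, ∃ U, IsOpen U ∧ x ∈ U ∧ InjOn f U := by
    intro x
    obtain ⟨g, -, -, -, hg⟩ := exists_contMDiffAt_local_inverse (hf.contMDiff x)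
      (hf.mfderiv_injective x)
    obtain ⟨U, hU, hUo, hxU⟩ := eventually_nhds_iff.1 hg
    refine ⟨U, hUo, hxU, fun a ha b hb hab => ?_⟩
    rw [← hU a ha, ← hU b hb, hab]
  choose U hUo hxU hU using hloc
  obtain ⟨r, hr, h⟩ := lebesgue_number_lemma_of_emetric (isCompact_univ (X := M)) hUo
    (fun x _ => mem_iUnion.2 ⟨x, hxU x⟩)
  refine ⟨r, hr, fun x y hxy hfxy => ?_⟩
  obtain ⟨i, hi⟩ := h x (mem_univ x)
  exact hU i (hi (Metric.mem_eball_self hr)) (hi (by simpa [edist_comm] using hxy)) hfxy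

/-- Near a point, short paths lift through an expanding map, with lengths contracted. -/
lemma IsExpanding.exists_local_lift [IsRiemannianManifold 𝓘(ℝ, E) M]
    (hf : IsExpanding E f lam) (x : M) {c : ℝ≥0} (hc : (c : ℝ) = lam⁻¹) :
    ∃ U ∈ 𝓝 x, ∃ ρ : ℝ≥0∞, 0 < ρ ∧ ∀ x' ∈ U, ∀ y, edist (f x') y < ρ →
      ∃ w, f w = y ∧ edist x' w ≤ c * edist (f x') y := by
  have hlam : 0 < lam := by linarith [hf.one_lt]
  have hc0 : c ≠ 0 := by
    rintro rfl
    simp [hlam.ne] at hc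
  obtain ⟨g, hgx, hgc, hfg, hgf⟩ := exists_contMDiffAt_local_inverse (hf.contMDiff x)
    (hf.mfderiv_injective x)
  have hgc' := (contMDiffAt_iff_contMDiffAt_nhds (by decide)).1 hgc
  obtain ⟨V, hV, hVo, hxV⟩ := eventually_nhds_iff.1 (hgc'.and hfg)
  obtain ⟨ρ, hρ, hball⟩ := EMetric.mem_nhds_iff.1 (hVo.mem_nhds hxV)
  have hder : ∀ y ∈ V, ∀ v : TangentSpace 𝓘(ℝ, E) y,
      ‖mfderiv 𝓘(ℝ, E) 𝓘(ℝ, E) g y v‖ ≤ c * ‖v‖ := by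
    intro y hy v
    have h1 : mfderiv 𝓘(ℝ, E) 𝓘(ℝ, E) (f ∘ g) y = (mfderiv 𝓘(ℝ, E) 𝓘(ℝ, E) f (g y)) ∘L
        (mfderiv 𝓘(ℝ, E) 𝓘(ℝ, E) g y) :=
      mfderiv_comp y ((hf.contMDiff (g y)).mdifferentiableAt one_ne_zero)
        ((hV y hy).1.mdifferentiableAt one_ne_zero)
    have h2 : (f ∘ g) =ᶠ[𝓝 y] id := by
      filter_upwards [hVo.mem_nhds hy] with y' hy'
      exact (hV y' hy').2
    have h3 := hf.le_norm (g y) (mfderiv 𝓘(ℝ, E) 𝓘(ℝ, E) g y v)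
    have h4 : ‖mfderiv 𝓘(ℝ, E) 𝓘(ℝ, E) f (g y) (mfderiv 𝓘(ℝ, E) 𝓘(ℝ, E) g y v)‖ = ‖v‖ := by
      have h5 : (mfderiv 𝓘(ℝ, E) 𝓘(ℝ, E) f (g y) (mfderiv 𝓘(ℝ, E) 𝓘(ℝ, E) g y v) : E) = v := by
        have h6 := congrArg (fun A : E →L[ℝ] E => A v) (h1.symm.trans h2.mfderiv_eq)
        rw [mfderiv_id] at h6
        exact h6
      refine Eq.trans ?_ (norm_tangentSpace_congr (E := E) (hV y hy).2 v)
      exact congrArg (fun u : TangentSpace 𝓘(ℝ, E) (f (g y)) => ‖u‖) h5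
    rw [h4] at h3
    rw [hc, inv_mul_eq_div, le_div_iff₀ hlam]
    linarith
  -- With radius `ρ / 2` on both sides, a path of length less than `ρ / 2` starting at `f x'` stays
  -- in the `ρ`-ball around `f x`, where `g` is a contracting inverse.
  refine ⟨{x' | g (f x') = x'} ∩ f ⁻¹' (Metric.eball (f x) (ρ / 2)), inter_mem hgf
    ((hf.contMDiff x).continuousAt (Metric.eball_mem_nhds _ (ENNReal.half_pos hρ.ne'))),
    ρ / 2, ENNReal.half_pos hρ.ne', ?_⟩
  rintro x' ⟨hx', hx'2⟩ y hy
  refine ⟨g y, (hV y (hball ?_)).2, ?_⟩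
  · rw [mem_preimage, Metric.mem_eball] at hx'2
    rw [Metric.mem_eball]
    calc edist y (f x) ≤ edist y (f x') + edist (f x') (f x) := edist_triangle _ _ _
      _ < ρ / 2 + ρ / 2 := ENNReal.add_lt_add (by rwa [edist_comm]) hx'2
      _ = ρ := ENNReal.add_halves ρ
  rw [mul_comm, ← ENNReal.div_le_iff (by simpa using hc0) ENNReal.coe_ne_top]
  refine le_of_forall_gt_imp_ge_of_dense fun r hr => ?_
  obtain ⟨γ, h0, h1, hγ, hlen⟩ := exists_path_of_edist_lt (E := E) (lt_min hr hy)
  rw [ENNReal.div_le_iff (by simpa using hc0) ENNReal.coe_ne_top, mul_comm]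
  have := edist_le_mul_pathELength hVo (fun y hy => (hV y hy).1.contMDiffWithinAt) hder hγ ?_
  · rw [h0, h1, hx'] at this
    refine this.trans ?_
    gcongr
    exact hlen.le.trans (min_le_left _ _)
  · intro t ht
    apply hball
    rw [mem_preimage, Metric.mem_eball] at hx'2
    rw [Metric.mem_eball]
    have h2 : edist (γ t) (f x') < ρ / 2 := by
      rw [edist_comm, IsRiemannianManifold.out (I := 𝓘(ℝ, E)) (f x') (γ t)]
      refine (riemannianEDist_le_pathELength (hγ.mono (Icc_subset_Icc_right ht.2)) h0 rfl
        ht.1).trans_lt ?_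
      exact (pathELength_mono le_rfl ht.2).trans_lt (hlen.trans_le (min_le_right _ _))
    calc edist (γ t) (f x) ≤ edist (γ t) (f x') + edist (f x') (f x) := edist_triangle _ _ _
      _ < ρ / 2 + ρ / 2 := ENNReal.add_lt_add h2 hx'2
      _ = ρ := ENNReal.add_halves ρ

/-- Through an expanding map of a compact manifold, points at finite distance lift, with
distances contracted. -/
lemma IsExpanding.exists_lift [CompactSpace M] [IsRiemannianManifold 𝓘(ℝ, E) M]
    (hf : IsExpanding E f lam) {c : ℝ≥0} (hc : (c : ℝ) = lam⁻¹) (x y : M)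
    (hxy : edist (f x) y < ⊤) :
    ∃ w, f w = y ∧ edist x w ≤ c * edist (f x) y := by
  have hlam : 0 < lam := by linarith [hf.one_lt]
  have hc0 : c ≠ 0 := by
    rintro rfl
    simp [hlam.ne] at hc
  -- Compactness makes the radius of local lifting uniform.
  obtain ⟨ρ, hρ, hloc⟩ : ∃ ρ : ℝ≥0∞, 0 < ρ ∧ ∀ x' ∈ (univ : Set M), ∀ y, edist (f x') y < ρ →
      ∃ w, f w = y ∧ edist x' w ≤ c * edist (f x') y := by
    refine isCompact_univ.induction_on (p := fun s => ∃ ρ : ℝ≥0∞, 0 < ρ ∧ ∀ x' ∈ s, ∀ y,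
      edist (f x') y < ρ → ∃ w, f w = y ∧ edist x' w ≤ c * edist (f x') y)
      ⟨1, one_pos, by simp⟩ ?_ ?_ ?_
    · rintro s t hst ⟨ρ, hρ, h⟩
      exact ⟨ρ, hρ, fun x' hx' => h x' (hst hx')⟩
    · rintro s t ⟨ρ, hρ, h⟩ ⟨ρ', hρ', h'⟩
      refine ⟨min ρ ρ', lt_min hρ hρ', ?_⟩
      rintro x' (hx' | hx') y hy
      · exact h x' hx' y (hy.trans_le (min_le_left _ _))
      · exact h' x' hx' y (hy.trans_le (min_le_right _ _))
    · intro x _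
      obtain ⟨U, hU, ρ, hρ, h⟩ := hf.exists_local_lift x hc
      exact ⟨U, mem_nhdsWithin_of_mem_nhds hU, ρ, hρ, h⟩
  have happrox : ∀ r, edist (f x) y < r → ∃ w, f w = y ∧ edist x w ≤ c * r := by
    intro r hr
    obtain ⟨γ, h0, rfl, hγ, hlen⟩ := exists_path_of_edist_lt (E := E) hr
    obtain ⟨w, hw, hxw⟩ := exists_lift_of_path hρ (fun x y => hloc x (mem_univ x) y) hγ h0.symm
    exact ⟨w, hw, hxw.trans (by gcongr)⟩
  -- Paths only approximate the distance, so the lifts found so far satisfy the bound with every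
  -- larger `r`. A nearest point of the compact fibre satisfies all these bounds at once.
  have hcomp : IsCompact (f ⁻¹' {y}) :=
    (isClosed_singleton.preimage hf.contMDiff.continuous).isCompact
  obtain ⟨w, hw, hmin⟩ := hcomp.exists_isMinOn
    (let ⟨w, hw, _⟩ := happrox ⊤ hxy; ⟨w, hw⟩)
    (continuous_const.edist continuous_id : Continuous fun w => edist x w).continuousOn
  refine ⟨w, hw, ?_⟩
  rw [mul_comm, ← ENNReal.div_le_iff (by simpa using hc0) ENNReal.coe_ne_top]
  refine le_of_forall_gt_imp_ge_of_dense fun r hr => ?_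
  obtain ⟨w', hw', hxw'⟩ := happrox r hr
  rw [ENNReal.div_le_iff (by simpa using hc0) ENNReal.coe_ne_top, mul_comm]
  exact (hmin hw').trans hxw'

end Lift

end Riemannian

end ShrinkingTarget

/-! ### Contracting lifts and the classes of points at finite distance -/

namespace ShrinkingTarget

/-- A Lipschitz self-map which is uniformly locally injective, and through which points at finite
distance lift with distances contracted by the factor `κ < 1`. -/
structure HasContractingLifts {X : Type*} [EMetricSpace X] (f : X → X) (κ L : ℝ≥0) : Prop where
  lipschitz : LipschitzWith L f
  lift : ∀ x y, edist (f x) y < ⊤ → ∃ w, f w = y ∧ edist x w ≤ κ * edist (f x) y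
  locally_injective : ∃ r : ℝ≥0∞, 0 < r ∧ ∀ x y, edist x y < r → f x = f y → x = y
  pos : 0 < κ
  lt_one : κ < 1
  inv_le : κ⁻¹ ≤ L

variable {X : Type*} [EMetricSpace X] {f : X → X} {κ L : ℝ≥0}

lemma exists_pow_mul_lt {κ : ℝ≥0} (hκ : κ < 1) {D ε : ℝ≥0∞} (hD : D ≠ ⊤) (hε : 0 < ε) :
    ∃ p : ℕ, ∀ q, p ≤ q → (κ : ℝ≥0∞) ^ q * D < ε := by
  have h1 : Tendsto (fun n : ℕ => (κ : ℝ≥0∞) ^ n * D) atTop (𝓝 (0 * D)) :=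
    ENNReal.Tendsto.mul_const
      (ENNReal.tendsto_pow_atTop_nhds_zero_of_lt_one (by exact_mod_cast hκ)) (Or.inr hD)
  rw [zero_mul] at h1
  exact eventually_atTop.1 (h1.eventually_lt_const hε)

/-- A finite cover by unit balls leaves finitely many finite distances between centres, and their
sum is a crude bound. This makes the errors of iterated lifts uniform. -/
lemma exists_edist_le_of_lt_top [CompactSpace X] :
    ∃ D : ℝ≥0∞, D ≠ ⊤ ∧ ∀ x y : X, edist x y < ⊤ → edist x y ≤ D := by
  classical
  obtain ⟨t, -, ht⟩ := (isCompact_univ (X := X)).elim_nhds_subcover (fun x => Metric.eball x 1)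
    (fun x _ => Metric.eball_mem_nhds x one_pos)
  refine ⟨1 + (∑ p ∈ t ×ˢ t, if edist p.1 p.2 < ⊤ then edist p.1 p.2 else 0) + 1, ?_, ?_⟩
  · refine ENNReal.add_ne_top.2 ⟨ENNReal.add_ne_top.2 ⟨ENNReal.one_ne_top, ?_⟩,
      ENNReal.one_ne_top⟩
    refine ENNReal.sum_ne_top.2 fun p _ => ?_
    split_ifs with h
    · exact h.ne
    · simp
  · intro x y hxy
    obtain ⟨c, hc, hxc⟩ := mem_iUnion₂.1 (ht (mem_univ x))
    obtain ⟨c', hc', hyc⟩ := mem_iUnion₂.1 (ht (mem_univ y))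
    rw [Metric.mem_eball] at hxc hyc
    have hcc : edist c c' < ⊤ := by
      refine (edist_triangle4 c x y c').trans_lt ?_
      rw [edist_comm c x]
      exact ENNReal.add_lt_top.2 ⟨ENNReal.add_lt_top.2 ⟨hxc.trans_le le_top, hxy⟩,
        hyc.trans_le le_top⟩
    refine (edist_triangle4 x c c' y).trans ?_
    refine add_le_add (add_le_add hxc.le ?_) (by rw [edist_comm]; exact hyc.le)
    have := Finset.single_le_sum (f := fun p : X × X =>
      if edist p.1 p.2 < ⊤ then edist p.1 p.2 else 0) (s := t ×ˢ t) (fun _ _ => zero_le)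
      (Finset.mk_mem_product hc hc')
    simpa [hcc] using this

namespace HasContractingLifts

lemma iterate_lt_top (hf : HasContractingLifts f κ L) (n : ℕ) {x y : X} (h : edist x y < ⊤) :
    edist (f^[n] x) (f^[n] y) < ⊤ :=
  ((hf.lipschitz.iterate n) x y).trans_lt (ENNReal.mul_lt_top ENNReal.coe_lt_top h)

/-- Each of the `n` successive lifts contracts by `κ`, so the new orbit is exponentially close to
the old one in the past and ends exactly at `y`. This is the shadowing tool behind specification,
the covers and the tracing construction. -/
lemma exists_iterate_lift (hf : HasContractingLifts f κ L) (n : ℕ) (x y : X)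
    (h : edist (f^[n] x) y < ⊤) :
    ∃ w, f^[n] w = y ∧
      ∀ t ≤ n, edist (f^[t] x) (f^[t] w) ≤ (κ : ℝ≥0∞) ^ (n - t) * edist (f^[n] x) y := by
  induction n generalizing y with
  | zero =>
    refine ⟨y, rfl, fun t ht => ?_⟩
    obtain rfl : t = 0 := by omega
    simp
  | succ n ih =>
    rw [Function.iterate_succ_apply'] at h
    obtain ⟨w₁, hw₁, hd⟩ := hf.lift _ _ h
    obtain ⟨w, hw, hwd⟩ := ih w₁ (hd.trans_lt (ENNReal.mul_lt_top ENNReal.coe_lt_top h))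
    refine ⟨w, by rw [Function.iterate_succ_apply', hw, hw₁], fun t ht => ?_⟩
    rcases Nat.lt_or_ge n t with h' | h'
    · obtain rfl : t = n + 1 := by omega
      rw [Function.iterate_succ_apply' f n w, hw, hw₁]
      simp
    · refine (hwd t h').trans ?_
      rw [Nat.succ_sub h', pow_succ, mul_assoc, Function.iterate_succ_apply']
      gcongr

/-- Local injectivity is applied backwards from time `n`. Consequently distinct points of one fibre
are separated by `r` at some earlier time. -/
lemma eq_of_iterate_eq {r : ℝ≥0∞} (hr : ∀ x y, edist x y < r → f x = f y → x = y) (n : ℕ)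
    {x y : X} (h : ∀ t < n, edist (f^[t] x) (f^[t] y) < r) (hn : f^[n] x = f^[n] y) : x = y := by
  induction n with
  | zero => simpa using hn
  | succ n ih =>
    refine ih (fun t ht => h t (by omega)) (hr _ _ (h n (by omega)) ?_)
    rwa [← Function.iterate_succ_apply' f, ← Function.iterate_succ_apply' f]

/-- The range is open, since lifting puts in it every point at finite distance from one of its
points, and closed by compactness. It is forward invariant, so transitivity leaves no room for its
complement. -/
lemma surjective [CompactSpace X] [Nonempty X] (hf : HasContractingLifts f κ L)
    (htrans : IsTransitive f) : Function.Surjective f := by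
  have hopen : IsOpen (range f) := by
    rw [EMetric.isOpen_iff]
    rintro _ ⟨x, rfl⟩
    refine ⟨⊤, ENNReal.coe_lt_top (r := 0) , fun y hy => ?_⟩
    rw [Metric.mem_eball, edist_comm] at hy
    obtain ⟨w, hw, -⟩ := hf.lift x y hy
    exact ⟨w, hw⟩
  have hclosed : IsClosed (range f) := (isCompact_range hf.lipschitz.continuous).isClosed
  by_contra hns
  have hne : (range f)ᶜ.Nonempty := by
    rw [nonempty_compl]
    exact fun h => hns (range_eq_univ.1 h)
  obtain ⟨n, y, ⟨_, ⟨x, rfl⟩, rfl⟩, hy⟩ :=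
    htrans (range f) (range f)ᶜ hopen (range_nonempty f) hclosed.isOpen_compl hne
  apply hy
  rw [← Function.iterate_succ_apply, Function.iterate_succ_apply']
  exact mem_range_self _

/-- The finitely many classes of points at finite distance of each other are met by a finite
set. -/
lemma finite_quotient [CompactSpace X] : Finite (Quotient (Metric.edistLtTopSetoid (α := X))) := by
  obtain ⟨t, -, ht⟩ := (isCompact_univ (X := X)).elim_nhds_subcover (fun x => Metric.eball x ⊤)
    (fun x _ => Metric.eball_mem_nhds x (ENNReal.coe_lt_top (r := 0)))
  refine Finite.of_surjective (fun c : t => Quotient.mk Metric.edistLtTopSetoid c.1) ?_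
  intro q
  induction q using Quotient.inductionOn with
  | h x =>
    obtain ⟨c, hc, hxc⟩ := mem_iUnion₂.1 (ht (mem_univ x))
    refine ⟨⟨c, hc⟩, Quotient.sound ?_⟩
    show edist c x < ⊤
    rw [edist_comm]
    exact hxc

lemma edist_out_lt_top (x : X) : edist (Quotient.mk Metric.edistLtTopSetoid x).out x < ⊤ :=
  show Metric.edistLtTopSetoid.r _ _ from
    Quotient.exact (Quotient.out_eq (Quotient.mk Metric.edistLtTopSetoid x))

/-- The map induced on the finite set of classes is surjective, hence injective. -/
lemma edist_lt_top_of_map [CompactSpace X] [Nonempty X] (hf : HasContractingLifts f κ L)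
    (htrans : IsTransitive f) {x y : X} (h : edist (f x) (f y) < ⊤) : edist x y < ⊤ := by
  have := finite_quotient (X := X)
  let F : Quotient (Metric.edistLtTopSetoid (α := X)) → Quotient (Metric.edistLtTopSetoid (α := X)) :=
    Quotient.map f (fun a b hab => hf.iterate_lt_top 1 hab)
  have hF : Function.Surjective F := by
    intro q
    induction q using Quotient.inductionOn with
    | h x =>
      obtain ⟨w, hw⟩ := hf.surjective htrans x
      exact ⟨Quotient.mk _ w, congrArg (Quotient.mk _) hw⟩
  have hinj : Function.Injective F := Finite.injective_iff_surjective.2 hF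
  have : F (Quotient.mk _ x) = F (Quotient.mk _ y) := Quotient.sound h
  exact Quotient.exact (hinj this)

lemma edist_lt_top_of_iterate [CompactSpace X] [Nonempty X] (hf : HasContractingLifts f κ L)
    (htrans : IsTransitive f) (n : ℕ) {x y : X} (h : edist (f^[n] x) (f^[n] y) < ⊤) :
    edist x y < ⊤ := by
  induction n with
  | zero => exact h
  | succ n ih =>
    rw [Function.iterate_succ_apply', Function.iterate_succ_apply'] at h
    exact ih (hf.edist_lt_top_of_map htrans h)

/-- Some iterate of bounded order maps a given class to a given point. -/
lemma exists_iterate_eq [CompactSpace X] (hf : HasContractingLifts f κ L)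
    (htrans : IsTransitive f) :
    ∃ N : ℕ, ∀ x y : X, ∃ i ≤ N, ∃ w, f^[i] w = y ∧ edist x w < ⊤ := by
  have := finite_quotient (X := X)
  have h0 : ∀ x y : X, ∃ i, ∃ w, f^[i] w = y ∧ edist x w < ⊤ := by
    intro x y
    obtain ⟨i, _, ⟨w, hw, rfl⟩, hwy⟩ := htrans (Metric.eball x ⊤) (Metric.eball y ⊤)
      Metric.isOpen_eball ⟨x, Metric.mem_eball_self (ENNReal.coe_lt_top (r := 0))⟩
      Metric.isOpen_eball ⟨y, Metric.mem_eball_self (ENNReal.coe_lt_top (r := 0))⟩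
    rw [Metric.mem_eball] at hw hwy
    obtain ⟨w', hw', hd⟩ := hf.exists_iterate_lift i w y hwy
    refine ⟨i, w', hw', (edist_triangle x w w').trans_lt (ENNReal.add_lt_top.2
      ⟨by rwa [edist_comm], ?_⟩)⟩
    refine (hd 0 (Nat.zero_le _)).trans_lt (ENNReal.mul_lt_top ?_ hwy)
    exact ENNReal.pow_lt_top ENNReal.coe_lt_top
  choose i hi using h0
  -- One pair of representatives for each pair of classes suffices, so finitely many times have to
  -- be bounded.
  obtain ⟨N, hN⟩ : ∃ N : ℕ, ∀ q : Quotient (Metric.edistLtTopSetoid (α := X)) ×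
      Quotient (Metric.edistLtTopSetoid (α := X)), i q.1.out q.2.out ≤ N := by
    obtain ⟨N, hN⟩ := (Set.finite_range fun q : Quotient (Metric.edistLtTopSetoid (α := X)) ×
      Quotient (Metric.edistLtTopSetoid (α := X)) => i q.1.out q.2.out).bddAbove
    exact ⟨N, fun q => hN (mem_range_self q)⟩
  refine ⟨N, fun x y => ?_⟩
  have hx : edist (Quotient.mk Metric.edistLtTopSetoid x).out x < ⊤ :=
    edist_out_lt_top _
  have hy : edist (Quotient.mk Metric.edistLtTopSetoid y).out y < ⊤ :=
    edist_out_lt_top _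
  refine ⟨_, hN (Quotient.mk _ x, Quotient.mk _ y), ?_⟩
  obtain ⟨w, hw, hxw⟩ := hi (Quotient.mk Metric.edistLtTopSetoid x).out
    (Quotient.mk Metric.edistLtTopSetoid y).out
  rw [← hw] at hy
  obtain ⟨w', hw', hd⟩ := hf.exists_iterate_lift _ w y hy
  refine ⟨w', hw', (edist_triangle4 x (Quotient.mk Metric.edistLtTopSetoid x).out w w').trans_lt ?_⟩
  refine ENNReal.add_lt_top.2 ⟨ENNReal.add_lt_top.2 ⟨by rwa [edist_comm], hxw⟩, ?_⟩
  refine (hd 0 (Nat.zero_le _)).trans_lt (ENNReal.mul_lt_top ?_ hy)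
  exact ENNReal.pow_lt_top ENNReal.coe_lt_top

end HasContractingLifts

section Count

variable {α β : Type*}

lemma ncard_preimage_le {g : α → β} {s : Set β} (hs : s.Finite) {b : ℕ}
    (hb : ∀ w ∈ s, (g ⁻¹' {w}).Finite ∧ (g ⁻¹' {w}).ncard ≤ b) :
    (g ⁻¹' s).Finite ∧ (g ⁻¹' s).ncard ≤ s.ncard * b := by
  classical
  have hfin : (g ⁻¹' s).Finite := Set.Finite.preimage' hs (fun w hw => (hb w hw).1)
  refine ⟨hfin, ?_⟩
  rw [Set.ncard_eq_toFinset_card _ hfin, Set.ncard_eq_toFinset_card _ hs, mul_comm]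
  refine Finset.card_le_mul_card_image_of_maps_to (f := g) (by simp) b fun w hw => ?_
  rw [Set.Finite.mem_toFinset] at hw
  refine le_trans ?_ (hb w hw).2
  rw [← Set.ncard_coe_finset]
  refine Set.ncard_le_ncard ?_ (hb w hw).1
  intro x hx
  simp at hx
  exact hx.2

lemma le_ncard_preimage {g : α → β} {s : Set β} (hs : s.Finite) {b : ℕ}
    (hfin : (g ⁻¹' s).Finite) (hb : ∀ w ∈ s, b ≤ (g ⁻¹' {w}).ncard) :
    s.ncard * b ≤ (g ⁻¹' s).ncard := by
  classical
  rw [Set.ncard_eq_toFinset_card _ hfin, Set.ncard_eq_toFinset_card _ hs, mul_comm]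
  refine Finset.mul_card_image_le_card_of_maps_to (f := g) (by simp) b fun w hw => ?_
  rw [Set.Finite.mem_toFinset] at hw
  refine (hb w hw).trans ?_
  rw [← Set.ncard_coe_finset]
  refine Set.ncard_le_ncard ?_ (Finset.finite_toSet _)
  intro x hx
  have hx' : g x = w := hx
  simp [hx', hw]

end Count

end ShrinkingTarget

/-! ### Exponential growth of the fibres -/

namespace ShrinkingTarget

lemma preimage_iterate_add {X : Type*} (f : X → X) (r s : ℕ) (y : X) :
    f^[r + s] ⁻¹' {y} = f^[s] ⁻¹' (f^[r] ⁻¹' {y}) := by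
  rw [Function.iterate_add, preimage_comp]

variable {X : Type*} [EMetricSpace X] {f : X → X} {κ L : ℝ≥0}

namespace HasContractingLifts

/-- Two preimages in the same ball of radius `r₀ / 2` coincide, so a finite cover by such balls
bounds the fibres of `f`, and the fibres of iterates multiply. -/
lemma exists_ncard_preimage_le [CompactSpace X] [Nonempty X] (hf : HasContractingLifts f κ L) :
    ∃ B : ℕ, 1 ≤ B ∧ ∀ r y, (f^[r] ⁻¹' {y}).Finite ∧ (f^[r] ⁻¹' {y}).ncard ≤ B ^ r := by
  obtain ⟨r₀, hr₀, hinj⟩ := hf.locally_injective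
  obtain ⟨t, -, ht⟩ := (isCompact_univ (X := X)).elim_nhds_subcover
    (fun x => Metric.eball x (r₀ / 2))
    (fun x _ => Metric.eball_mem_nhds x (ENNReal.half_pos hr₀.ne'))
  have hc : ∀ x : X, ∃ c ∈ t, edist x c < r₀ / 2 := by
    intro x
    obtain ⟨c, hc, hxc⟩ := mem_iUnion₂.1 (ht (mem_univ x))
    exact ⟨c, hc, hxc⟩
  choose c hct hc using hc
  have hone : ∀ y, (f ⁻¹' {y}).Finite ∧ (f ⁻¹' {y}).ncard ≤ t.card := by
    intro y
    have hio : InjOn c (f ⁻¹' {y}) := by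
      intro a ha b hb hab
      refine hinj a b ?_ (Eq.trans ha (Eq.symm hb))
      refine (edist_triangle a (c a) b).trans_lt ?_
      rw [← ENNReal.add_halves r₀]
      refine ENNReal.add_lt_add (hc a) ?_
      rw [hab, edist_comm]
      exact hc b
    have hmaps : MapsTo c (f ⁻¹' {y}) t := fun a _ => hct a
    refine ⟨Set.Finite.of_injOn hmaps hio t.finite_toSet, ?_⟩
    rw [← Set.ncard_coe_finset t]
    exact Set.ncard_le_ncard_of_injOn c hmaps hio t.finite_toSet
  refine ⟨t.card, ?_, ?_⟩
  · obtain ⟨x⟩ := ‹Nonempty X›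
    exact Finset.card_pos.2 ⟨c x, hct x⟩
  · intro r
    induction r with
    | zero => intro y; simp
    | succ r ih =>
      intro y
      rw [preimage_iterate_add]
      obtain ⟨h1, h2⟩ := ncard_preimage_le (ih y).1 (g := f^[1]) (fun w _ => hone w)
      refine ⟨h1, h2.trans ?_⟩
      rw [pow_succ]
      exact Nat.mul_le_mul_right _ (ih y).2

lemma preimage_finite [CompactSpace X] [Nonempty X] (hf : HasContractingLifts f κ L) (r : ℕ)
    (y : X) : (f^[r] ⁻¹' {y}).Finite := by
  obtain ⟨B, -, hB⟩ := hf.exists_ncard_preimage_le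
  exact (hB r y).1

lemma one_le_ncard_preimage [CompactSpace X] [Nonempty X] (hf : HasContractingLifts f κ L)
    (htrans : IsTransitive f) (r : ℕ) (y : X) : 1 ≤ (f^[r] ⁻¹' {y}).ncard := by
  rw [Nat.one_le_iff_ne_zero, Ne, Set.ncard_eq_zero (hf.preimage_finite r y), ← Ne,
    ← Set.nonempty_iff_ne_empty]
  exact ((hf.surjective htrans).iterate r) y

/-- Each point `u` over `y'` is sent to a shadowing point over `y`. Two points with the same image
stay `r₀`-close until time `r - p`, where `κ ^ p * D < r₀ / 2`; recording `f^[r - p] u` as well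
makes the map injective. The extra datum costs a factor `B ^ p`, independent of `r`. -/
lemma exists_ncard_le_of_edist_lt_top [CompactSpace X] [Nonempty X]
    (hf : HasContractingLifts f κ L) (htrans : IsTransitive f) :
    ∃ C : ℕ, ∀ r y y', edist y y' < ⊤ →
      (f^[r] ⁻¹' {y'}).ncard ≤ C * (f^[r] ⁻¹' {y}).ncard := by
  obtain ⟨B, hB1, hB⟩ := hf.exists_ncard_preimage_le
  obtain ⟨r₀, hr₀, hinj⟩ := hf.locally_injective
  obtain ⟨D, hD, hDle⟩ := exists_edist_le_of_lt_top (X := X)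
  obtain ⟨p, hp⟩ := exists_pow_mul_lt hf.lt_one hD (ENNReal.half_pos hr₀.ne')
  refine ⟨B ^ p, fun r y y' hyy' => ?_⟩
  rcases Nat.lt_or_ge r p with hrp | hrp
  · calc (f^[r] ⁻¹' {y'}).ncard ≤ B ^ r := (hB r y').2
      _ ≤ B ^ p := Nat.pow_le_pow_right hB1 hrp.le
      _ = B ^ p * 1 := (mul_one _).symm
      _ ≤ _ := Nat.mul_le_mul_left _ (hf.one_le_ncard_preimage htrans r y)
  have hlift : ∀ u : X, ∃ w, f^[r] u = y' → f^[r] w = y ∧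
      ∀ t ≤ r, edist (f^[t] u) (f^[t] w) ≤ (κ : ℝ≥0∞) ^ (r - t) * D := by
    intro u
    by_cases hu : f^[r] u = y'
    · have h1 : edist (f^[r] u) y < ⊤ := by rwa [hu, edist_comm]
      obtain ⟨w, hw, hd⟩ := hf.exists_iterate_lift r u y h1
      exact ⟨w, fun _ => ⟨hw, fun t ht => (hd t ht).trans (by gcongr; exact hDle _ _ h1)⟩⟩
    · exact ⟨u, fun h => absurd h hu⟩
  choose Φ hΦ using hlift
  have hmaps : MapsTo (fun u => (f^[r - p] u, Φ u)) (f^[r] ⁻¹' {y'})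
      ((f^[p] ⁻¹' {y'}) ×ˢ (f^[r] ⁻¹' {y})) := by
    intro u hu
    refine ⟨?_, (hΦ u hu).1⟩
    show f^[p] (f^[r - p] u) = y'
    rw [← Function.iterate_add_apply, Nat.add_sub_cancel' hrp]
    exact hu
  have hio : InjOn (fun u => (f^[r - p] u, Φ u)) (f^[r] ⁻¹' {y'}) := by
    intro a ha b hb hab
    simp only [Prod.mk.injEq] at hab
    refine eq_of_iterate_eq hinj (r - p) (fun t ht => ?_) hab.1
    refine (edist_triangle _ (f^[t] (Φ a)) _).trans_lt ?_
    rw [← ENNReal.add_halves r₀]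
    refine ENNReal.add_lt_add ?_ ?_
    · exact ((hΦ a ha).2 t (by omega)).trans_lt (hp _ (by omega))
    · rw [hab.2, edist_comm]
      exact ((hΦ b hb).2 t (by omega)).trans_lt (hp _ (by omega))
  calc (f^[r] ⁻¹' {y'}).ncard ≤ ((f^[p] ⁻¹' {y'}) ×ˢ (f^[r] ⁻¹' {y})).ncard :=
        Set.ncard_le_ncard_of_injOn _ hmaps hio ((hB p y').1.prod (hB r y).1)
    _ = (f^[p] ⁻¹' {y'}).ncard * (f^[r] ⁻¹' {y}).ncard := Set.ncard_prod
    _ ≤ _ := Nat.mul_le_mul_right _ (hB p y').2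

/-- Some `w` in the class of `y'` reaches `y` after `i ≤ N` steps, so the fibre of order `r - i`
over `w` embeds in that of order `r` over `y`. The comparison within a class applies to `w` and
`y'`, and the shift of order costs at most `B ^ N`. -/
lemma exists_ncard_le [CompactSpace X] [Nonempty X]
    (hf : HasContractingLifts f κ L) (htrans : IsTransitive f) :
    ∃ C : ℕ, ∀ r y y', (f^[r] ⁻¹' {y'}).ncard ≤ C * (f^[r] ⁻¹' {y}).ncard := by
  obtain ⟨B, hB1, hB⟩ := hf.exists_ncard_preimage_le
  obtain ⟨C, hC⟩ := hf.exists_ncard_le_of_edist_lt_top htrans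
  obtain ⟨N, hN⟩ := hf.exists_iterate_eq htrans
  refine ⟨(C + 1) * B ^ N, fun r y y' => ?_⟩
  obtain ⟨i, hi, w, hw, hyw⟩ := hN y' y
  rcases Nat.lt_or_ge r i with hri | hri
  · calc (f^[r] ⁻¹' {y'}).ncard ≤ B ^ r := (hB r y').2
      _ ≤ B ^ N := Nat.pow_le_pow_right hB1 (by omega)
      _ = 1 * B ^ N * 1 := by ring
      _ ≤ _ := Nat.mul_le_mul (Nat.mul_le_mul_right _ (by omega))
        (hf.one_le_ncard_preimage htrans r y)
  · have h1 : (f^[r] ⁻¹' {y'}).ncard ≤ (f^[r - i] ⁻¹' {y'}).ncard * B ^ N := by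
      obtain ⟨j, rfl⟩ : ∃ j, r = j + i := ⟨r - i, by omega⟩
      rw [preimage_iterate_add, Nat.add_sub_cancel]
      refine (ncard_preimage_le (hB j y').1 (fun w _ => hB i w)).2.trans ?_
      exact Nat.mul_le_mul_left _ (Nat.pow_le_pow_right hB1 hi)
    have h2 : (f^[r - i] ⁻¹' {w}).ncard ≤ (f^[r] ⁻¹' {y}).ncard := by
      refine Set.ncard_le_ncard ?_ (hB r y).1
      intro u hu
      have hu' : f^[r - i] u = w := hu
      show f^[r] u = y
      rw [← hw, ← hu', ← Function.iterate_add_apply, Nat.add_sub_cancel' hri]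
    have h3 := hC (r - i) w y' (by rwa [edist_comm])
    calc (f^[r] ⁻¹' {y'}).ncard ≤ (C * (f^[r - i] ⁻¹' {w}).ncard) * B ^ N :=
          h1.trans (Nat.mul_le_mul_right _ h3)
      _ ≤ ((C + 1) * (f^[r] ⁻¹' {y}).ncard) * B ^ N := by gcongr; omega
      _ = _ := by ring

/-- The number of preimages of a point under the iterates grows exactly exponentially. -/
lemma exists_growth [CompactSpace X] [Nonempty X]
    (hf : HasContractingLifts f κ L) (htrans : IsTransitive f) :
    ∃ h K : ℝ, 0 ≤ h ∧ 1 ≤ K ∧ ∀ (r : ℕ) (y : X), Real.exp (h * r) ≤ K * (f^[r] ⁻¹' {y}).ncard ∧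
      ((f^[r] ⁻¹' {y}).ncard : ℝ) ≤ K * Real.exp (h * r) := by
  obtain ⟨C, hC⟩ := hf.exists_ncard_le htrans
  obtain ⟨B, hB1, hB⟩ := hf.exists_ncard_preimage_le
  obtain ⟨y₀⟩ := ‹Nonempty X›
  have : Nonempty X := ⟨y₀⟩
  have hone := fun r y => hf.one_le_ncard_preimage htrans r y
  have hC1 : 1 ≤ C := by
    have := hC 0 y₀ y₀
    have h1 := hone 0 y₀
    by_contra h
    obtain rfl : C = 0 := by omega
    omega
  have hC0 : (0 : ℝ) < C := by exact_mod_cast hC1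
  set a : ℕ → ℝ := fun r => ((f^[r] ⁻¹' {y₀}).ncard : ℝ) with ha
  have ha1 : ∀ r, 1 ≤ a r := fun r => by simp only [ha]; exact_mod_cast hone r y₀
  have ha0 : ∀ r, 0 < a r := fun r => by linarith [ha1 r]
  have hup : ∀ r s, a (r + s) ≤ C * (a r * a s) := by
    intro r s
    have h1 : (f^[r + s] ⁻¹' {y₀}).ncard ≤
        (f^[r] ⁻¹' {y₀}).ncard * (C * (f^[s] ⁻¹' {y₀}).ncard) := by
      rw [preimage_iterate_add]
      exact (ncard_preimage_le (hB r y₀).1 (fun w _ => ⟨(hB s w).1, hC s y₀ w⟩)).2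
    have h2 : a (r + s) ≤ a r * (C * a s) := by simp only [ha]; exact_mod_cast h1
    linarith
  have hlow : ∀ r s, a r * a s ≤ C * a (r + s) := by
    intro r s
    have h1 : (f^[r] ⁻¹' {y₀}).ncard * (f^[s] ⁻¹' {y₀}).ncard ≤
        C * (f^[r + s] ⁻¹' {y₀}).ncard := by
      -- The smallest fibre of order `s` bounds all the others from below.
      have hex : ∃ w, ∀ w', (f^[s] ⁻¹' {w}).ncard ≤ (f^[s] ⁻¹' {w'}).ncard := by
        obtain ⟨w, hw⟩ := WellFounded.has_min (measure fun w : X => (f^[s] ⁻¹' {w}).ncard).wf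
          univ ⟨y₀, mem_univ _⟩
        exact ⟨w, fun w' => not_lt.1 (hw.2 w' (mem_univ _))⟩
      obtain ⟨w, hw⟩ := hex
      have h3 := le_ncard_preimage (g := f^[s]) (hB r y₀).1
        (by rw [← preimage_iterate_add]; exact (hB _ _).1) (fun w' _ => hw w')
      rw [← preimage_iterate_add] at h3
      calc _ ≤ (f^[r] ⁻¹' {y₀}).ncard * (C * (f^[s] ⁻¹' {w}).ncard) :=
            Nat.mul_le_mul_left _ (hC s w y₀)
        _ = C * ((f^[r] ⁻¹' {y₀}).ncard * (f^[s] ⁻¹' {w}).ncard) := by ring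
        _ ≤ _ := Nat.mul_le_mul_left _ h3
    simp only [ha]; exact_mod_cast h1
  set u : ℕ → ℝ := fun r => Real.log (a r) + Real.log C with hu
  have hsub : Subadditive u := by
    intro r s
    have := Real.log_le_log (ha0 _) (hup r s)
    rw [Real.log_mul hC0.ne' (mul_pos (ha0 r) (ha0 s)).ne',
      Real.log_mul (ha0 r).ne' (ha0 s).ne'] at this
    simp only [hu]; linarith
  -- Both `log a + log C` and `-log a + log C` are subadditive. Fekete's lemma for the two sequences
  -- bounds `log a r - h * r` from both sides by `log C`, which is stronger than the mere existence
  -- of a growth rate.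
  set v : ℕ → ℝ := fun r => -Real.log (a r) + Real.log C with hv
  have hsub' : Subadditive v := by
    intro r s
    have := Real.log_le_log (mul_pos (ha0 r) (ha0 s)) (hlow r s)
    rw [Real.log_mul hC0.ne' (ha0 _).ne',
      Real.log_mul (ha0 r).ne' (ha0 s).ne'] at this
    simp only [hv]; linarith
  have hlogC : 0 ≤ Real.log C := Real.log_nonneg (by exact_mod_cast hC1)
  have hu0 : ∀ r, 0 ≤ u r := fun r => add_nonneg (Real.log_nonneg (ha1 r)) hlogC
  have hbdd : BddBelow (range fun n => u n / n) := by
    refine ⟨0, ?_⟩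
    rintro _ ⟨n, rfl⟩
    exact div_nonneg (hu0 n) (Nat.cast_nonneg n)
  have hlim := hsub.tendsto_lim hbdd
  set h := hsub.lim with hh
  have hh0 : 0 ≤ h := ge_of_tendsto' hlim fun n => div_nonneg (hu0 n) (Nat.cast_nonneg n)
  have hloga : Tendsto (fun n : ℕ => v n / n) atTop (𝓝 (-h)) := by
    have h1 : Tendsto (fun n : ℕ => (2 * Real.log C) / (n : ℝ)) atTop (𝓝 0) :=
      tendsto_const_div_atTop_nhds_zero_nat _
    have h2 := h1.sub hlim
    rw [zero_sub] at h2
    refine h2.congr fun n => ?_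
    simp only [hu, hv]; ring
  have hbdd' : BddBelow (range fun n => v n / n) := hloga.bddBelow_range
  have hlim' : hsub'.lim = -h := tendsto_nhds_unique (hsub'.tendsto_lim hbdd') hloga
  have hA : ∀ r : ℕ, Real.exp (h * r) ≤ C * a r := by
    intro r
    rcases Nat.eq_zero_or_pos r with rfl | hr
    · have : (1 : ℝ) ≤ C := by exact_mod_cast hC1
      simp only [Nat.cast_zero, mul_zero, Real.exp_zero]
      nlinarith [ha1 0]
    have hr0 : (0 : ℝ) < r := by exact_mod_cast hr
    have h1 := hsub.lim_le_div hbdd hr.ne'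
    rw [le_div_iff₀ hr0] at h1
    rw [← Real.le_log_iff_exp_le (by have := ha0 r; positivity),
      Real.log_mul hC0.ne' (ha0 r).ne']
    simp only [hu] at h1
    linarith
  have hA' : ∀ r : ℕ, a r ≤ C * Real.exp (h * r) := by
    intro r
    rcases Nat.eq_zero_or_pos r with rfl | hr
    · have : (1 : ℝ) ≤ C := by exact_mod_cast hC1
      simp [ha]
      exact_mod_cast hC1
    have hr0 : (0 : ℝ) < r := by exact_mod_cast hr
    have h1 := hsub'.lim_le_div hbdd' hr.ne'
    rw [hlim', le_div_iff₀ hr0] at h1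
    rw [← Real.log_le_log_iff (ha0 r) (by positivity), Real.log_mul hC0.ne' (Real.exp_pos _).ne',
      Real.log_exp]
    simp only [hv] at h1
    linarith
  have hCC : ∀ r y y', ((f^[r] ⁻¹' {y'}).ncard : ℝ) ≤ C * ((f^[r] ⁻¹' {y}).ncard : ℝ) :=
    fun r y y' => by exact_mod_cast hC r y y'
  refine ⟨h, (C : ℝ) * C, hh0, ?_, fun r y => ⟨?_, ?_⟩⟩
  · have : (1 : ℝ) ≤ C := by exact_mod_cast hC1
    nlinarith
  · calc Real.exp (h * r) ≤ C * a r := hA r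
      _ ≤ C * (C * ((f^[r] ⁻¹' {y}).ncard : ℝ)) := by
          gcongr; exact hCC r y y₀
      _ = _ := by ring
  · calc ((f^[r] ⁻¹' {y}).ncard : ℝ) ≤ C * a r := hCC r y₀ y
      _ ≤ C * (C * Real.exp (h * r)) := by gcongr; exact hA' r
      _ = _ := by ring

end HasContractingLifts

end ShrinkingTarget

/-! ### Topological entropy, specification and periodic pieces -/

namespace ShrinkingTarget

variable {X : Type*} [EMetricSpace X] {f : X → X} {κ L : ℝ≥0}

lemma exists_finset_edist_lt_top [CompactSpace X] : ∃ t : Finset X, ∀ x, ∃ c ∈ t, edist x c < ⊤ := by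
  obtain ⟨t, -, ht⟩ := (isCompact_univ (X := X)).elim_nhds_subcover (fun x => Metric.eball x ⊤)
    (fun x _ => Metric.eball_mem_nhds x (ENNReal.coe_lt_top (r := 0)))
  refine ⟨t, fun x => ?_⟩
  obtain ⟨c, hc, hxc⟩ := mem_iUnion₂.1 (ht (mem_univ x))
  exact ⟨c, hc, hxc⟩

lemma coe_pow_eq_ofReal_exp {lam : ℝ} (hlam : 0 < lam) (hκ : (κ : ℝ) = lam⁻¹) (n : ℕ) :
    (κ : ℝ≥0∞) ^ n = ENNReal.ofReal (Real.exp (-(n * Real.log lam))) := by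
  have h1 : Real.exp (-(n * Real.log lam)) = (κ : ℝ) ^ n := by
    rw [hκ, Real.exp_neg, Real.exp_nat_mul, Real.exp_log hlam, inv_pow]
  rw [h1, ENNReal.ofReal_pow κ.coe_nonneg, ENNReal.ofReal_coe_nnreal]

namespace HasContractingLifts

/-- Fibres of order `n + p` over one point per class are dense at scale `ε` for `n` steps, by
lifting; a fibre of order `n` is separated for `n` steps, by local injectivity. Both cardinalities
are `exp (h * n)` up to constants. -/
lemma coverEntropy_eq [CompactSpace X] [Nonempty X] (hf : HasContractingLifts f κ L) {h K : ℝ}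
    (hK1 : 1 ≤ K) (hK : ∀ (r : ℕ) (y : X), Real.exp (h * r) ≤ K * (f^[r] ⁻¹' {y}).ncard ∧
      ((f^[r] ⁻¹' {y}).ncard : ℝ) ≤ K * Real.exp (h * r)) :
    Dynamics.coverEntropy f univ = h := by
  classical
  have hexp : ∀ n : ℕ, EReal.exp ((h : EReal) * (n : EReal)) = ENNReal.ofReal (Real.exp (h * n)) := by
    intro n
    rw [← EReal.exp_coe]
    norm_cast
  refine le_antisymm ?_ ?_
  · refine iSup₂_le fun U hU => ?_
    obtain ⟨ε, hε, hεU⟩ := mem_uniformity_edist.1 hU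
    obtain ⟨D, hD, hDle⟩ := exists_edist_le_of_lt_top (X := X)
    obtain ⟨p, hp⟩ := exists_pow_mul_lt hf.lt_one hD hε
    obtain ⟨T, hT⟩ := exists_finset_edist_lt_top (X := X)
    have hcover : ∀ n, Dynamics.IsDynCoverOf f univ U n
        ((T.biUnion fun c => (hf.preimage_finite (n + p) c).toFinset : Finset X) : Set X) := by
      intro n x _
      obtain ⟨c, hc, hxc⟩ := hT (f^[n + p] x)
      obtain ⟨w, hw, hd⟩ := hf.exists_iterate_lift (n + p) x c hxc
      refine ⟨w, ?_, ?_⟩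
      · simp only [Finset.coe_biUnion, mem_iUnion]
        exact ⟨c, hc, by simpa using hw⟩
      · rw [Dynamics.mem_dynEntourage]
        intro k hk
        refine hεU ((hd k (by omega)).trans_lt ?_)
        refine lt_of_le_of_lt ?_ (hp (n + p - k) (by omega))
        gcongr
        exact hDle _ _ hxc
    have hle : ∀ n, (Dynamics.coverMincard f univ U n : ℝ≥0∞) ≤
        ENNReal.ofReal (T.card * (K * Real.exp (h * p))) *
          EReal.exp ((h : EReal) * (n : EReal)) := by
      intro n
      have h1 := (hcover n).coverMincard_le_card
      have h2 : (T.biUnion fun c => (hf.preimage_finite (n + p) c).toFinset).card ≤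
          ∑ c ∈ T, (f^[n + p] ⁻¹' {c}).ncard := by
        refine Finset.card_biUnion_le.trans (Finset.sum_le_sum fun c _ => ?_)
        rw [← Set.ncard_eq_toFinset_card _ (hf.preimage_finite (n + p) c)]
      have h3 : ((∑ c ∈ T, (f^[n + p] ⁻¹' {c}).ncard : ℕ) : ℝ) ≤
          T.card * (K * Real.exp (h * p)) * Real.exp (h * n) := by
        push_cast
        refine (Finset.sum_le_sum fun c _ => (hK (n + p) c).2).trans ?_
        rw [Finset.sum_const, nsmul_eq_mul]
        push_cast
        rw [mul_add, Real.exp_add]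
        apply le_of_eq; ring
      calc (Dynamics.coverMincard f univ U n : ℝ≥0∞)
          ≤ (((T.biUnion fun c => (hf.preimage_finite (n + p) c).toFinset).card : ℕ∞) : ℝ≥0∞) := by
            exact_mod_cast h1
        _ ≤ ((∑ c ∈ T, (f^[n + p] ⁻¹' {c}).ncard : ℕ) : ℝ≥0∞) := by
            rw [ENat.toENNReal_coe]; exact_mod_cast h2
        _ ≤ _ := by
            rw [hexp, ← ENNReal.ofReal_mul (by positivity), ← ENNReal.ofReal_natCast]
            exact ENNReal.ofReal_le_ofReal h3
    calc Dynamics.coverEntropyEntourage f univ U ≤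
        ExpGrowth.expGrowthSup (fun n : ℕ => EReal.exp ((h : EReal) * (n : EReal))) :=
          ExpGrowth.expGrowthSup_le_of_eventually_le ENNReal.ofReal_ne_top
            (Eventually.of_forall hle)
      _ = h := ExpGrowth.expGrowthSup_exp
  · obtain ⟨r₀, hr₀, hinj⟩ := hf.locally_injective
    obtain ⟨y⟩ := ‹Nonempty X›
    have : Nonempty X := ⟨y⟩
    set U : SetRel X X := {q : X × X | edist q.1 q.2 < r₀ / 2} with hU
    have hUmem : U ∈ uniformity X := edist_mem_uniformity (ENNReal.half_pos hr₀.ne')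
    refine le_trans ?_ (Dynamics.netEntropyEntourage_le_coverEntropy (T := f) (F := univ) hUmem)
    have hnet : ∀ n, Dynamics.IsDynNetIn f univ U n
        ((hf.preimage_finite n y).toFinset : Set X) := by
      intro n
      refine ⟨subset_univ _, ?_⟩
      intro a ha b hb hab
      rw [Function.onFun, Set.disjoint_left]
      intro x hxa hxb
      apply hab
      simp only [Set.Finite.coe_toFinset] at ha hb
      refine eq_of_iterate_eq hinj n (fun t ht => ?_) (Eq.trans ha (Eq.symm hb))
      have h1 := Dynamics.mem_dynEntourage.1 hxa t ht
      have h2 := Dynamics.mem_dynEntourage.1 hxb t ht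
      refine (edist_triangle _ (f^[t] x) _).trans_lt ?_
      rw [← ENNReal.add_halves r₀]
      refine ENNReal.add_lt_add h1 ?_
      rw [edist_comm]; exact h2
    have hge : ∀ n : ℕ, ENNReal.ofReal K⁻¹ * EReal.exp ((h : EReal) * (n : EReal)) ≤
        (Dynamics.netMaxcard f univ U n : ℝ≥0∞) := by
      intro n
      have h1 := (hnet n).card_le_netMaxcard
      rw [← Set.ncard_eq_toFinset_card _ (hf.preimage_finite n y)] at h1
      have h2 : (((f^[n] ⁻¹' {y}).ncard : ℕ∞) : ℝ≥0∞) ≤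
          (Dynamics.netMaxcard f univ U n : ℝ≥0∞) := by exact_mod_cast h1
      refine le_trans ?_ h2
      have hK0 : 0 < K := by linarith
      rw [hexp, ← ENNReal.ofReal_mul (by positivity), ENat.toENNReal_coe,
        ← ENNReal.ofReal_natCast]
      refine ENNReal.ofReal_le_ofReal ?_
      rw [inv_mul_le_iff₀ hK0]
      exact (hK n y).1
    have hK0 : ENNReal.ofReal K⁻¹ ≠ 0 := by
      have : 0 < K⁻¹ := inv_pos.2 (by linarith)
      exact (ENNReal.ofReal_pos.2 this).ne'
    calc (h : EReal) = ExpGrowth.expGrowthSup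
          (fun n : ℕ => EReal.exp ((h : EReal) * (n : EReal))) := ExpGrowth.expGrowthSup_exp.symm
      _ ≤ _ := ExpGrowth.expGrowthSup_of_eventually_ge hK0
          (Eventually.of_forall hge)

/-- Induction by prepending a segment: the point `w` serving the later segments is lifted along the
orbit of `x 0`. The later segments see `w` itself and incur no further error, while the first is
shadowed with the contraction of a single lift. -/
lemma hasExpSpecification [CompactSpace X] (hf : HasContractingLifts f κ L) {lam : ℝ}
    (hlam : 0 < lam) (hκ : (κ : ℝ) = lam⁻¹) {Y : Set X} {N : ℕ} (hN : 0 < N)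
    (hne : Y.Nonempty) (hY : ∀ x ∈ Y, ∀ y, y ∈ Y ↔ edist x y < ⊤) (hmaps : MapsTo f^[N] Y Y)
    {ε : ℝ} (hε : 0 < ε) : HasExpSpecification f^[N] Y (N * Real.log lam) ε := by
  obtain ⟨D, hD, hDle⟩ := exists_edist_le_of_lt_top (X := X)
  obtain ⟨p, hp⟩ := exists_pow_mul_lt hf.lt_one hD (ENNReal.ofReal_pos.2 hε)
  -- The gap has to be positive, whereas `p` may vanish.
  refine ⟨p + 1, by omega, fun k => ?_⟩
  induction k with
  | zero =>
    intro x n q _ _ _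
    obtain ⟨y, hy⟩ := hne
    exact ⟨y, hy, fun i hi => absurd hi (by omega)⟩
  | succ k ih =>
    intro x n q hx hn hq
    obtain ⟨w, hwY, hw⟩ := ih (fun i => x (i + 1)) (fun i => n (i + 1)) (fun i => q (i + 1))
      (fun i hi => hx _ (by omega)) (fun i hi => hn _ (by omega)) (fun i hi => hq _ (by omega))
    have hmapsT : f^[N * (n 0 + q 0)] (x 0) ∈ Y := by
      rw [Function.iterate_mul]
      exact hmaps.iterate _ (hx 0 (by omega))
    have hfin : edist (f^[N * (n 0 + q 0)] (x 0)) w < ⊤ := (hY _ hmapsT w).1 hwY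
    obtain ⟨z, hz, hd⟩ := hf.exists_iterate_lift _ _ _ hfin
    refine ⟨z, ?_, ?_⟩
    · refine (hY _ (hx 0 (by omega)) z).2 ((hd 0 (Nat.zero_le _)).trans_lt ?_)
      exact ENNReal.mul_lt_top (ENNReal.pow_lt_top ENNReal.coe_lt_top) hfin
    · intro i hi
      rcases Nat.eq_zero_or_pos i with rfl | hi0
      · intro t ht
        simp only [Finset.range_zero, Finset.sum_empty, Function.iterate_zero, id]
        rw [← Function.iterate_mul]
        have hn0 := hn 0 (by omega)
        have hq0 := hq 0 (by omega)
        refine (hd (N * t) (Nat.mul_le_mul_left _ (by omega))).trans_lt ?_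
        obtain ⟨m, hm⟩ : ∃ m, n 0 = t + 1 + m := ⟨n 0 - (t + 1), by omega⟩
        -- The first part of the exponent is the required exponential precision; the second, at
        -- least `p`, brings the error below `ε`.
        have hsub : N * (n 0 + q 0) - N * t = N * m + N * (q 0 + 1) := by
          rw [hm, ← Nat.mul_sub, ← Nat.mul_add]
          congr 1
          omega
        rw [hsub, pow_add, mul_assoc]
        have h1 : (κ : ℝ≥0∞) ^ (N * (q 0 + 1)) * edist (f^[N * (n 0 + q 0)] (x 0)) w <
            ENNReal.ofReal ε := by
          refine lt_of_le_of_lt ?_ (hp (N * (q 0 + 1)) (by nlinarith))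
          gcongr
          exact hDle _ _ hfin
        have h2 : ENNReal.ofReal (ε * Real.exp (-((n 0 : ℝ) - 1 - t) * (N * Real.log lam))) =
            (κ : ℝ≥0∞) ^ (N * m) * ENNReal.ofReal ε := by
          rw [coe_pow_eq_ofReal_exp hlam hκ, mul_comm, ENNReal.ofReal_mul (Real.exp_pos _).le]
          congr 3
          rw [hm]
          push_cast
          ring
        rw [h2]
        have hκ0 : (κ : ℝ≥0∞) ^ (N * m) ≠ 0 := pow_ne_zero _ (by simpa using hf.pos.ne')
        exact (ENNReal.mul_lt_mul_iff_right hκ0 (ENNReal.pow_ne_top ENNReal.coe_ne_top)).2 h1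
      · obtain ⟨i, rfl⟩ : ∃ i', i = i' + 1 := ⟨i - 1, by omega⟩
        have := hw i (by omega)
        rw [Finset.sum_range_succ', Function.iterate_add_apply, ← Function.iterate_mul f N (n 0 + q 0),
          hz]
        exact this

/-- The piece is the class of a point `x₀` and `N` a return time to it: by pigeonhole two iterates
of `x₀` share a class, and injectivity on classes pulls this back to `x₀`. -/
lemma exists_isPeriodicPiece [CompactSpace X] [Nonempty X] (hf : HasContractingLifts f κ L)
    (htrans : IsTransitive f) {lam : ℝ} (hlam : 0 < lam) (hκ : (κ : ℝ) = lam⁻¹) :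
    ∃ (Y : Set X) (N : ℕ), IsPeriodicPiece f (Real.log lam) Y N := by
  obtain ⟨x₀⟩ := ‹Nonempty X›
  have : Nonempty X := ⟨x₀⟩
  have := finite_quotient (X := X)
  obtain ⟨N, hN, hret⟩ : ∃ N, 0 < N ∧ edist (f^[N] x₀) x₀ < ⊤ := by
    obtain ⟨i, j, hij, h⟩ := Finite.exists_ne_map_eq_of_infinite
      (fun n : ℕ => Quotient.mk Metric.edistLtTopSetoid (f^[n] x₀))
    have hex : ∀ i j, i < j → edist (f^[i] x₀) (f^[j] x₀) < ⊤ →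
        ∃ N, 0 < N ∧ edist (f^[N] x₀) x₀ < ⊤ := by
      intro i j hij h
      refine ⟨j - i, by omega, ?_⟩
      rw [edist_comm]
      refine hf.edist_lt_top_of_iterate htrans i ?_
      rwa [← Function.iterate_add_apply, Nat.add_sub_cancel' hij.le]
    have h' : edist (f^[i] x₀) (f^[j] x₀) < ⊤ :=
      show Metric.edistLtTopSetoid.r _ _ from Quotient.exact h
    rcases Nat.lt_or_gt_of_ne hij with h1 | h1
    · exact hex i j h1 h'
    · exact hex j i h1 (by rwa [edist_comm])
  have htri : ∀ {a b c : X}, edist a b < ⊤ → edist b c < ⊤ → edist a c < ⊤ := fun h1 h2 =>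
    (edist_triangle _ _ _).trans_lt (ENNReal.add_lt_top.2 ⟨h1, h2⟩)
  have hmaps : MapsTo f^[N] (Metric.eball x₀ ⊤) (Metric.eball x₀ ⊤) := by
    intro x hx
    exact htri (hf.iterate_lt_top N hx) hret
  refine ⟨Metric.eball x₀ ⊤, N, ⟨x₀, Metric.mem_eball_self (ENNReal.coe_lt_top (r := 0))⟩,
    Metric.isClosed_eball_top.isCompact, hN, ?_, ?_, ?_⟩
  · refine Subset.antisymm hmaps.image_subset fun y hy => ?_
    have hy' : edist (f^[N] x₀) y < ⊤ := htri hret (by rw [edist_comm]; exact hy)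
    obtain ⟨w, hw, hd⟩ := hf.exists_iterate_lift N x₀ y hy'
    refine ⟨w, ?_, hw⟩
    rw [Metric.mem_eball, edist_comm]
    exact (hd 0 (Nat.zero_le _)).trans_lt
      (ENNReal.mul_lt_top (ENNReal.pow_lt_top ENNReal.coe_lt_top) hy')
  · refine eq_univ_of_forall fun y => ?_
    obtain ⟨N', hN'⟩ := hf.exists_iterate_eq htrans
    obtain ⟨i, -, w, hw, hxw⟩ := hN' x₀ y
    simp only [mem_iUnion, Finset.mem_range]
    refine ⟨i % N, Nat.mod_lt _ hN, f^[N * (i / N)] w, ?_, ?_⟩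
    · rw [Function.iterate_mul]
      exact hmaps.iterate _ (by rw [Metric.mem_eball, edist_comm]; exact hxw)
    · rw [← Function.iterate_add_apply, Nat.mod_add_div, hw]
  · intro ε hε
    refine hf.hasExpSpecification hlam hκ hN
      ⟨x₀, Metric.mem_eball_self (ENNReal.coe_lt_top (r := 0))⟩ ?_ hmaps hε
    intro x hx y
    rw [Metric.mem_eball] at hx ⊢
    exact ⟨fun h => htri hx (by rwa [edist_comm]), fun h => htri (by rwa [edist_comm]) hx⟩

/-- Under mixing the orbit of `x` is in the class of `x` and in the class of `y` at a common late
time. -/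
lemma edist_lt_top_of_isMixing (hf : HasContractingLifts f κ L) (hmix : IsMixing f) (x y : X) :
    edist x y < ⊤ := by
  have htri : ∀ {a b c : X}, edist a b < ⊤ → edist b c < ⊤ → edist a c < ⊤ := fun h1 h2 =>
    (edist_triangle _ _ _).trans_lt (ENNReal.add_lt_top.2 ⟨h1, h2⟩)
  have hself : ∀ a : X, (Metric.eball a ⊤).Nonempty := fun a =>
    ⟨a, Metric.mem_eball_self (ENNReal.coe_lt_top (r := 0))⟩
  have h : ∀ a, ∃ n₀, ∀ n ≥ n₀, edist (f^[n] x) a < ⊤ := by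
    intro a
    obtain ⟨n₀, hn⟩ := hmix (Metric.eball x ⊤) (Metric.eball a ⊤) Metric.isOpen_eball (hself x)
      Metric.isOpen_eball (hself a)
    refine ⟨n₀, fun n hn' => ?_⟩
    obtain ⟨_, ⟨u, hu, rfl⟩, hua⟩ := hn n hn'
    rw [Metric.mem_eball, edist_comm] at hu
    exact htri (hf.iterate_lt_top n hu) hua
  obtain ⟨n₁, h1⟩ := h x
  obtain ⟨n₂, h2⟩ := h y
  refine htri ?_ (h2 (max n₁ n₂) (le_max_right _ _))
  rw [edist_comm]
  exact h1 _ (le_max_left _ _)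

end HasContractingLifts

/-- Specification with two segments of length one gives an orbit starting near `x` and arriving near
any prescribed `u ∈ Y` after the same number `1 + p` of steps of `f^[N]`. Hence a single iterate of
`x` is at finite distance from all of `Y`. -/
lemma IsPeriodicPiece.edist_lt_top {a : ℝ} {Y : Set X} {N : ℕ} (hY : IsPeriodicPiece f a Y N)
    (hf : HasContractingLifts f κ L) {x y : X} (hx : x ∈ Y) (hy : y ∈ Y) : edist x y < ⊤ := by
  obtain ⟨p, hp, hspec⟩ := hY.spec 1 one_pos
  have key : ∀ u ∈ Y, edist ((f^[N])^[1 + p] x) u < ⊤ := by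
    intro u hu
    obtain ⟨z, -, hz⟩ := hspec 2 (fun i => if i = 0 then x else u) (fun _ => 1) (fun _ => p)
      (fun i _ => by split_ifs <;> assumption) (fun _ _ => one_pos) (fun _ _ => le_rfl)
    have h0 := (hz 0 (by norm_num) 0 one_pos).trans ENNReal.ofReal_lt_top
    have h1 := (hz 1 (by norm_num) 0 one_pos).trans ENNReal.ofReal_lt_top
    simp at h0 h1
    rw [← Function.iterate_mul] at h1 ⊢
    have h2 := hf.iterate_lt_top (N * (1 + p)) h0
    rw [edist_comm] at h1
    exact (edist_triangle _ _ _).trans_lt (ENNReal.add_lt_top.2 ⟨h2, h1⟩)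
  have h1 := key x hx
  rw [edist_comm] at h1
  exact (edist_triangle _ _ _).trans_lt (ENNReal.add_lt_top.2 ⟨h1, key y hy⟩)

lemma infinite_image_of_tendsto {s : ℕ → ℕ} (hs : Tendsto s atTop atTop) {I : Set ℕ}
    (hI : I.Infinite) : (s '' I).Infinite := by
  intro hfin
  obtain ⟨B, hB⟩ := hfin.bddAbove
  obtain ⟨m, hm⟩ := eventually_atTop.1 (hs.eventually_gt_atTop B)
  obtain ⟨i, hi, him⟩ := hI.exists_gt m
  exact absurd (hB (mem_image_of_mem s hi)) (not_le.2 (hm i him.le))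

/-- The index condition yields a class whose images meet all the classes of the targets. -/
lemma IsPeriodicPiece.exists_base_point {a : ℝ} {Y : Set X} {N : ℕ} (hY : IsPeriodicPiece f a Y N)
    (hf : HasContractingLifts f κ L) {z : ℕ → ℕ → X} {s : ℕ → ℕ → ℕ}
    (hs : ∀ j, Tendsto (s j) atTop atTop)
    (hind : (⋂ j, indexDiff f (z j) (s j) Y N).Nonempty) :
    ∃ x₀, ∀ j, {n | n ∈ range (s j) ∧ edist (f^[n] x₀) (z j n) < ⊤}.Infinite := by
  obtain ⟨m, hm⟩ := hind
  rw [mem_iInter] at hm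
  obtain ⟨y₀, hy₀⟩ := hY.nonempty
  -- Since `m = I₁ - I₂` for every `j`, a time congruent to `I₂` plus this shift is congruent to
  -- `I₁` modulo `N`. Adding `N` makes the shift nonnegative.
  refine ⟨f^[(m + N).toNat] y₀, fun j => ?_⟩
  obtain ⟨⟨I₁, I₂⟩, ⟨h1, h2, hinf⟩, hmI⟩ := hm j
  dsimp only at h1 h2 hinf hmI
  refine (infinite_image_of_tendsto (hs j) hinf).mono ?_
  rintro _ ⟨i, ⟨⟨y, hy, hyz⟩, k, hk⟩, rfl⟩
  refine ⟨mem_range_self _, ?_⟩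
  have hk0 : -1 < k := by
    by_contra hcon
    have : k ≤ -1 := by omega
    have hN : (0 : ℤ) < N := by exact_mod_cast hY.pos
    nlinarith
  obtain ⟨k', rfl⟩ : ∃ k' : ℕ, k = (k' : ℤ) := ⟨k.toNat, by omega⟩
  have he : s j i + (m + N).toNat = I₁ + N * (k' + 1) := by
    zify
    rw [Int.toNat_of_nonneg (by omega)]
    linarith
  rw [← Function.iterate_add_apply, he, Function.iterate_add_apply, ← hyz]
  refine hf.iterate_lt_top I₁ (hY.edist_lt_top hf ?_ hy)
  rw [Function.iterate_mul]
  have hmaps : MapsTo f^[N] Y Y := by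
    have := hY.image_eq
    exact mapsTo_iff_image_subset.2 this.subset
  exact hmaps.iterate _ hy₀

end ShrinkingTarget

/-! ### Bowen entropy and its upper bound on target sets -/

namespace ShrinkingTarget

variable {X : Type*} [EMetricSpace X] {f : X → X} {κ L : ℝ≥0}

section Bowen

lemma bowenPreMeasure_le_tsum {s : ℝ≥0} {N : ℕ} {ε : ℝ≥0∞} {Z : Set X} {ι : Type*} [Countable ι]
    (c : ι → X × ℕ) (hN : ∀ i, N ≤ (c i).2) (hZ : Z ⊆ ⋃ i, bowenBall f (c i).2 (c i).1 ε) :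
    bowenPreMeasure f s N ε Z ≤ ∑' i, ENNReal.ofReal (Real.exp (-(s : ℝ) * ((c i).2 : ℝ))) := by
  unfold bowenPreMeasure
  refine iInf_le_of_le (range c) (iInf_le_of_le (countable_range c)
    (iInf_le_of_le ?_ (iInf_le_of_le ?_ ?_)))
  · rintro _ ⟨i, rfl⟩
    exact hN i
  · simpa only [biUnion_range] using hZ
  · exact ENNReal.tsum_le_tsum_comp_of_surjective (f := rangeFactorization c)
      rangeFactorization_surjective
      (fun p : range c => ENNReal.ofReal (Real.exp (-(s : ℝ) * (p.1.2 : ℝ))))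

lemma bowenEntropyAt_le {s : ℝ≥0} {ε : ℝ≥0∞} {Z : Set X} (h : bowenMeasure f s ε Z = 0) :
    bowenEntropyAt f ε Z ≤ s :=
  iInf₂_le s h

lemma bowenPreMeasure_mono {s : ℝ≥0} {N : ℕ} {ε ε' : ℝ≥0∞} (hε : ε' ≤ ε) {Z Z' : Set X}
    (hZ : Z ⊆ Z') : bowenPreMeasure f s N ε Z ≤ bowenPreMeasure f s N ε' Z' := by
  refine le_iInf fun C => le_iInf fun hC => le_iInf fun hN => le_iInf fun hcov => ?_
  refine iInf_le_of_le C (iInf_le_of_le hC (iInf_le_of_le hN (iInf_le_of_le ?_ le_rfl)))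
  refine hZ.trans (hcov.trans (iUnion₂_mono fun p _ y hy i hi => (hy i hi).trans_le hε))

lemma bowenEntropyAt_mono {ε ε' : ℝ≥0∞} (hε : ε' ≤ ε) {Z Z' : Set X}
    (hZ : Z ⊆ Z') : bowenEntropyAt f ε Z ≤ bowenEntropyAt f ε' Z' := by
  refine le_iInf₂ fun s hs => bowenEntropyAt_le ?_
  rw [bowenMeasure, ENNReal.iSup_eq_zero] at hs ⊢
  exact fun N => le_antisymm ((bowenPreMeasure_mono hε hZ).trans (hs N).le) zero_le

lemma bowenEntropy_mono {Z Z' : Set X} (hZ : Z ⊆ Z') : bowenEntropy f Z ≤ bowenEntropy f Z' :=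
  iSup₂_mono fun _ _ => bowenEntropyAt_mono le_rfl hZ

end Bowen

namespace HasContractingLifts

lemma one_lt_inv (hf : HasContractingLifts f κ L) : (1 : ℝ) < (κ : ℝ)⁻¹ :=
  (one_lt_inv₀ (by exact_mod_cast hf.pos)).2 (by exact_mod_cast hf.lt_one)

lemma log_inv_pos (hf : HasContractingLifts f κ L) : 0 < Real.log (κ : ℝ)⁻¹ :=
  Real.log_pos hf.one_lt_inv

lemma log_inv_le (hf : HasContractingLifts f κ L) : Real.log (κ : ℝ)⁻¹ ≤ Real.log L :=
  Real.log_le_log (by linarith [hf.one_lt_inv]) (by exact_mod_cast hf.inv_le)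

lemma one_lt (hf : HasContractingLifts f κ L) : (1 : ℝ) < L :=
  hf.one_lt_inv.trans_le (by exact_mod_cast hf.inv_le)

lemma log_pos (hf : HasContractingLifts f κ L) : 0 < Real.log L := Real.log_pos hf.one_lt

end HasContractingLifts

lemma coe_pow_eq_ofReal_exp_log {L : ℝ≥0} (hL : (0 : ℝ) < L) (n : ℕ) :
    (L : ℝ≥0∞) ^ n = ENNReal.ofReal (Real.exp (n * Real.log L)) := by
  rw [Real.exp_nat_mul, Real.exp_log hL, ENNReal.ofReal_pow L.coe_nonneg, ENNReal.ofReal_coe_nnreal]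

namespace HasContractingLifts

/-- The lift of `z` along the orbit of `x` shadows it up to time `n`. Afterwards the distance, at
most `exp (-n τ)`, grows at most by `L` per step, so it stays small for about `n τ / log L` further
steps. Dropping the last `p` steps brings it down to `κ ^ p`, since `κ⁻¹ ≤ L`. -/
lemma targetSet_subset_bowenBall (hf : HasContractingLifts f κ L) {τ : ℝ} (hτ : 0 ≤ τ)
    {ε : ℝ≥0∞} {p : ℕ} (hp : (κ : ℝ≥0∞) ^ p < ε) {n : ℕ} {x z : X} {r : ℝ}
    (hr : r ≤ Real.exp (-(n * τ))) (hx : edist (f^[n] x) z < ENNReal.ofReal r) :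
    ∃ y, f^[n] y = z ∧ x ∈ bowenBall f (⌊(n : ℝ) * (1 + τ / Real.log L)⌋₊ - p) y ε := by
  have hfin : edist (f^[n] x) z < ⊤ := hx.trans ENNReal.ofReal_lt_top
  have hx' : edist (f^[n] x) z ≤ ENNReal.ofReal (Real.exp (-(n * τ))) :=
    hx.le.trans (ENNReal.ofReal_le_ofReal hr)
  have hκ0 : (0 : ℝ) < (κ : ℝ) := by exact_mod_cast hf.pos
  have hκi : (0 : ℝ) < (κ : ℝ)⁻¹ := inv_pos.2 hκ0
  have hℓ := hf.log_inv_pos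
  have hℓ' := hf.log_pos
  have hle := hf.log_inv_le
  set ℓ := Real.log (κ : ℝ)⁻¹
  set ℓ' := Real.log (L : ℝ)
  obtain ⟨y, hy, hd⟩ := hf.exists_iterate_lift n x z hfin
  refine ⟨y, hy, fun t ht => ?_⟩
  have hnτ : 0 ≤ (n : ℝ) * τ := by positivity
  have ht1 : (t : ℝ) + p ≤ n * (1 + τ / ℓ') := by
    have : t + p ≤ ⌊(n : ℝ) * (1 + τ / ℓ')⌋₊ := by omega
    have h2 := Nat.floor_le (a := (n : ℝ) * (1 + τ / ℓ')) (by positivity)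
    have h3 : ((t + p : ℕ) : ℝ) ≤ (⌊(n : ℝ) * (1 + τ / ℓ')⌋₊ : ℝ) := by exact_mod_cast this
    push_cast at h3
    linarith
  have ht2 : ((t : ℝ) + p - n) * ℓ' ≤ n * τ := by
    have : (t : ℝ) + p - n ≤ n * τ / ℓ' := by
      have : (n : ℝ) * (1 + τ / ℓ') = n + n * τ / ℓ' := by ring
      linarith
    rwa [le_div_iff₀ hℓ'] at this
  have ht3 : ((t : ℝ) + p - n) * ℓ ≤ n * τ := by
    rcases le_total 0 ((t : ℝ) + p - n) with h | h
    · exact (mul_le_mul_of_nonneg_left hle h).trans ht2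
    · exact (mul_nonpos_of_nonpos_of_nonneg h hℓ.le).trans hnτ
  rw [edist_comm]
  refine lt_of_le_of_lt ?_ hp
  rw [coe_pow_eq_ofReal_exp hκi (by simp) p]
  rcases le_total t n with htn | htn
  · refine (hd t htn).trans ?_
    rw [coe_pow_eq_ofReal_exp hκi (by simp) (n - t)]
    calc _ ≤ ENNReal.ofReal (Real.exp (-(((n - t : ℕ) : ℝ) * ℓ))) *
          ENNReal.ofReal (Real.exp (-(n * τ))) := by gcongr
      _ = ENNReal.ofReal (Real.exp (-(((n - t : ℕ) : ℝ) * ℓ) + -(n * τ))) := by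
          rw [← ENNReal.ofReal_mul (Real.exp_pos _).le, Real.exp_add]
      _ ≤ _ := by
          apply ENNReal.ofReal_le_ofReal
          rw [Real.exp_le_exp, Nat.cast_sub htn]
          nlinarith
  · obtain ⟨m, rfl⟩ := Nat.exists_eq_add_of_le htn
    have h1 := (hf.lipschitz.iterate m) (f^[n] x) (f^[n] y)
    rw [← Function.iterate_add_apply, ← Function.iterate_add_apply, hy, add_comm m n] at h1
    refine h1.trans ?_
    rw [ENNReal.coe_pow, coe_pow_eq_ofReal_exp_log (by linarith [hf.one_lt])]
    calc _ ≤ ENNReal.ofReal (Real.exp (m * ℓ')) *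
          ENNReal.ofReal (Real.exp (-(n * τ))) := by gcongr
      _ = ENNReal.ofReal (Real.exp (m * ℓ' + -(n * τ))) := by
          rw [← ENNReal.ofReal_mul (Real.exp_pos _).le, Real.exp_add]
      _ ≤ _ := by
          apply ENNReal.ofReal_le_ofReal
          rw [Real.exp_le_exp]
          push_cast at ht2
          have hp0 : (0 : ℝ) ≤ p := Nat.cast_nonneg p
          nlinarith

/-- A point hitting infinitely often is covered by the balls coming from any tail of the times `n`.
The fibres contribute `exp (h n)` balls of length about `n A`, so the sums are dominated by tails of
a convergent geometric series. -/
lemma bowenMeasure_targetSet_eq_zero [CompactSpace X] [Nonempty X]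
    (hf : HasContractingLifts f κ L) {h K : ℝ}
    (hK : ∀ (r : ℕ) (y : X), ((f^[r] ⁻¹' {y}).ncard : ℝ) ≤ K * Real.exp (h * r))
    {τ : ℝ} (hτ : 0 ≤ τ) {s : ℝ≥0} (hs : h < s * (1 + τ / Real.log L)) {φ : ℕ → ℝ}
    (hφ : ∀ᶠ n : ℕ in atTop, φ n ≤ Real.exp (-(n * τ))) (z : ℕ → X) (S : Set ℕ)
    {ε : ℝ≥0∞} (hε : 0 < ε) : bowenMeasure f s ε (targetSet f φ z S) = 0 := by
  rw [bowenMeasure, ENNReal.iSup_eq_zero]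
  intro N
  obtain ⟨p, hp⟩ := exists_pow_mul_lt hf.lt_one ENNReal.one_ne_top hε
  have hp := hp p le_rfl
  rw [mul_one] at hp
  set A : ℝ := 1 + τ / Real.log L with hA
  have hA0 : 0 < A := by
    have := hf.log_pos
    positivity
  -- The factor `exp (s * (p + 1))` pays for the integer part and for the `p` steps dropped.
  set G : ℕ → ℝ≥0∞ := fun n => ENNReal.ofReal (K * Real.exp (s * (p + 1))) *
    ENNReal.ofReal (Real.exp (h - s * A)) ^ n with hG
  have hGsum : ∑' n, G n ≠ ⊤ := by
    rw [hG, ENNReal.tsum_mul_left, ENNReal.tsum_geometric]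
    refine ENNReal.mul_ne_top ENNReal.ofReal_ne_top (ENNReal.inv_ne_top.2 ?_)
    rw [Ne, tsub_eq_zero_iff_le, not_le, ENNReal.ofReal_lt_one, Real.exp_lt_one_iff]
    linarith
  have hK0 : 0 ≤ K := by
    obtain ⟨x⟩ := ‹Nonempty X›
    have := hK 0 x
    simp at this
    linarith
  have hlen : Tendsto (fun n : ℕ => ⌊(n : ℝ) * A⌋₊ - p) atTop atTop :=
    (tendsto_sub_atTop_nat p).comp
      (tendsto_nat_floor_atTop.comp (tendsto_natCast_atTop_atTop.atTop_mul_const hA0))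
  refine le_antisymm (ge_of_tendsto (ENNReal.tendsto_sum_nat_add G hGsum) ?_) zero_le
  obtain ⟨n₁, hn₁⟩ := eventually_atTop.1 (hφ.and (hlen.eventually_ge_atTop N))
  filter_upwards [eventually_ge_atTop n₁] with n₀ hn₀
  have hcount : ∀ n, Countable (f^[n] ⁻¹' {z n}) := fun n =>
    (hf.preimage_finite n (z n)).countable.to_subtype
  have hcount' : Countable ((k : ℕ) × (f^[k + n₀] ⁻¹' {z (k + n₀)} : Set X)) := by
    have := fun k => hcount (k + n₀)
    infer_instance
  refine (bowenPreMeasure_le_tsum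
    (fun i : (k : ℕ) × (f^[k + n₀] ⁻¹' {z (k + n₀)} : Set X) =>
      ((i.2 : X), ⌊((i.1 + n₀ : ℕ) : ℝ) * A⌋₊ - p)) ?_ ?_).trans ?_
  · rintro ⟨k, y⟩
    exact (hn₁ (k + n₀) (by omega)).2
  · intro x hx
    obtain ⟨n, ⟨-, hn⟩, hnn₀⟩ := hx.exists_gt n₀
    obtain ⟨y, hy, hxy⟩ := hf.targetSet_subset_bowenBall hτ hp (hn₁ n (by omega)).1 hn
    obtain ⟨k, rfl⟩ : ∃ k, n = k + n₀ := ⟨n - n₀, by omega⟩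
    exact mem_iUnion.2 ⟨⟨k, y, hy⟩, hxy⟩
  · rw [ENNReal.tsum_sigma']
    refine ENNReal.tsum_le_tsum fun k => ?_
    dsimp only
    set n := k + n₀
    have := (hf.preimage_finite n (z n)).fintype
    rw [ENNReal.tsum_const]
    have hcard : (ENat.card (f^[n] ⁻¹' {z n}) : ℝ≥0∞) ≤ ENNReal.ofReal (K * Real.exp (h * n)) := by
      rw [ENat.card_eq_coe_natCard, Nat.card_coe_set_eq, ENat.toENNReal_coe,
        ← ENNReal.ofReal_natCast]
      exact ENNReal.ofReal_le_ofReal (hK n (z n))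
    refine (mul_le_mul_left hcard _).trans ?_
    rw [hG]
    dsimp only
    rw [← ENNReal.ofReal_mul (by positivity), ← ENNReal.ofReal_pow (Real.exp_pos _).le,
      ← ENNReal.ofReal_mul (by positivity)]
    refine ENNReal.ofReal_le_ofReal ?_
    rw [← Real.exp_nat_mul, mul_assoc, mul_assoc, ← Real.exp_add, ← Real.exp_add]
    refine mul_le_mul_of_nonneg_left (Real.exp_le_exp.2 ?_) hK0
    have hfl : (n : ℝ) * A - 1 - p ≤ ((⌊(n : ℝ) * A⌋₊ - p : ℕ) : ℝ) := by
      have h1 := Nat.lt_floor_add_one ((n : ℝ) * A)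
      have h2 : (⌊(n : ℝ) * A⌋₊ : ℝ) ≤ ((⌊(n : ℝ) * A⌋₊ - p : ℕ) : ℝ) + p := by
        exact_mod_cast le_tsub_add
      linarith
    have := mul_le_mul_of_nonneg_left hfl s.coe_nonneg
    nlinarith

lemma bowenEntropy_targetSet_le [CompactSpace X] [Nonempty X]
    (hf : HasContractingLifts f κ L) {h K : ℝ} (hh : 0 ≤ h)
    (hK : ∀ (r : ℕ) (y : X), ((f^[r] ⁻¹' {y}).ncard : ℝ) ≤ K * Real.exp (h * r))
    {τ : ℝ} (hτ : 0 ≤ τ) {φ : ℕ → ℝ}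
    (hφ : ∀ᶠ n : ℕ in atTop, φ n ≤ Real.exp (-(n * τ))) (z : ℕ → X) (S : Set ℕ) :
    bowenEntropy f (targetSet f φ z S) ≤
      ENNReal.ofReal (Real.log L / (Real.log L + τ) * h) := by
  have hℓ := hf.log_pos
  refine iSup₂_le fun ε hε => ?_
  refine le_of_forall_gt_imp_ge_of_dense fun c hc => ?_
  rcases eq_or_ne c ⊤ with rfl | hct
  · exact le_top
  lift c to ℝ≥0 using hct
  refine bowenEntropyAt_le (hf.bowenMeasure_targetSet_eq_zero hK hτ ?_ hφ z S hε)
  rw [← ENNReal.ofReal_coe_nnreal, ENNReal.ofReal_lt_ofReal_iff_of_nonneg (by positivity)] at hc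
  have h1 : (1 + τ / Real.log L) = (Real.log L + τ) / Real.log L := by field_simp
  rw [h1]
  have h2 : 0 < Real.log L + τ := by positivity
  calc h = Real.log L / (Real.log L + τ) * h * ((Real.log L + τ) / Real.log L) := by field_simp
    _ < _ := by gcongr

end HasContractingLifts

end ShrinkingTarget

/-! ### Comparison of Bowen entropy and Hausdorff dimension -/

namespace ShrinkingTarget

variable {X : Type*} [EMetricSpace X] {f : X → X} {κ L : ℝ≥0}

namespace HasContractingLifts

/-- The lift of `f y` near `x` must be `y` itself by local injectivity, unless `κ * edist (f x) (f
y)` is already at least `r₀ / 2`. -/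
lemma exists_local_expansion (hf : HasContractingLifts f κ L) :
    ∃ ρ : ℝ≥0∞, 0 < ρ ∧ ρ ≠ ⊤ ∧ ∀ x y, edist x y < ρ → edist x y ≤ κ * edist (f x) (f y) := by
  obtain ⟨r₀, hr₀, hinj⟩ := hf.locally_injective
  refine ⟨min (r₀ / 2) 1, lt_min (ENNReal.half_pos hr₀.ne') one_pos,
    ((min_le_right _ _).trans_lt ENNReal.one_lt_top).ne, fun x y hxy => ?_⟩
  have hxy' := hxy.trans_le (min_le_left _ _)
  rcases eq_or_ne (edist (f x) (f y)) ⊤ with htop | htop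
  · rw [htop, ENNReal.mul_top (by simpa using hf.pos.ne')]
    exact le_top
  obtain ⟨w, hw, hxw⟩ := hf.lift x (f y) htop.lt_top
  rcases lt_or_ge (κ * edist (f x) (f y)) (r₀ / 2) with hlt | hge
  · have : w = y := by
      refine hinj w y ((edist_triangle w x y).trans_lt ?_) hw
      rw [← ENNReal.add_halves r₀, edist_comm w x]
      exact ENNReal.add_lt_add (hxw.trans_lt hlt) hxy'
    rwa [← this, hw]
  · exact hxy'.le.trans hge

lemma edist_le_of_mem_bowenBall {ρ : ℝ≥0∞}
    (hρ : ∀ x y, edist x y < ρ → edist x y ≤ κ * edist (f x) (f y)) (n : ℕ) {x y : X}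
    (hy : y ∈ bowenBall f (n + 1) x ρ) : edist x y ≤ (κ : ℝ≥0∞) ^ n * ρ := by
  have key : ∀ k ≤ n, edist x y ≤ (κ : ℝ≥0∞) ^ k * edist (f^[k] x) (f^[k] y) := by
    intro k
    induction k with
    | zero => simp
    | succ k ih =>
      intro hk
      refine (ih (by omega)).trans ?_
      rw [pow_succ, mul_assoc, Function.iterate_succ_apply', Function.iterate_succ_apply']
      gcongr
      exact hρ _ _ (hy k (by omega))
  refine (key n le_rfl).trans ?_
  gcongr
  exact (hy n (by omega)).le

/-- A Bowen ball of length `n` has diameter at most a constant times `κ ^ n`, so the weight `exp (-s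
n)` dominates, up to a constant, the diameter to the power `s / log κ⁻¹`. -/
lemma dimH_mul_log_le (hf : HasContractingLifts f κ L) (A : Set X) :
    dimH A * ENNReal.ofReal (Real.log (κ : ℝ)⁻¹) ≤ bowenEntropy f A := by
  obtain ⟨ρ, hρ0, hρtop, hρ⟩ := hf.exists_local_expansion
  have hℓ := hf.log_inv_pos
  have hκi : (0 : ℝ) < (κ : ℝ)⁻¹ := by linarith [hf.one_lt_inv]
  set ℓ := Real.log (κ : ℝ)⁻¹ with hℓdef
  refine le_trans ?_ (le_iSup₂ (f := fun (ε : ℝ≥0∞) (_ : 0 < ε) => bowenEntropyAt f ε A) ρ hρ0)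
  refine le_iInf₂ fun s hs => ?_
  borelize X
  set d : ℝ≥0 := s / ℓ.toNNReal with hd
  have hdℓ : (d : ℝ) * ℓ = s := by
    rw [hd, NNReal.coe_div, Real.coe_toNNReal _ hℓ.le, div_mul_cancel₀ _ hℓ.ne']
  have hdim : dimH A ≤ d := by
    refine dimH_le_of_hausdorffMeasure_ne_top ?_
    have hcov : ∀ N : ℕ, ∃ C : Set (X × ℕ), C.Countable ∧ (∀ p ∈ C, N + 1 ≤ p.2) ∧
        A ⊆ (⋃ p ∈ C, bowenBall f p.2 p.1 ρ) ∧
        ∑' p : C, ENNReal.ofReal (Real.exp (-(s : ℝ) * (p.1.2 : ℝ))) < 1 := by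
      intro N
      rw [bowenMeasure, ENNReal.iSup_eq_zero] at hs
      have h1 : bowenPreMeasure f s (N + 1) ρ A < 1 := by rw [hs]; exact one_pos
      unfold bowenPreMeasure at h1
      simp only [iInf_lt_iff] at h1
      obtain ⟨C, hC, hN, hA, hlt⟩ := h1
      exact ⟨C, hC, hN, hA, hlt⟩
    choose C hC hCN hCA hCs using hcov
    have : ∀ N, Countable (C N) := fun N => (hC N).to_subtype
    have hdiam : ∀ (q : X × ℕ), 0 < q.2 → Metric.ediam (bowenBall f q.2 q.1 ρ) ≤
        (κ : ℝ≥0∞) ^ (q.2 - 1) * (2 * ρ) := by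
      intro q hq
      refine Metric.ediam_le fun a ha b hb => ?_
      have hq' : q.2 = (q.2 - 1) + 1 := by omega
      rw [hq'] at ha hb
      have h1 := edist_le_of_mem_bowenBall hρ _ ha
      have h2 := edist_le_of_mem_bowenBall hρ _ hb
      calc edist a b ≤ edist a q.1 + edist q.1 b := edist_triangle _ _ _
        _ ≤ (κ : ℝ≥0∞) ^ (q.2 - 1) * ρ + (κ : ℝ≥0∞) ^ (q.2 - 1) * ρ := by
            rw [edist_comm a]; exact add_le_add h1 h2
        _ = _ := by ring
    have h2ρ : (2 * ρ) ≠ ⊤ := ENNReal.mul_ne_top (by norm_num) hρtop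
    have htend : Tendsto (fun N : ℕ => (κ : ℝ≥0∞) ^ N * (2 * ρ)) atTop (𝓝 0) := by
      have := ENNReal.Tendsto.mul_const (b := 2 * ρ)
        (ENNReal.tendsto_pow_atTop_nhds_zero_of_lt_one (r := (κ : ℝ≥0∞))
          (by exact_mod_cast hf.lt_one)) (Or.inr h2ρ)
      rwa [zero_mul] at this
    have hκle : (κ : ℝ≥0∞) ≤ 1 := by exact_mod_cast hf.lt_one.le
    have hmain := MeasureTheory.Measure.hausdorffMeasure_le_liminf_tsum (d : ℝ) A (l := atTop)
      (fun N : ℕ => (κ : ℝ≥0∞) ^ N * (2 * ρ)) htend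
      (fun N (q : C N) => bowenBall f q.1.2 q.1.1 ρ)
      (Eventually.of_forall fun N q => by
        have hN := hCN N q.1 q.2
        refine (hdiam q.1 (by omega)).trans ?_
        gcongr ?_ * _
        exact pow_le_pow_of_le_one zero_le hκle (by omega))
      (Eventually.of_forall fun N => by
        have := hCA N
        rwa [biUnion_eq_iUnion] at this)
    refine (hmain.trans_lt ?_).ne
    set c : ℝ≥0∞ := ((κ : ℝ≥0∞)⁻¹ * (2 * ρ)) ^ (d : ℝ) with hc
    have hκ0 : (κ : ℝ≥0∞) ≠ 0 := by simpa using hf.pos.ne'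
    have hctop : c ≠ ⊤ := by
      refine ENNReal.rpow_ne_top_of_nonneg d.coe_nonneg (ENNReal.mul_ne_top ?_ h2ρ)
      exact ENNReal.inv_ne_top.2 hκ0
    refine lt_of_le_of_lt ?_ hctop.lt_top
    refine liminf_le_of_le (by isBoundedDefault) fun b hb => ?_
    obtain ⟨N, hN⟩ := hb.exists
    refine hN.trans ?_
    have hterm : ∀ q : C N, Metric.ediam (bowenBall f q.1.2 q.1.1 ρ) ^ (d : ℝ) ≤
        c * ENNReal.ofReal (Real.exp (-(s : ℝ) * (q.1.2 : ℝ))) := by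
      intro q
      have hq := hCN N q.1 q.2
      have h1 : (κ : ℝ≥0∞) ^ (q.1.2 - 1) * (2 * ρ) =
          (κ : ℝ≥0∞)⁻¹ * (2 * ρ) * (κ : ℝ≥0∞) ^ q.1.2 := by
        obtain ⟨m, hm⟩ : ∃ m, q.1.2 = m + 1 := ⟨q.1.2 - 1, by omega⟩
        rw [hm, Nat.add_sub_cancel, pow_succ]
        have : (κ : ℝ≥0∞)⁻¹ * κ = 1 := ENNReal.inv_mul_cancel hκ0 ENNReal.coe_ne_top
        calc _ = ((κ : ℝ≥0∞)⁻¹ * κ) * ((κ : ℝ≥0∞) ^ m * (2 * ρ)) := by rw [this, one_mul]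
          _ = _ := by ring
      have h2 : ENNReal.ofReal (Real.exp (-(s : ℝ) * (q.1.2 : ℝ))) =
          ((κ : ℝ≥0∞) ^ q.1.2) ^ (d : ℝ) := by
        rw [coe_pow_eq_ofReal_exp hκi (by simp),
          ENNReal.ofReal_rpow_of_nonneg (Real.exp_pos _).le d.coe_nonneg, ← Real.exp_mul]
        congr 2
        rw [← hdℓ]; ring
      rw [h2, hc, ← ENNReal.mul_rpow_of_nonneg _ _ d.coe_nonneg, ← h1]
      exact ENNReal.rpow_le_rpow (hdiam q.1 (by omega)) d.coe_nonneg
    calc _ ≤ ∑' q : C N, c * ENNReal.ofReal (Real.exp (-(s : ℝ) * (q.1.2 : ℝ))) :=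
          ENNReal.tsum_le_tsum hterm
      _ = c * ∑' q : C N, ENNReal.ofReal (Real.exp (-(s : ℝ) * (q.1.2 : ℝ))) :=
          ENNReal.tsum_mul_left
      _ ≤ c * 1 := by gcongr; exact (hCs N).le
      _ = c := mul_one c
  calc dimH A * ENNReal.ofReal ℓ ≤ d * ENNReal.ofReal ℓ := by gcongr
    _ = ENNReal.ofReal ((d : ℝ) * ℓ) := by
        rw [ENNReal.ofReal_mul d.coe_nonneg, ENNReal.ofReal_coe_nnreal]
    _ = s := by rw [hdℓ, ENNReal.ofReal_coe_nnreal]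

end HasContractingLifts

/-- Take the first `n` for which `L ^ n` times the diameter reaches `ε`. A set of diameter zero has
no such `n`; an arbitrarily long ball is used for it, whose weight is absorbed by the extra `δ`. -/
lemma exists_subset_bowenBall (hf : LipschitzWith L f) (hL : (1 : ℝ) < L) {ε : ℝ≥0∞}
    (hε : 0 < ε) (hε' : ε ≠ ⊤) {d : ℝ} (hd : 0 < d) (N : ℕ) {T : Set X} {x : X} (hx : x ∈ T)
    (hT : (L : ℝ≥0∞) ^ N * Metric.ediam T < ε) {δ : ℝ≥0∞} (hδ : 0 < δ) :
    ∃ n, N ≤ n ∧ T ⊆ bowenBall f n x ε ∧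
      ENNReal.ofReal (Real.exp (-(d * Real.log L) * n)) ≤ δ + (Metric.ediam T / ε) ^ d := by
  have hℓ : 0 < Real.log L := Real.log_pos hL
  have hL1 : (1 : ℝ≥0∞) < L := by exact_mod_cast hL
  have hball : ∀ n, (∀ k < n, (L : ℝ≥0∞) ^ k * Metric.ediam T < ε) → T ⊆ bowenBall f n x ε := by
    intro n hn y hy k hk
    refine lt_of_le_of_lt ?_ (hn k hk)
    refine ((hf.iterate k) x y).trans ?_
    rw [ENNReal.coe_pow]
    gcongr
    exact Metric.edist_le_ediam_of_mem hx hy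
  rcases eq_or_ne (Metric.ediam T) 0 with h0 | h0
  · have htend : Tendsto (fun n : ℕ => ENNReal.ofReal (Real.exp (-(d * Real.log L) * n))) atTop
        (𝓝 0) := by
      rw [← ENNReal.ofReal_zero]
      refine ENNReal.tendsto_ofReal (Real.tendsto_exp_atBot.comp ?_)
      exact tendsto_natCast_atTop_atTop.const_mul_atTop_of_neg (by nlinarith)
    obtain ⟨n, hn, hnN⟩ := ((htend.eventually_lt_const hδ).and (eventually_ge_atTop N)).exists
    refine ⟨n, hnN, hball n fun k _ => by rwa [h0, mul_zero], hn.le.trans le_self_add⟩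
  · have hex : ∃ n, ε ≤ (L : ℝ≥0∞) ^ n * Metric.ediam T := by
      have h1 : Tendsto (fun n : ℕ => (L : ℝ≥0∞) ^ n * Metric.ediam T) atTop
          (𝓝 (⊤ * Metric.ediam T)) :=
        ENNReal.Tendsto.mul_const (ENNReal.tendsto_pow_atTop_nhds_top_iff.2 hL1) (Or.inl ENNReal.top_ne_zero)
      rw [ENNReal.top_mul h0] at h1
      obtain ⟨n, hn⟩ := (h1.eventually_const_lt hε'.lt_top).exists
      exact ⟨n, hn.le⟩
    classical
    refine ⟨Nat.find hex, ?_, hball _ fun k hk => not_le.1 (Nat.find_min hex hk), ?_⟩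
    · by_contra hlt
      push Not at hlt
      have h1 := Nat.find_spec hex
      refine absurd (h1.trans ?_) (not_le.2 hT)
      gcongr
      exact hL1.le
    · set n := Nat.find hex
      have h1 : ε ≤ (L : ℝ≥0∞) ^ n * Metric.ediam T := Nat.find_spec hex
      refine le_trans ?_ le_add_self
      have hLn0 : (L : ℝ≥0∞) ^ n ≠ 0 := pow_ne_zero _ (by positivity)
      have hLnt : (L : ℝ≥0∞) ^ n ≠ ⊤ := ENNReal.pow_ne_top ENNReal.coe_ne_top
      have h2 : ((L : ℝ≥0∞) ^ n)⁻¹ ≤ Metric.ediam T / ε := by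
        rw [ENNReal.le_div_iff_mul_le (Or.inl hε.ne') (Or.inl hε'), mul_comm, ← div_eq_mul_inv]
        exact ENNReal.div_le_of_le_mul' h1
      have h3 : ENNReal.ofReal (Real.exp (-(d * Real.log L) * n)) =
          ((L : ℝ≥0∞) ^ n)⁻¹ ^ d := by
        rw [coe_pow_eq_ofReal_exp_log (by linarith), ← ENNReal.ofReal_inv_of_pos (Real.exp_pos _),
          ENNReal.ofReal_rpow_of_nonneg (by positivity) hd.le, ← Real.exp_neg, ← Real.exp_mul]
        congr 2; ring
      rw [h3]
      exact ENNReal.rpow_le_rpow h2 hd.le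

lemma bowenEntropy_le_dimH_mul_log (hf : LipschitzWith L f) (hL : (1 : ℝ) < L) (A : Set X) :
    bowenEntropy f A ≤ dimH A * ENNReal.ofReal (Real.log L) := by
  have hℓ : 0 < Real.log L := Real.log_pos hL
  have hℓ' : ENNReal.ofReal (Real.log L) ≠ 0 := (ENNReal.ofReal_pos.2 hℓ).ne'
  borelize X
  refine iSup₂_le fun ε₀ hε₀ => ?_
  -- The scale is made finite, so that division by it is harmless.
  refine (bowenEntropyAt_mono (min_le_left ε₀ 1) (Subset.refl A)).trans ?_
  set ε := min ε₀ 1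
  have hε : 0 < ε := lt_min hε₀ one_pos
  have hε' : ε ≠ ⊤ := ((min_le_right _ _).trans_lt ENNReal.one_lt_top).ne
  rw [← ENNReal.div_le_iff hℓ' ENNReal.ofReal_ne_top]
  refine le_of_forall_gt_imp_ge_of_dense fun d hd => ?_
  rcases eq_or_ne d ⊤ with rfl | hdt
  · exact le_top
  lift d to ℝ≥0 using hdt
  rw [ENNReal.div_le_iff hℓ' ENNReal.ofReal_ne_top]
  have hd0 : (0 : ℝ) < d := by
    have : (0 : ℝ≥0∞) < d := bot_le.trans_lt hd
    exact_mod_cast this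
  set s : ℝ≥0 := d * (Real.log L).toNNReal with hs
  have hsR : (s : ℝ) = d * Real.log L := by
    rw [hs, NNReal.coe_mul, Real.coe_toNNReal _ hℓ.le]
  have hsE : (s : ℝ≥0∞) = d * ENNReal.ofReal (Real.log L) := by
    rw [hs, ENNReal.coe_mul]; rfl
  rw [← hsE]
  refine bowenEntropyAt_le ?_
  rw [bowenMeasure, ENNReal.iSup_eq_zero]
  intro N
  have hμ := hausdorffMeasure_of_dimH_lt hd
  rw [MeasureTheory.Measure.hausdorffMeasure_apply] at hμ
  have hL0 : (L : ℝ≥0∞) ^ N ≠ 0 :=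
    pow_ne_zero _ (by simp only [ne_eq, ENNReal.coe_eq_zero]; rintro rfl; norm_num at hL)
  have hLt : (L : ℝ≥0∞) ^ N ≠ ⊤ := ENNReal.pow_ne_top ENNReal.coe_ne_top
  obtain ⟨r, hr0, hr⟩ : ∃ r : ℝ≥0∞, 0 < r ∧ (L : ℝ≥0∞) ^ N * r < ε := by
    refine ⟨ε / (L : ℝ≥0∞) ^ N / 2, ENNReal.half_pos (ENNReal.div_pos hε.ne' hLt).ne', ?_⟩
    rw [← mul_div_assoc, ENNReal.mul_div_cancel hL0 hLt]
    exact ENNReal.half_lt_self hε.ne' hε'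
  have hμr : (⨅ (t : ℕ → Set X) (_ : A ⊆ ⋃ n, t n) (_ : ∀ n, Metric.ediam (t n) ≤ r),
      ∑' n, ⨆ _ : (t n).Nonempty, Metric.ediam (t n) ^ (d : ℝ)) = 0 := by
    refine le_antisymm (le_trans ?_ hμ.le) zero_le
    exact le_iSup₂ (f := fun (r : ℝ≥0∞) (_ : 0 < r) =>
      ⨅ (t : ℕ → Set X) (_ : A ⊆ ⋃ n, t n) (_ : ∀ n, Metric.ediam (t n) ≤ r),
      ∑' n, ⨆ _ : (t n).Nonempty, Metric.ediam (t n) ^ (d : ℝ)) r hr0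
  have hεd : (ε ^ (d : ℝ))⁻¹ ≠ ⊤ := by
    rw [Ne, ENNReal.inv_eq_top]
    exact (ENNReal.rpow_pos hε hε').ne'
  have key : ∀ η : ℝ≥0∞, 0 < η → bowenPreMeasure f s N ε A ≤ η + (ε ^ (d : ℝ))⁻¹ * η := by
    intro η hη
    have hlt := hμr.trans_lt hη
    simp only [iInf_lt_iff] at hlt
    obtain ⟨t, hAt, htr, hsum⟩ := hlt
    obtain ⟨δ, hδ0, hδ⟩ := ENNReal.exists_pos_sum_of_countable hη.ne' ℕ
    have hex : ∀ i : {i // (t i).Nonempty}, ∃ (x : X) (n : ℕ), N ≤ n ∧ t i ⊆ bowenBall f n x ε ∧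
        ENNReal.ofReal (Real.exp (-(d * Real.log L) * n)) ≤
          δ i + (Metric.ediam (t i) / ε) ^ (d : ℝ) := by
      rintro ⟨i, x, hx⟩
      obtain ⟨n, hn⟩ := exists_subset_bowenBall hf hL hε hε' hd0 N hx
        (lt_of_le_of_lt (by gcongr; exact htr i) hr) (δ := δ i) (by exact_mod_cast hδ0 i)
      exact ⟨x, n, hn⟩
    choose x n hnN hball hle using hex
    refine (bowenPreMeasure_le_tsum (fun i => (x i, n i)) hnN ?_).trans ?_
    · intro a ha
      obtain ⟨i, hi⟩ := mem_iUnion.1 (hAt ha)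
      exact mem_iUnion.2 ⟨⟨i, a, hi⟩, hball ⟨i, a, hi⟩ hi⟩
    · rw [hsR]
      refine (ENNReal.tsum_le_tsum hle).trans ?_
      rw [ENNReal.tsum_add]
      refine add_le_add ?_ ?_
      · exact (ENNReal.tsum_comp_le_tsum_of_injective Subtype.val_injective
          (fun i => (δ i : ℝ≥0∞))).trans hδ.le
      · have h1 : ∀ i : {i // (t i).Nonempty}, (Metric.ediam (t i) / ε) ^ (d : ℝ) =
            (ε ^ (d : ℝ))⁻¹ * ⨆ _ : (t i).Nonempty, Metric.ediam (t i) ^ (d : ℝ) := by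
          intro i
          rw [iSup_pos i.2, ENNReal.div_rpow_of_nonneg _ _ hd0.le, mul_comm, div_eq_mul_inv]
        rw [tsum_congr h1, ENNReal.tsum_mul_left]
        gcongr
        exact (ENNReal.tsum_comp_le_tsum_of_injective Subtype.val_injective
          (fun i => ⨆ _ : (t i).Nonempty, Metric.ediam (t i) ^ (d : ℝ))).trans hsum.le
  have hlim : Tendsto (fun η : ℝ≥0∞ => η + (ε ^ (d : ℝ))⁻¹ * η) (𝓝[>] 0) (𝓝 0) := by
    have h1 : Tendsto (fun η : ℝ≥0∞ => η + (ε ^ (d : ℝ))⁻¹ * η) (𝓝 0)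
        (𝓝 (0 + (ε ^ (d : ℝ))⁻¹ * 0)) :=
      tendsto_id.add (ENNReal.Tendsto.const_mul tendsto_id (Or.inr hεd))
    rw [mul_zero, add_zero] at h1
    exact h1.mono_left nhdsWithin_le_nhds
  exact le_antisymm (ge_of_tendsto hlim (eventually_mem_nhdsWithin.mono fun η hη => key η hη))
    zero_le

end ShrinkingTarget

/-! ### Tracing construction and mass distribution -/

namespace ShrinkingTarget

/-- The uniform Bernoulli measure on a product of finite sets, with a bound for its value on a set
of sequences with prescribed first terms. -/
lemma exists_uniform_outerMeasure {A : ℕ → Type*} [∀ k, Fintype (A k)] [∀ k, Nonempty (A k)] :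
    ∃ μ : MeasureTheory.OuterMeasure (∀ k, A k), μ univ = 1 ∧
      ∀ (k : ℕ) (S : Set (∀ k, A k)) (v : ∀ k, A k) (G : Finset (A k)),
        (∀ u ∈ S, (∀ i < k, u i = v i) ∧ u k ∈ G) →
        μ S ≤ ENNReal.ofReal ((∏ i ∈ Finset.range k, (Fintype.card (A i) : ℝ)⁻¹) *
          (G.card / Fintype.card (A k))) := by
  classical
  let mA : ∀ k, MeasurableSpace (A k) := fun _ => ⊤
  let ν : ∀ k, MeasureTheory.Measure (A k) := fun k => (PMF.uniformOfFintype (A k)).toMeasure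
  have hν : ∀ k, MeasureTheory.IsProbabilityMeasure (ν k) := fun k => inferInstance
  have hνle : ∀ k (T : Set (A k)) (G : Finset (A k)), T ⊆ G →
      ν k T ≤ ENNReal.ofReal (G.card / Fintype.card (A k)) := by
    intro k T G hTG
    refine (MeasureTheory.measure_mono hTG).trans ?_
    simp only [ν]
    rw [PMF.toMeasure_uniformOfFintype_apply _ (MeasurableSpace.measurableSet_top)]
    rw [ENNReal.ofReal_div_of_pos (by exact_mod_cast Fintype.card_pos)]
    simp
  refine ⟨(MeasureTheory.Measure.infinitePi ν).toOuterMeasure, ?_, ?_⟩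
  · exact MeasureTheory.measure_univ
  · intro k S v G hS
    let t : ∀ i, Set (A i) := fun i => (fun u : ∀ k, A k => u i) '' S
    have hsub : S ⊆ ((Finset.range (k + 1) : Finset ℕ) : Set ℕ).pi t :=
      fun u hu i _ => mem_image_of_mem _ hu
    refine (MeasureTheory.measure_mono (μ := MeasureTheory.Measure.infinitePi ν) hsub).trans ?_
    rw [MeasureTheory.Measure.infinitePi_pi ν (fun i _ => MeasurableSpace.measurableSet_top),
      Finset.prod_range_succ, ENNReal.ofReal_mul (Finset.prod_nonneg fun _ _ => by positivity),
      ENNReal.ofReal_prod_of_nonneg (fun _ _ => by positivity)]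
    refine mul_le_mul' (Finset.prod_le_prod' fun i hi => ?_) (hνle k (t k) G ?_)
    · refine (hνle i (t i) {v i} ?_).trans ?_
      · rintro _ ⟨u, hu, rfl⟩
        simpa using (hS u hu).1 i (Finset.mem_range.1 hi)
      · simp
    · rintro _ ⟨u, hu, rfl⟩
      exact (hS u hu).2

variable {X : Type*} [EMetricSpace X] {f : X → X} {κ L : ℝ≥0}

namespace HasContractingLifts

/-- Points whose orbits follow successively the orbits of prescribed preimages `u k` of the
points `ζ k`, between the times `b k` and `b (k + 1)`. -/
lemma exists_tracing [CompactSpace X] [Nonempty X] (hf : HasContractingLifts f κ L)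
    (htrans : IsTransitive f) {D : ℝ≥0∞} (hD : D ≠ ⊤)
    (hDle : ∀ x y : X, edist x y < ⊤ → edist x y ≤ D) (x₀ : X) {b n : ℕ → ℕ} {ζ : ℕ → X}
    (hbn : ∀ k, b k ≤ n k) (hnb : ∀ k, n k < b (k + 1))
    (hζ : ∀ k, edist (f^[n k] x₀) (ζ k) < ⊤) :
    ∃ θ : (∀ k, (f^[n k - b k] ⁻¹' {ζ k} : Set X)) → X, ∀ u k t, t ≤ b (k + 1) - b k →
      edist (f^[t] (u k : X)) (f^[b k + t] (θ u)) ≤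
        (κ : ℝ≥0∞) ^ (b (k + 1) - b k - t) * (D / (1 - κ)) := by
  have hlift : ∀ (m : ℕ) (x y : X), ∃ w, edist (f^[m] x) y < ⊤ → f^[m] w = y ∧
      ∀ t ≤ m, edist (f^[t] x) (f^[t] w) ≤ (κ : ℝ≥0∞) ^ (m - t) * D := by
    intro m x y
    by_cases h : edist (f^[m] x) y < ⊤
    · obtain ⟨w, hw, hd⟩ := hf.exists_iterate_lift m x y h
      exact ⟨w, fun _ => ⟨hw, fun t ht => (hd t ht).trans (by gcongr; exact hDle _ _ h)⟩⟩
    · exact ⟨x, fun h' => absurd h' h⟩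
  choose Φ hΦ using hlift
  -- `P u (k + 1)` is the lift of `u k` by `f^[b k]` along the orbit of `P u k`. Successive
  -- corrections are exponentially small in the past, so the sequence converges.
  let P : (∀ k, (f^[n k - b k] ⁻¹' {ζ k} : Set X)) → ℕ → X := fun u k =>
    Nat.rec x₀ (fun k x => Φ (b k) x (u k)) k
  have hκ1 : (κ : ℝ≥0∞) < 1 := by exact_mod_cast hf.lt_one
  have hbmono : StrictMono b := strictMono_nat_of_lt_succ fun k => (hbn k).trans_lt (hnb k)
  have hclass : ∀ u k, edist x₀ (P u k) < ⊤ → edist (f^[b k] (P u k)) (u k) < ⊤ := by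
    intro u k hk
    have h1 : edist (f^[b k] x₀) (u k : X) < ⊤ := by
      refine hf.edist_lt_top_of_iterate htrans (n k - b k) ?_
      rw [← Function.iterate_add_apply, Nat.sub_add_cancel (hbn k)]
      have : f^[n k - b k] (u k : X) = ζ k := (u k).2
      rw [this]
      exact hζ k
    refine (edist_triangle _ (f^[b k] x₀) _).trans_lt (ENNReal.add_lt_top.2 ⟨?_, h1⟩)
    rw [edist_comm]
    exact hf.iterate_lt_top _ hk
  have hP0 : ∀ u k, edist x₀ (P u k) < ⊤ := by
    intro u k
    induction k with
    | zero => simp [P]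
    | succ k ih =>
      have h1 := (hΦ (b k) (P u k) (u k) (hclass u k ih)).2 0 (Nat.zero_le _)
      refine (edist_triangle _ (P u k) _).trans_lt (ENNReal.add_lt_top.2 ⟨ih, h1.trans_lt ?_⟩)
      exact ENNReal.mul_lt_top (ENNReal.pow_lt_top ENNReal.coe_lt_top) hD.lt_top
  have hP1 : ∀ u k, f^[b k] (P u (k + 1)) = u k := fun u k =>
    (hΦ (b k) (P u k) (u k) (hclass u k (hP0 u k))).1
  have hP2 : ∀ u k, ∀ t ≤ b k, edist (f^[t] (P u k)) (f^[t] (P u (k + 1))) ≤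
      (κ : ℝ≥0∞) ^ (b k - t) * D := fun u k =>
    (hΦ (b k) (P u k) (u k) (hclass u k (hP0 u k))).2
  have hlim : ∀ u, ∃ x, Tendsto (P u) atTop (𝓝 x) := by
    intro u
    refine cauchySeq_tendsto_of_complete
      (cauchySeq_of_edist_le_geometric (κ : ℝ≥0∞) D hκ1 hD fun k => ?_)
    have h1 := hP2 u k 0 (Nat.zero_le _)
    refine h1.trans ?_
    rw [mul_comm]
    exact mul_le_mul' le_rfl (pow_le_pow_of_le_one zero_le hκ1.le (hbmono.id_le k))
  choose θ hθ using hlim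
  refine ⟨θ, fun u k t ht => ?_⟩
  have hbk : b k ≤ b (k + 1) := hbmono.monotone (Nat.le_succ k)
  have htend : Tendsto (fun i => f^[b k + t] (P u (k + 1 + i))) atTop
      (𝓝 (f^[b k + t] (θ u))) := by
    have hc : Continuous f^[b k + t] := hf.lipschitz.continuous.iterate _
    have h1 := (hc.tendsto (θ u)).comp (hθ u)
    have h2 : Tendsto (fun i => k + 1 + i) atTop atTop := tendsto_add_atTop_nat (k + 1) |>.congr
      fun i => by ring
    exact h1.comp h2
  -- Strict monotonicity of `b` gives at least one more factor `κ` for each later correction, hence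
  -- a geometric series with sum `D / (1 - κ)`.
  have hstep : ∀ i, edist (f^[b k + t] (P u (k + 1 + i))) (f^[b k + t] (P u (k + 1 + (i + 1)))) ≤
      ((κ : ℝ≥0∞) ^ (b (k + 1) - b k - t) * D) * (κ : ℝ≥0∞) ^ i := by
    intro i
    have hbi : b (k + 1) + i ≤ b (k + 1 + i) := by
      have := hbmono.add_le_nat i (k + 1)
      rwa [add_comm, add_comm (k + 1) i]
    refine (hP2 u (k + 1 + i) (b k + t) (by omega)).trans ?_
    rw [mul_right_comm, ← pow_add]
    gcongr ?_ * _
    exact pow_le_pow_of_le_one zero_le hκ1.le (by omega)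
  have h1 := edist_le_of_edist_le_geometric_of_tendsto₀ (κ : ℝ≥0∞) _ hstep htend
  rw [mul_div_assoc, add_zero, add_comm (b k) t, Function.iterate_add_apply, hP1] at h1
  rwa [add_comm (b k) t]

section Mass

variable {b n : ℕ → ℕ} {ζ : ℕ → X} {θ : (∀ k, (f^[n k - b k] ⁻¹' {ζ k} : Set X)) → X}
  {E r₀ : ℝ≥0∞}

/-- Two traced points in one Bowen ball of radius `r₀ / 4` force their prescribed segments to be
`r₀`-close, through four steps of `r₀ / 4`. Local injectivity then propagates equality back from
time `r`. -/
lemma eq_of_tracing (hκ : κ < 1) (hinj : ∀ x y, edist x y < r₀ → f x = f y → x = y)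
    (hbn : ∀ k, b k ≤ n k) (hnb : ∀ k, n k < b (k + 1))
    (hθ : ∀ u k t, t ≤ b (k + 1) - b k → edist (f^[t] (u k : X)) (f^[b k + t] (θ u)) ≤
      (κ : ℝ≥0∞) ^ (b (k + 1) - b k - t) * E)
    (hE : ∀ k, (κ : ℝ≥0∞) ^ (b (k + 1) - n k) * E < r₀ / 4) {N k r : ℕ} {y : X}
    {u u' : ∀ k, (f^[n k - b k] ⁻¹' {ζ k} : Set X)}
    (hu : θ u ∈ bowenBall f N y (r₀ / 4)) (hu' : θ u' ∈ bowenBall f N y (r₀ / 4))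
    (hr : r ≤ n k - b k) (hrN : b k + r ≤ N)
    (h : f^[r] (u k : X) = f^[r] (u' k : X)) : u k = u' k := by
  refine Subtype.ext (eq_of_iterate_eq hinj r (fun t ht => ?_) h)
  have hκ1 : (κ : ℝ≥0∞) ≤ 1 := by exact_mod_cast hκ.le
  have hnb' := hnb k
  have hbn' := hbn k
  have hclose : ∀ v : ∀ k, (f^[n k - b k] ⁻¹' {ζ k} : Set X),
      edist (f^[t] (v k : X)) (f^[b k + t] (θ v)) < r₀ / 4 := by
    intro v
    refine lt_of_le_of_lt ((hθ v k t (by omega)).trans ?_) (hE k)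
    gcongr ?_ * _
    exact pow_le_pow_of_le_one zero_le hκ1 (by omega)
  have h1 := hu (b k + t) (by omega)
  have h2 := hu' (b k + t) (by omega)
  have h4 : r₀ = (r₀ / 4 + r₀ / 4) + (r₀ / 4 + r₀ / 4) := by
    have h2 : r₀ / 4 = r₀ / 2 / 2 := by
      rw [div_eq_mul_inv, div_eq_mul_inv, div_eq_mul_inv, mul_assoc,
        ← ENNReal.mul_inv (by simp) (by simp)]
      norm_num
    rw [h2, ENNReal.add_halves, ENNReal.add_halves]
  calc edist (f^[t] (u k : X)) (f^[t] (u' k : X))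
      ≤ edist (f^[t] (u k : X)) (f^[b k + t] y) + edist (f^[b k + t] y) (f^[t] (u' k : X)) :=
        edist_triangle _ _ _
    _ ≤ (edist (f^[t] (u k : X)) (f^[b k + t] (θ u)) + edist (f^[b k + t] (θ u)) (f^[b k + t] y)) +
        (edist (f^[b k + t] y) (f^[b k + t] (θ u')) +
          edist (f^[b k + t] (θ u')) (f^[t] (u' k : X))) :=
        add_le_add (edist_triangle _ _ _) (edist_triangle _ _ _)
    _ < (r₀ / 4 + r₀ / 4) + (r₀ / 4 + r₀ / 4) := by
        refine ENNReal.add_lt_add (ENNReal.add_lt_add (hclose u) ?_) (ENNReal.add_lt_add h2 ?_)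
        · rwa [edist_comm]
        · rw [edist_comm]; exact hclose u'
    _ = r₀ := h4.symm

/-- Mass distribution: the choices leading into a Bowen ball of length `N` have measure at most `K²
exp (-s N)`. If `b k ≤ N ≤ n k`, the `k`-th choice is determined up to about `exp (h (n k - N))`
possibilities; for `n k < N < b (k + 1)` it is unique, and `hW` says that its weight already pays
for the whole gap up to `b (k + 1)`. An outer measure on the space of choices avoids any
measurability of `θ`. -/
lemma le_bowenEntropyAt_range [CompactSpace X] [Nonempty X] (hf : HasContractingLifts f κ L)
    (htrans : IsTransitive f) {h K : ℝ} (hK1 : 1 ≤ K)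
    (hK : ∀ (r : ℕ) (y : X), Real.exp (h * r) ≤ K * (f^[r] ⁻¹' {y}).ncard ∧
      ((f^[r] ⁻¹' {y}).ncard : ℝ) ≤ K * Real.exp (h * r))
    (hinj : ∀ x y, edist x y < r₀ → f x = f y → x = y)
    (hb0 : b 0 = 0) (hbn : ∀ k, b k ≤ n k) (hnb : ∀ k, n k < b (k + 1))
    (hθ : ∀ u k t, t ≤ b (k + 1) - b k → edist (f^[t] (u k : X)) (f^[b k + t] (θ u)) ≤
      (κ : ℝ≥0∞) ^ (b (k + 1) - b k - t) * E)
    (hE : ∀ k, (κ : ℝ≥0∞) ^ (b (k + 1) - n k) * E < r₀ / 4) {s : ℝ} (hs0 : 0 ≤ s) (hsh : s ≤ h)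
    (hW : ∀ k, K * Real.exp (-h * ((n k : ℝ) - b k)) ≤ Real.exp (-s * b (k + 1))) :
    ENNReal.ofReal s ≤ bowenEntropyAt f (r₀ / 4) (range θ) := by
  classical
  have hK0 : 0 < K := by linarith
  have hbmono : StrictMono b := strictMono_nat_of_lt_succ fun k => (hbn k).trans_lt (hnb k)
  have : ∀ k, Fintype (f^[n k - b k] ⁻¹' {ζ k} : Set X) := fun k =>
    (hf.preimage_finite _ _).fintype
  have : ∀ k, Nonempty (f^[n k - b k] ⁻¹' {ζ k} : Set X) := fun k =>
    let ⟨w, hw⟩ := ((hf.surjective htrans).iterate (n k - b k)) (ζ k)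
    ⟨⟨w, hw⟩⟩
  have hcard : ∀ k, (Fintype.card (f^[n k - b k] ⁻¹' {ζ k} : Set X) : ℝ) =
      (f^[n k - b k] ⁻¹' {ζ k}).ncard := fun k => by
    rw [← Nat.card_eq_fintype_card, Nat.card_coe_set_eq]
  set a : ℕ → ℝ := fun k => (Fintype.card (f^[n k - b k] ⁻¹' {ζ k} : Set X) : ℝ) with ha
  have ha1 : ∀ k, 1 ≤ a k := fun k => by
    simp only [ha]; exact_mod_cast Fintype.card_pos
  have hainv : ∀ k, (a k)⁻¹ ≤ K * Real.exp (-h * ((n k : ℝ) - b k)) := by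
    intro k
    have h1 := (hK (n k - b k) (ζ k)).1
    rw [← hcard, Nat.cast_sub (hbn k)] at h1
    rw [neg_mul, Real.exp_neg, ← div_eq_mul_inv, le_div_iff₀ (Real.exp_pos _),
      inv_mul_le_iff₀ (by linarith [ha1 k])]
    linarith [mul_comm K (a k)]
  have hprod1 : ∀ k, ∏ i ∈ Finset.range k, (a i)⁻¹ ≤ 1 := fun k =>
    Finset.prod_le_one (fun i _ => inv_nonneg.2 (by linarith [ha1 i]))
      fun i _ => inv_le_one_of_one_le₀ (ha1 i)
  have hprod0 : ∀ k, 0 ≤ ∏ i ∈ Finset.range k, (a i)⁻¹ := fun k =>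
    Finset.prod_nonneg fun i _ => inv_nonneg.2 (by linarith [ha1 i])
  -- Only the last factor matters, since `hW` makes it small enough alone; the others are bounded by
  -- one.
  have hprod : ∀ k, ∏ i ∈ Finset.range k, (a i)⁻¹ ≤ Real.exp (-s * b k) := by
    intro k
    cases k with
    | zero => simp [hb0]
    | succ k =>
      rw [Finset.prod_range_succ]
      calc _ ≤ 1 * (a k)⁻¹ :=
            mul_le_mul_of_nonneg_right (hprod1 k) (inv_nonneg.2 (by linarith [ha1 k]))
        _ = (a k)⁻¹ := one_mul _
        _ ≤ _ := (hainv k).trans (hW k)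
  obtain ⟨μ, hμ1, hμ⟩ := exists_uniform_outerMeasure
    (A := fun k => (f^[n k - b k] ⁻¹' {ζ k} : Set X))
  have hmass : ∀ (y : X) (N : ℕ), μ (θ ⁻¹' (bowenBall f N y (r₀ / 4))) ≤
      ENNReal.ofReal (K * K) * ENNReal.ofReal (Real.exp (-s * N)) := by
    intro y N
    rcases (θ ⁻¹' (bowenBall f N y (r₀ / 4))).eq_empty_or_nonempty with hem | ⟨v, hv⟩
    · rw [hem]; simp
    obtain ⟨k, hk1, hk2⟩ : ∃ k, b k ≤ N ∧ N < b (k + 1) := by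
      have hex : ∃ k, N < b (k + 1) := ⟨N, (Nat.lt_succ_self N).trans_le (hbmono.id_le (N + 1))⟩
      refine ⟨Nat.find hex, ?_, Nat.find_spec hex⟩
      rcases Nat.eq_zero_or_pos (Nat.find hex) with h0 | hpos
      · rw [h0, hb0]; exact Nat.zero_le _
      · have := Nat.find_min hex (Nat.sub_lt hpos one_pos)
        rw [Nat.sub_add_cancel (show 1 ≤ Nat.find hex from hpos)] at this
        omega
    have hagree : ∀ u ∈ θ ⁻¹' (bowenBall f N y (r₀ / 4)), ∀ i < k, u i = v i := by
      intro u hu i hi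
      refine eq_of_tracing hf.lt_one hinj hbn hnb hθ hE hu hv le_rfl ?_
        (Eq.trans (u i).2 (Eq.symm (v i).2))
      have h1 := hbmono.monotone (Nat.succ_le_of_lt hi)
      have h2 := hnb i
      have h3 := hbn i
      have : b (i + 1) ≤ b k := h1
      omega
    rw [← ENNReal.ofReal_mul (by positivity)]
    rcases le_or_gt N (n k) with hN | hN
    · let G : Finset (f^[n k - b k] ⁻¹' {ζ k} : Set X) :=
        Finset.univ.filter fun w => ∃ u ∈ θ ⁻¹' (bowenBall f N y (r₀ / 4)), u k = w
      refine (hμ k _ v G fun u hu => ⟨hagree u hu, ?_⟩).trans (ENNReal.ofReal_le_ofReal ?_)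
      · exact Finset.mem_filter.2 ⟨Finset.mem_univ _, u, hu, rfl⟩
      have hGcard : (G.card : ℝ) ≤ K * Real.exp (h * ((n k : ℝ) - N)) := by
        have h1 : G.card ≤ (f^[n k - N] ⁻¹' {ζ k}).ncard := by
          rw [← Set.ncard_coe_finset]
          refine Set.ncard_le_ncard_of_injOn (fun w => f^[N - b k] (w : X)) ?_ ?_
            (hf.preimage_finite _ _)
          · intro w _
            show f^[n k - N] (f^[N - b k] (w : X)) = ζ k
            rw [← Function.iterate_add_apply, show n k - N + (N - b k) = n k - b k by omega]
            exact w.2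
          · intro w hw w' hw' hww'
            obtain ⟨u, hu, rfl⟩ := (Finset.mem_filter.1 hw).2
            obtain ⟨u', hu', rfl⟩ := (Finset.mem_filter.1 hw').2
            exact eq_of_tracing hf.lt_one hinj hbn hnb hθ hE hu hu' (r := N - b k) (by omega)
              (by omega) hww'
        have h2 := (hK (n k - N) (ζ k)).2
        rw [Nat.cast_sub hN] at h2
        exact le_trans (by exact_mod_cast h1) h2
      have hbn' := hbn k
      calc (∏ i ∈ Finset.range k, (a i)⁻¹) * (G.card / a k)
          ≤ Real.exp (-s * b k) * ((K * Real.exp (h * ((n k : ℝ) - N))) *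
              (K * Real.exp (-h * ((n k : ℝ) - b k)))) := by
            rw [div_eq_mul_inv]
            refine mul_le_mul (hprod k) (mul_le_mul hGcard (hainv k) ?_ (by positivity)) ?_
              (Real.exp_pos _).le
            · exact inv_nonneg.2 (by linarith [ha1 k])
            · exact mul_nonneg (Nat.cast_nonneg _) (inv_nonneg.2 (by linarith [ha1 k]))
        _ = K * K * Real.exp (-s * b k + (h * ((n k : ℝ) - N) + -h * ((n k : ℝ) - b k))) := by
            rw [Real.exp_add, Real.exp_add]; ring
        -- The exponent is `-s b k - h (N - b k)`, and `s ≤ h`.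
        _ ≤ K * K * Real.exp (-s * N) := by
            gcongr
            have : (b k : ℝ) ≤ N := by exact_mod_cast hk1
            nlinarith
    · refine (hμ k _ v {v k} fun u hu => ⟨hagree u hu, ?_⟩).trans (ENNReal.ofReal_le_ofReal ?_)
      · rw [Finset.mem_singleton]
        have hbn' := hbn k
        exact eq_of_tracing hf.lt_one hinj hbn hnb hθ hE hu hv le_rfl (by omega)
          (Eq.trans (u k).2 (Eq.symm (v k).2))
      · rw [Finset.card_singleton, Nat.cast_one, one_div, ← Finset.prod_range_succ]
        refine (hprod (k + 1)).trans ?_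
        have h1 : Real.exp (-s * b (k + 1)) ≤ Real.exp (-s * N) := by
          rw [Real.exp_le_exp]
          have : (N : ℝ) ≤ b (k + 1) := by exact_mod_cast hk2.le
          nlinarith
        have h2 : 1 ≤ K * K := by nlinarith
        nlinarith [Real.exp_pos (-s * N)]
  refine le_iInf₂ fun s' hs' => ?_
  by_contra hlt
  push Not at hlt
  have hs's : (s' : ℝ) ≤ s := by
    rw [← ENNReal.ofReal_coe_nnreal, ENNReal.ofReal_lt_ofReal_iff_of_nonneg s'.coe_nonneg] at hlt
    exact hlt.le
  rw [bowenMeasure, ENNReal.iSup_eq_zero] at hs'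
  have hKK : ENNReal.ofReal (K * K) ≠ 0 := (ENNReal.ofReal_pos.2 (by positivity)).ne'
  have h0 : bowenPreMeasure f s' 0 (r₀ / 4) (range θ) < (ENNReal.ofReal (K * K))⁻¹ := by
    rw [hs' 0]
    exact ENNReal.inv_pos.2 ENNReal.ofReal_ne_top
  unfold bowenPreMeasure at h0
  simp only [iInf_lt_iff] at h0
  obtain ⟨C, hC, -, hcov, hsum⟩ := h0
  have := hC.to_subtype
  have h1 : (1 : ℝ≥0∞) ≤ ∑' p : C, μ (θ ⁻¹' (bowenBall f p.1.2 p.1.1 (r₀ / 4))) := by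
    rw [← hμ1]
    refine le_trans (μ.mono ?_) (MeasureTheory.measure_iUnion_le _)
    intro u _
    have := hcov (mem_range_self u)
    rw [biUnion_eq_iUnion] at this
    obtain ⟨p, hp⟩ := mem_iUnion.1 this
    exact mem_iUnion.2 ⟨p, hp⟩
  have h2 : ∑' p : C, μ (θ ⁻¹' (bowenBall f p.1.2 p.1.1 (r₀ / 4))) ≤
      ENNReal.ofReal (K * K) * ∑' p : C, ENNReal.ofReal (Real.exp (-(s' : ℝ) * (p.1.2 : ℝ))) := by
    rw [← ENNReal.tsum_mul_left]
    refine ENNReal.tsum_le_tsum fun p => (hmass _ _).trans ?_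
    gcongr
  have h3 : ENNReal.ofReal (K * K) *
      ∑' p : C, ENNReal.ofReal (Real.exp (-(s' : ℝ) * (p.1.2 : ℝ))) < 1 := by
    rw [← ENNReal.mul_inv_cancel hKK ENNReal.ofReal_ne_top]
    exact (ENNReal.mul_lt_mul_iff_right hKK ENNReal.ofReal_ne_top).2 hsum
  exact absurd (h1.trans h2) (not_le.2 h3)

end Mass

end HasContractingLifts

end ShrinkingTarget

/-! ### Hitting times and the lower entropy bound -/

namespace ShrinkingTarget

/-- Recursive choice of times in infinite sets `G j`, each `j` being visited infinitely often. -/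
lemma exists_visiting_times {G : ℕ → Set ℕ} (hG : ∀ j, (G j).Infinite) (q : ℕ → ℕ → ℕ)
    {Q : ℕ → ℕ → ℕ → Prop} (hQ : ∀ j b, ∀ᶠ n in atTop, Q j b n) :
    ∃ b n : ℕ → ℕ, b 0 = 0 ∧ ∀ k, b k ≤ n k ∧ n k ∈ G (Nat.unpair k).1 ∧
      Q (Nat.unpair k).1 (b k) (n k) ∧ b (k + 1) = n k + q (Nat.unpair k).1 (n k) := by
  have hex : ∀ j b, ∃ n, b ≤ n ∧ n ∈ G j ∧ Q j b n := by
    intro j b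
    obtain ⟨n, hn, hn'⟩ := ((Nat.frequently_atTop_iff_infinite.2 (hG j)).and_eventually
      ((eventually_ge_atTop b).and (hQ j b))).exists
    exact ⟨n, hn'.1, hn, hn'.2⟩
  choose ν hν using hex
  let b : ℕ → ℕ := fun k =>
    Nat.rec 0 (fun k b => ν (Nat.unpair k).1 b + q (Nat.unpair k).1 (ν (Nat.unpair k).1 b)) k
  exact ⟨b, fun k => ν (Nat.unpair k).1 (b k), rfl, fun k =>
    ⟨(hν _ _).1, (hν _ _).2.1, (hν _ _).2.2, rfl⟩⟩

variable {X : Type*} [EMetricSpace X] {f : X → X} {κ L : ℝ≥0}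

namespace HasContractingLifts

/-- Points whose orbits hit all the targets infinitely often: the orbit is prescribed between the
times `b k` and `n k`, and the times `n k` are the hitting times. -/
lemma exists_tracing_targets [CompactSpace X] [Nonempty X] (hf : HasContractingLifts f κ L)
    (htrans : IsTransitive f) {φ : ℕ → ℕ → ℝ} {z : ℕ → ℕ → X} {S : ℕ → Set ℕ}
    (hφ : ∀ j n, 0 < φ j n) {x₀ : X}
    (hx₀ : ∀ j, {n | n ∈ S j ∧ edist (f^[n] x₀) (z j n) < ⊤}.Infinite) {r₀ : ℝ≥0∞}
    (hr₀ : 0 < r₀) :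
    ∃ (E : ℝ≥0∞) (p : ℕ), ∀ Q : ℕ → ℕ → ℕ → Prop, (∀ j b, ∀ᶠ n in atTop, Q j b n) →
      ∃ (b n : ℕ → ℕ) (ζ : ℕ → X) (θ : (∀ k, (f^[n k - b k] ⁻¹' {ζ k} : Set X)) → X),
        b 0 = 0 ∧ (∀ k, b k ≤ n k) ∧ (∀ k, n k < b (k + 1)) ∧
        (∀ u k t, t ≤ b (k + 1) - b k → edist (f^[t] (u k : X)) (f^[b k + t] (θ u)) ≤
          (κ : ℝ≥0∞) ^ (b (k + 1) - b k - t) * E) ∧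
        (∀ k, (κ : ℝ≥0∞) ^ (b (k + 1) - n k) * E < r₀ / 4) ∧
        range θ ⊆ ⋂ j, targetSet f (φ j) (z j) (S j) ∧
        ∀ k, ∃ j, n k ∈ S j ∧ Q j (b k) (n k) ∧
          b (k + 1) = n k + (p + ⌈-Real.log (φ j (n k)) / Real.log (κ : ℝ)⁻¹⌉₊) := by
  obtain ⟨D, hD, hDle⟩ := exists_edist_le_of_lt_top (X := X)
  have hκ1 : (κ : ℝ≥0∞) < 1 := by exact_mod_cast hf.lt_one
  have hE : D / (1 - κ) ≠ ⊤ := ENNReal.div_ne_top hD (tsub_pos_of_lt hκ1).ne'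
  -- The bound by `1` leaves the full factor `φ` for the precision of the hits; the bound by `r₀ /
  -- 4` is the one needed for the mass estimate.
  obtain ⟨p, hp⟩ := exists_pow_mul_lt hf.lt_one hE (ε := min 1 (r₀ / 4))
    (lt_min one_pos (ENNReal.div_pos hr₀.ne' (by simp)))
  refine ⟨D / (1 - κ), p + 1, fun Q hQ => ?_⟩
  obtain ⟨b, n, hb0, hbn⟩ := exists_visiting_times hx₀
    (fun j m => p + 1 + ⌈-Real.log (φ j m) / Real.log (κ : ℝ)⁻¹⌉₊) hQ
  have hbn1 : ∀ k, b k ≤ n k := fun k => (hbn k).1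
  have hnb : ∀ k, n k < b (k + 1) := fun k => by rw [(hbn k).2.2.2]; omega
  obtain ⟨θ, hθ⟩ := hf.exists_tracing htrans hD hDle x₀ (ζ := fun k => z (Nat.unpair k).1 (n k))
    hbn1 hnb (fun k => (hbn k).2.1.2)
  refine ⟨b, n, _, θ, hb0, hbn1, hnb, hθ, fun k => ?_, ?_, fun k => ⟨_, (hbn k).2.1.1, (hbn k).2.2⟩⟩
  · exact (hp _ (by rw [(hbn k).2.2.2]; omega)).trans_le (min_le_right _ _)
  rintro _ ⟨u, rfl⟩
  refine mem_iInter.2 fun j => ?_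
  have hnmono : StrictMono n := strictMono_nat_of_lt_succ fun k => (hnb k).trans_le (hbn1 (k + 1))
  -- The indices `Nat.pair j i` are the infinitely many stages devoted to the target sequence `j`.
  refine (infinite_range_of_injective (f := fun i => n (Nat.pair j i)) fun i i' h => ?_).mono ?_
  · have := congrArg Nat.unpair (hnmono.injective h)
    rw [Nat.unpair_pair, Nat.unpair_pair] at this
    exact (Prod.mk.inj this).2
  rintro _ ⟨i, rfl⟩
  set k := Nat.pair j i with hk
  have hkj : (Nat.unpair k).1 = j := by rw [hk, Nat.unpair_pair]
  have hbk := hbn k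
  rw [hkj] at hbk
  refine ⟨hbk.2.1.1, ?_⟩
  have h1 := hθ u k (n k - b k) (by have := hnb k; omega)
  have h2 : f^[n k - b k] (u k : X) = z j (n k) := by
    have h : f^[n k - b k] (u k : X) = z (Nat.unpair k).1 (n k) := (u k).2
    exact h.trans (by rw [hkj])
  rw [h2, Nat.add_sub_cancel' (hbn1 k), edist_comm] at h1
  refine h1.trans_lt ?_
  have h3 : b (k + 1) - b k - (n k - b k) =
      ⌈-Real.log (φ j (n k)) / Real.log (κ : ℝ)⁻¹⌉₊ + (p + 1) := by
    have := hbk.2.2.2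
    have := hbn1 k
    omega
  have h4 : (κ : ℝ≥0∞) ^ ⌈-Real.log (φ j (n k)) / Real.log (κ : ℝ)⁻¹⌉₊ ≤
      ENNReal.ofReal (φ j (n k)) := by
    rw [coe_pow_eq_ofReal_exp_log (by exact_mod_cast hf.pos)]
    refine ENNReal.ofReal_le_ofReal ?_
    rw [← Real.le_log_iff_exp_le (hφ j (n k))]
    have := Nat.le_ceil (-Real.log (φ j (n k)) / Real.log (κ : ℝ)⁻¹)
    rw [div_le_iff₀ hf.log_inv_pos] at this
    rw [show Real.log κ = -Real.log (κ : ℝ)⁻¹ by rw [Real.log_inv, neg_neg]]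
    linarith
  have h5 : (κ : ℝ≥0∞) ^ (p + 1) * (D / (1 - κ)) < 1 :=
    (hp (p + 1) (Nat.le_succ p)).trans_le (min_le_left _ _)
  rw [h3, pow_add, mul_assoc]
  have h6 : ENNReal.ofReal (φ j (n k)) ≠ 0 := (ENNReal.ofReal_pos.2 (hφ j (n k))).ne'
  calc _ ≤ ENNReal.ofReal (φ j (n k)) * ((κ : ℝ≥0∞) ^ (p + 1) * (D / (1 - κ))) := by gcongr
    _ < ENNReal.ofReal (φ j (n k)) * 1 :=
        (ENNReal.mul_lt_mul_iff_right h6 ENNReal.ofReal_ne_top).2 h5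
    _ = _ := mul_one _

lemma nonempty_iInter_targetSet [CompactSpace X] [Nonempty X] (hf : HasContractingLifts f κ L)
    (htrans : IsTransitive f) {φ : ℕ → ℕ → ℝ} {z : ℕ → ℕ → X} {S : ℕ → Set ℕ}
    (hφ : ∀ j n, 0 < φ j n) {x₀ : X}
    (hx₀ : ∀ j, {n | n ∈ S j ∧ edist (f^[n] x₀) (z j n) < ⊤}.Infinite) :
    (⋂ j, targetSet f (φ j) (z j) (S j)).Nonempty := by
  obtain ⟨E, p, h⟩ := hf.exists_tracing_targets htrans hφ hx₀ one_pos
  obtain ⟨b, n, ζ, θ, -, -, -, -, -, hθ, -⟩ := h (fun _ _ _ => True) (by simp)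
  have hu : ∀ k, Nonempty (f^[n k - b k] ⁻¹' {ζ k} : Set X) := fun k =>
    let ⟨w, hw⟩ := ((hf.surjective htrans).iterate (n k - b k)) (ζ k)
    ⟨⟨w, hw⟩⟩
  exact ⟨θ fun k => (hu k).some, hθ (mem_range_self _)⟩

/-- Hits are sought only at times where `φ j n ≥ exp (-n τ)`, so that the waiting time after `n` is
at most about `n τ / log κ⁻¹`. This allows either rate: with the upper rate all large times qualify,
with the lower rate infinitely many do. -/
lemma le_bowenEntropy_iInter_targetSet [CompactSpace X] [Nonempty X]
    (hf : HasContractingLifts f κ L) (htrans : IsTransitive f) {φ : ℕ → ℕ → ℝ} {z : ℕ → ℕ → X}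
    {S : ℕ → Set ℕ} (hφ : ∀ j n, 0 < φ j n ∧ φ j n ≤ 1) {x₀ : X}
    {h K : ℝ} (hK1 : 1 ≤ K)
    (hK : ∀ (r : ℕ) (y : X), Real.exp (h * r) ≤ K * (f^[r] ⁻¹' {y}).ncard ∧
      ((f^[r] ⁻¹' {y}).ncard : ℝ) ≤ K * Real.exp (h * r))
    {τ : ℝ} (hτ0 : 0 ≤ τ) (hx₀ : ∀ j, {n : ℕ | (n ∈ S j ∧ Real.exp (-(n * τ)) ≤ φ j n) ∧
      edist (f^[n] x₀) (z j n) < ⊤}.Infinite)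
    {s : ℝ} (hs0 : 0 ≤ s) (hs : s * (1 + τ / Real.log (κ : ℝ)⁻¹) < h) :
    ENNReal.ofReal s ≤ bowenEntropy f (⋂ j, targetSet f (φ j) (z j) (S j)) := by
  obtain ⟨r₀, hr₀, hinj⟩ := hf.locally_injective
  obtain ⟨E, p, hEp⟩ := hf.exists_tracing_targets htrans (S := fun j => {n : ℕ | n ∈ S j ∧ Real.exp (-(n * τ)) ≤ φ j n})
    (fun j n => (hφ j n).1) hx₀ hr₀
  have hℓ := hf.log_inv_pos
  set ℓ := Real.log (κ : ℝ)⁻¹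
  have hc : 0 < h - s * (1 + τ / ℓ) := by linarith
  -- The requirement on `n` is the logarithm of the inequality `hW` below, with `b (k + 1)` replaced
  -- by its bound `n (1 + τ / ℓ) + p + 1`.
  obtain ⟨b, n, ζ, θ, hb0, hbn, hnb, hθ, hE, hsub, hQ⟩ := hEp
    (fun _ b n => Real.log K + h * b + s * (p + 1) ≤ (h - s * (1 + τ / ℓ)) * n)
    (fun _ b => (tendsto_natCast_atTop_atTop.const_mul_atTop hc).eventually_ge_atTop _)
  have hsh : s ≤ h := by
    have : 0 ≤ s * (τ / ℓ) := by positivity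
    linarith
  have hW : ∀ k, K * Real.exp (-h * ((n k : ℝ) - b k)) ≤ Real.exp (-s * b (k + 1)) := by
    intro k
    obtain ⟨j, ⟨-, h1⟩, h2, h3⟩ := hQ k
    have h4 : -Real.log (φ j (n k)) ≤ n k * τ := by
      have := (Real.le_log_iff_exp_le (hφ j (n k)).1).2 h1
      linarith
    have h5 : 0 ≤ -Real.log (φ j (n k)) / ℓ :=
      div_nonneg (neg_nonneg.2 (Real.log_nonpos (hφ j (n k)).1.le (hφ j (n k)).2)) hℓ.le
    have h6 : (⌈-Real.log (φ j (n k)) / ℓ⌉₊ : ℝ) ≤ n k * (τ / ℓ) + 1 := by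
      refine (Nat.ceil_lt_add_one h5).le.trans ?_
      rw [← mul_div_assoc]
      gcongr
    have h7 : (b (k + 1) : ℝ) ≤ n k * (1 + τ / ℓ) + (p + 1) := by
      rw [h3]; push_cast; linarith
    have h8 := mul_le_mul_of_nonneg_left h7 hs0
    calc K * Real.exp (-h * ((n k : ℝ) - b k))
        = Real.exp (Real.log K + -h * ((n k : ℝ) - b k)) := by
          rw [Real.exp_add, Real.exp_log (by linarith)]
      _ ≤ _ := by
          rw [Real.exp_le_exp]
          nlinarith
  have h1 := hf.le_bowenEntropyAt_range htrans hK1 hK hinj hb0 hbn hnb hθ hE hs0 hsh hW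
  refine h1.trans (le_trans ?_ (bowenEntropy_mono (hsub.trans
    (iInter_mono fun j x hx => hx.mono fun n hn => ⟨hn.1.1, hn.2⟩))))
  exact le_iSup₂ (f := fun (ε : ℝ≥0∞) (_ : 0 < ε) => bowenEntropyAt f ε (range θ)) (r₀ / 4)
    (ENNReal.div_pos hr₀.ne' (by simp))

end HasContractingLifts

end ShrinkingTarget

/-! ### Exponential rates and the bounds in extended reals -/

namespace ShrinkingTarget

section Rates

lemma rate_lt_iff {x τ : ℝ} (hx : 0 < x) {n : ℕ} (hn : 0 < n) :
    ((-Real.log x / n : ℝ) : EReal) < τ ↔ Real.exp (-(n * τ)) < x := by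
  have hn' : (0 : ℝ) < n := by exact_mod_cast hn
  rw [EReal.coe_lt_coe_iff, div_lt_iff₀ hn', ← Real.lt_log_iff_exp_lt hx, neg_lt, mul_comm]

lemma lt_rate_iff {x τ : ℝ} (hx : 0 < x) {n : ℕ} (hn : 0 < n) :
    (τ : EReal) < ((-Real.log x / n : ℝ) : EReal) ↔ x < Real.exp (-(n * τ)) := by
  have hn' : (0 : ℝ) < n := by exact_mod_cast hn
  rw [EReal.coe_lt_coe_iff, lt_div_iff₀ hn', ← Real.log_lt_iff_lt_exp hx, lt_neg, mul_comm]

variable {φ : ℕ → ℕ → ℝ}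

lemma lowerRate_nonneg (hφ : ∀ j n, 0 < φ j n ∧ φ j n ≤ 1) : 0 ≤ lowerRate φ := by
  refine le_trans ?_ (le_iSup _ 0)
  refine le_liminf_of_le (by isBoundedDefault) (Eventually.of_forall fun n => ?_)
  have : 0 ≤ -Real.log (φ 0 n) / n :=
    div_nonneg (neg_nonneg.2 (Real.log_nonpos (hφ 0 n).1.le (hφ 0 n).2)) (Nat.cast_nonneg n)
  exact_mod_cast this

lemma lowerRate_le_upperRate (φ : ℕ → ℕ → ℝ) : lowerRate φ ≤ upperRate φ :=
  iSup_mono fun _ => liminf_le_limsup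

lemma eventually_of_upperRate_lt (hφ : ∀ j n, 0 < φ j n) {τ : ℝ} (hτ : upperRate φ < τ) (j : ℕ) :
    ∀ᶠ n : ℕ in atTop, Real.exp (-(n * τ)) ≤ φ j n := by
  have h1 : limsup (fun n : ℕ => ((-Real.log (φ j n) / n : ℝ) : EReal)) atTop < τ :=
    (le_iSup (fun j => limsup (fun n : ℕ => ((-Real.log (φ j n) / n : ℝ) : EReal)) atTop)
      j).trans_lt hτ
  filter_upwards [eventually_lt_of_limsup_lt h1, eventually_gt_atTop 0] with n hn hn0
  exact ((rate_lt_iff (hφ j n) hn0).1 hn).le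

lemma frequently_of_lowerRate_lt (hφ : ∀ j n, 0 < φ j n) {τ : ℝ} (hτ : lowerRate φ < τ) (j : ℕ) :
    ∃ᶠ n : ℕ in atTop, Real.exp (-(n * τ)) ≤ φ j n := by
  have h1 : liminf (fun n : ℕ => ((-Real.log (φ j n) / n : ℝ) : EReal)) atTop < τ :=
    (le_iSup (fun j => liminf (fun n : ℕ => ((-Real.log (φ j n) / n : ℝ) : EReal)) atTop)
      j).trans_lt hτ
  refine ((frequently_lt_of_liminf_lt (by isBoundedDefault) h1).and_eventually
    (eventually_gt_atTop 0)).mono fun n hn => ?_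
  exact ((rate_lt_iff (hφ j n) hn.2).1 hn.1).le

lemma exists_eventually_of_lt_lowerRate (hφ : ∀ j n, 0 < φ j n) {τ : ℝ}
    (hτ : (τ : EReal) < lowerRate φ) :
    ∃ j, ∀ᶠ n : ℕ in atTop, φ j n ≤ Real.exp (-(n * τ)) := by
  obtain ⟨j, hj⟩ := lt_iSup_iff.1 hτ
  refine ⟨j, ?_⟩
  filter_upwards [eventually_lt_of_lt_liminf hj, eventually_gt_atTop 0] with n hn hn0
  exact ((lt_rate_iff (hφ j n) hn0).1 hn).le

end Rates

/-- Reconciles the two forms of the dimension formula when `L = lam`; for `τ = ⊤` both fractions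
vanish. -/
lemma one_div_mul_div_mul {a : ℝ} (ha : 0 < a) {τ : EReal} (hτ : 0 ≤ τ) (h : EReal) :
    1 / (a : EReal) * ((a : EReal) / (a + τ)) * h = 1 / (a + τ) * h := by
  congr 1
  induction τ with
  | bot => simp at hτ
  | top => rw [EReal.coe_add_top, EReal.div_top, EReal.div_top, mul_zero]
  | coe t =>
    have ht : 0 ≤ t := by exact_mod_cast hτ
    rw [← EReal.coe_one, ← EReal.coe_add, ← EReal.coe_div, ← EReal.coe_div, ← EReal.coe_div,
      ← EReal.coe_mul]
    congr 1
    field_simp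

variable {X : Type*} [EMetricSpace X] {f : X → X} {κ L : ℝ≥0}

namespace HasContractingLifts

lemma entropy_lower_bound [CompactSpace X] [Nonempty X]
    (hf : HasContractingLifts f κ L) (htrans : IsTransitive f) {φ : ℕ → ℕ → ℝ} {z : ℕ → ℕ → X}
    {S : ℕ → Set ℕ} (hφ : ∀ j n, 0 < φ j n ∧ φ j n ≤ 1) {x₀ : X} {τ : EReal} (hτ : 0 ≤ τ)
    (hx₀ : ∀ τ' : ℝ, τ < τ' → ∀ j, {n : ℕ | (n ∈ S j ∧ Real.exp (-(n * τ')) ≤ φ j n) ∧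
      edist (f^[n] x₀) (z j n) < ⊤}.Infinite) :
    (Real.log (κ : ℝ)⁻¹ : EReal) / (Real.log (κ : ℝ)⁻¹ + τ) * Dynamics.coverEntropy f univ
      ≤ (bowenEntropy f (⋂ j, targetSet f (φ j) (z j) (S j)) : EReal) := by
  obtain ⟨h, K, hh, hK1, hK⟩ := hf.exists_growth htrans
  rw [hf.coverEntropy_eq hK1 hK]
  have ha := hf.log_inv_pos
  set a := Real.log (κ : ℝ)⁻¹ with ha'
  induction τ with
  | bot => simp at hτ
  | top => rw [EReal.coe_add_top, EReal.div_top, zero_mul]; exact EReal.coe_ennreal_nonneg _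
  | coe t =>
    have ht : 0 ≤ t := by exact_mod_cast hτ
    rw [← EReal.coe_add, ← EReal.coe_div, ← EReal.coe_mul]
    refine EReal.ge_of_forall_gt_iff_ge.1 fun c hc => ?_
    rw [EReal.coe_lt_coe_iff] at hc
    rcases le_or_gt c 0 with hc0 | hc0
    · exact le_trans (by exact_mod_cast hc0) (EReal.coe_ennreal_nonneg _)
    have hgap : 0 < h - c * (1 + t / a) := by
      rw [div_mul_eq_mul_div, lt_div_iff₀ (by positivity)] at hc
      have : c * (1 + t / a) = c * (a + t) / a := by field_simp
      rw [this, sub_pos, div_lt_iff₀ ha]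
      linarith
    -- Chosen so that passing from rate `t` to `t + δ` uses exactly half of the gap.
    set δ := a * ((h - c * (1 + t / a)) / (2 * c)) with hδ
    have hδ0 : 0 < δ := by positivity
    have h1 : c * (1 + (t + δ) / a) < h := by
      have : c * (1 + (t + δ) / a) = c * (1 + t / a) + (h - c * (1 + t / a)) / 2 := by
        rw [hδ]; field_simp; ring
      rw [this]; linarith
    have h2 := hf.le_bowenEntropy_iInter_targetSet htrans hφ hK1 hK (τ := t + δ) (by positivity)
      (hx₀ (t + δ) (by exact_mod_cast lt_add_of_pos_right t hδ0)) hc0.le h1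
    rw [← EReal.coe_ennreal_le_coe_ennreal_iff, EReal.coe_ennreal_ofReal, max_eq_left hc0.le] at h2
    exact h2

lemma entropy_upper_bound [CompactSpace X] [Nonempty X]
    (hf : HasContractingLifts f κ L) (htrans : IsTransitive f) {φ : ℕ → ℕ → ℝ}
    (hφ : ∀ j n, 0 < φ j n ∧ φ j n ≤ 1) (z : ℕ → ℕ → X) (S : ℕ → Set ℕ) :
    (bowenEntropy f (⋂ j, targetSet f (φ j) (z j) (S j)) : EReal)
      ≤ (Real.log L : EReal) / (Real.log L + lowerRate φ) * Dynamics.coverEntropy f univ := by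
  obtain ⟨h, K, hh, hK1, hK⟩ := hf.exists_growth htrans
  rw [hf.coverEntropy_eq hK1 hK]
  have hb := hf.log_pos
  have hv := lowerRate_nonneg hφ
  have hnn : (0 : EReal) ≤ (Real.log L : EReal) / (Real.log L + lowerRate φ) * h :=
    mul_nonneg (EReal.div_nonneg (by exact_mod_cast hb.le)
      (add_nonneg (by exact_mod_cast hb.le) hv)) (by exact_mod_cast hh)
  refine EReal.le_of_forall_lt_iff_le.1 fun c hc => ?_
  have hc0 : 0 < c := by exact_mod_cast hnn.trans_lt hc
  -- The second entry of the maximum solves `log L / (log L + T) * h = c`. When the maximum is `0`,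
  -- the bound `φ ≤ 1` suffices.
  have hT : max 0 (Real.log L * h / c - Real.log L) = 0 ∨
      ((max 0 (Real.log L * h / c - Real.log L) : ℝ) : EReal) < lowerRate φ := by
    generalize hveq : lowerRate φ = v at hv hc
    induction v with
    | bot => simp at hv
    | top => exact Or.inr (EReal.coe_lt_top _)
    | coe t =>
      have ht : 0 ≤ t := by exact_mod_cast hv
      rw [← EReal.coe_add, ← EReal.coe_div, ← EReal.coe_mul, EReal.coe_lt_coe_iff,
        div_mul_eq_mul_div, div_lt_iff₀ (by positivity)] at hc
      rcases le_total (Real.log L * h / c - Real.log L) 0 with h0 | h0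
      · exact Or.inl (max_eq_left h0)
      · right
        rw [max_eq_right h0, EReal.coe_lt_coe_iff, sub_lt_iff_lt_add, div_lt_iff₀ hc0]
        linarith
  set T := max 0 (Real.log L * h / c - Real.log L) with hTdef
  have hT0 : 0 ≤ T := le_max_left _ _
  obtain ⟨j, hj⟩ : ∃ j, ∀ᶠ n : ℕ in atTop, φ j n ≤ Real.exp (-(n * T)) := by
    rcases hT with h0 | h0
    · exact ⟨0, Eventually.of_forall fun n => by simpa [h0] using (hφ 0 n).2⟩
    · exact exists_eventually_of_lt_lowerRate (fun j n => (hφ j n).1) h0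
  have h1 : bowenEntropy f (⋂ j, targetSet f (φ j) (z j) (S j)) ≤ ENNReal.ofReal c := by
    -- A single target sequence whose lower rate exceeds `T`, or any one if `T = 0`, bounds the
    -- whole intersection.
    refine (bowenEntropy_mono (iInter_subset _ j)).trans
      ((hf.bowenEntropy_targetSet_le hh (fun r y => (hK r y).2) hT0 hj (z j) (S j)).trans ?_)
    refine ENNReal.ofReal_le_ofReal ?_
    have h2 : Real.log L * h / c - Real.log L ≤ T := le_max_right _ _
    rw [div_mul_eq_mul_div, div_le_iff₀ (by positivity)]
    rw [sub_le_iff_le_add, div_le_iff₀ hc0] at h2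
    linarith
  rw [← EReal.coe_ennreal_le_coe_ennreal_iff, EReal.coe_ennreal_ofReal, max_eq_left hc0.le] at h1
  exact h1

lemma targetBounds [CompactSpace X] [Nonempty X]
    (hf : HasContractingLifts f κ L) (htrans : IsTransitive f) {φ : ℕ → ℕ → ℝ} {z : ℕ → ℕ → X}
    {S : ℕ → Set ℕ} (hφ : ∀ j n, 0 < φ j n ∧ φ j n ≤ 1) {x₀ : X}
    (hx₀ : ∀ j, {n | n ∈ S j ∧ edist (f^[n] x₀) (z j n) < ⊤}.Infinite) {τ : EReal} (hτ : 0 ≤ τ)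
    (hx₀τ : ∀ τ' : ℝ, τ < τ' → ∀ j, {n : ℕ | (n ∈ S j ∧ Real.exp (-(n * τ')) ≤ φ j n) ∧
      edist (f^[n] x₀) (z j n) < ⊤}.Infinite) :
    TargetBounds f (κ : ℝ)⁻¹ L τ (lowerRate φ) (⋂ j, targetSet f (φ j) (z j) (S j)) := by
  have hlow := hf.entropy_lower_bound htrans hφ hτ hx₀τ
  have hup := hf.entropy_upper_bound htrans hφ z S
  have ha := hf.log_inv_pos
  have hb := hf.log_pos
  have hcomm : ∀ (c : ℝ) (x y : EReal), 1 / (c : EReal) * x * y = x * y / c := fun c x y => by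
    rw [EReal.div_eq_inv_mul, EReal.div_eq_inv_mul, mul_one, mul_assoc]
  refine ⟨hf.nonempty_iInter_targetSet htrans (fun j n => (hφ j n).1) hx₀, hlow, hup, ?_, ?_⟩
  · rw [hcomm, EReal.div_le_iff_le_mul (by exact_mod_cast hb) (EReal.coe_ne_top _)]
    refine hlow.trans ?_
    have h1 := bowenEntropy_le_dimH_mul_log hf.lipschitz hf.one_lt
      (⋂ j, targetSet f (φ j) (z j) (S j))
    rw [← EReal.coe_ennreal_le_coe_ennreal_iff, EReal.coe_ennreal_mul, EReal.coe_ennreal_ofReal,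
      max_eq_left hb.le, mul_comm] at h1
    exact h1
  · rw [hcomm, EReal.le_div_iff_mul_le (by exact_mod_cast ha) (EReal.coe_ne_top _)]
    refine le_trans ?_ hup
    have h1 := hf.dimH_mul_log_le (⋂ j, targetSet f (φ j) (z j) (S j))
    rw [← EReal.coe_ennreal_le_coe_ennreal_iff, EReal.coe_ennreal_mul, EReal.coe_ennreal_ofReal,
      max_eq_left ha.le] at h1
    exact h1

/-- The bounds with the upper rate, for targets visited at finite distance by one orbit. -/
lemma targetBounds_upperRate [CompactSpace X] [Nonempty X]
    (hf : HasContractingLifts f κ L) (htrans : IsTransitive f) {φ : ℕ → ℕ → ℝ} {z : ℕ → ℕ → X}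
    {S : ℕ → Set ℕ} (hφ : ∀ j n, 0 < φ j n ∧ φ j n ≤ 1) {x₀ : X}
    (hx₀ : ∀ j, {n | n ∈ S j ∧ edist (f^[n] x₀) (z j n) < ⊤}.Infinite) :
    TargetBounds f (κ : ℝ)⁻¹ L (upperRate φ) (lowerRate φ)
      (⋂ j, targetSet f (φ j) (z j) (S j)) := by
  refine hf.targetBounds htrans hφ hx₀
    ((lowerRate_nonneg hφ).trans (lowerRate_le_upperRate φ)) fun τ' hτ' j => ?_
  refine Nat.frequently_atTop_iff_infinite.1 (((Nat.frequently_atTop_iff_infinite.2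
    (hx₀ j)).and_eventually (eventually_of_upperRate_lt (fun j n => (hφ j n).1) hτ' j)).mono ?_)
  exact fun n hn => ⟨⟨hn.1.1, hn.2⟩, hn.1.2⟩

/-- The bounds with the lower rate, when all the distances are finite and all positive times are
allowed. -/
lemma targetBounds_lowerRate [CompactSpace X] [Nonempty X]
    (hf : HasContractingLifts f κ L) (htrans : IsTransitive f)
    (hfin : ∀ x y : X, edist x y < ⊤) {φ : ℕ → ℕ → ℝ} (z : ℕ → ℕ → X)
    {S : ℕ → Set ℕ} (hφ : ∀ j n, 0 < φ j n ∧ φ j n ≤ 1) (hS : ∀ j n, 0 < n → n ∈ S j) :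
    TargetBounds f (κ : ℝ)⁻¹ L (lowerRate φ) (lowerRate φ)
      (⋂ j, targetSet f (φ j) (z j) (S j)) := by
  refine hf.targetBounds htrans hφ (x₀ := Classical.arbitrary X) (fun j => ?_)
    (lowerRate_nonneg hφ) fun τ' hτ' j => ?_
  · exact (Ioi_infinite 0).mono fun n hn => ⟨hS j n hn, hfin _ _⟩
  · refine Nat.frequently_atTop_iff_infinite.1 (((frequently_of_lowerRate_lt
      (fun j n => (hφ j n).1) hτ' j).and_eventually (eventually_gt_atTop 0)).mono ?_)
    exact fun n hn => ⟨⟨hS j n hn.2, hn.1⟩, hfin _ _⟩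

end HasContractingLifts

end ShrinkingTarget

/-! ### Expanding maps of Riemannian manifolds and the main theorem -/

namespace ShrinkingTarget

section Expanding

variable {E : Type*} [NormedAddCommGroup E] [NormedSpace ℝ E]
  {M : Type*} [EMetricSpace M] [ChartedSpace E M]
  [RiemannianBundle (fun x : M => TangentSpace 𝓘(ℝ, E) x)]

lemma isContinuousRiemannianBundle_tangentSpace [IsManifold 𝓘(ℝ, E) 1 M]
    [IsContMDiffRiemannianBundle 𝓘(ℝ, E) ∞ E (fun x : M => TangentSpace 𝓘(ℝ, E) x)] :
    IsContinuousRiemannianBundle E (fun x : M => TangentSpace 𝓘(ℝ, E) x) := by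
  obtain ⟨g, hg, hgi⟩ := IsContMDiffRiemannianBundle.exists_contMDiff (IB := 𝓘(ℝ, E)) (n := ∞)
    (F := E) (E := fun x : M => TangentSpace 𝓘(ℝ, E) x)
  exact ⟨g, hg.continuous, hgi⟩

lemma IsExpanding.hasContractingLifts [FiniteDimensional ℝ E] [Nontrivial E] [CompactSpace M]
    [Nonempty M] [IsManifold 𝓘(ℝ, E) 1 M]
    [IsContinuousRiemannianBundle E (fun x : M => TangentSpace 𝓘(ℝ, E) x)]
    [IsRiemannianManifold 𝓘(ℝ, E) M] {f : M → M} {lam : ℝ} (hf : IsExpanding E f lam) :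
    HasContractingLifts f (lam⁻¹).toNNReal (maxStretch E f).toNNReal := by
  have hlam := hf.one_lt
  have hle := hf.le_maxStretch
  have hc : ((lam⁻¹).toNNReal : ℝ) = lam⁻¹ := Real.coe_toNNReal _ (by positivity)
  have hL : ((maxStretch E f).toNNReal : ℝ) = maxStretch E f := Real.coe_toNNReal _ (by linarith)
  refine ⟨lipschitzWith_of_norm_mfderiv_le ?_ hf.contMDiff fun y v => ?_, hf.exists_lift hc,
    hf.exists_injOn, ?_, ?_, ?_⟩
  · exact (Real.toNNReal_pos.2 (by linarith)).ne'
  · rw [hL]; exact norm_mfderiv_le_maxStretch hf.contMDiff y v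
  · exact Real.toNNReal_pos.2 (by positivity)
  · rw [← NNReal.coe_lt_coe, hc]; exact inv_lt_one_of_one_lt₀ hlam
  · rw [← NNReal.coe_le_coe, NNReal.coe_inv, hc, hL, inv_inv]; exact hle

end Expanding

end ShrinkingTarget

theorem theorem1p14
    {E : Type*} [NormedAddCommGroup E] [NormedSpace ℝ E] [FiniteDimensional ℝ E] [Nontrivial E]
    {M : Type*} [EMetricSpace M] [CompactSpace M] [Nonempty M]
    [ChartedSpace E M] [IsManifold 𝓘(ℝ, E) ∞ M]
    [RiemannianBundle (fun x : M => TangentSpace 𝓘(ℝ, E) x)]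
    [IsContMDiffRiemannianBundle 𝓘(ℝ, E) ∞ E (fun x : M => TangentSpace 𝓘(ℝ, E) x)]
    [IsRiemannianManifold 𝓘(ℝ, E) M]
    (f : M → M) (lam : ℝ) (hf : ShrinkingTarget.IsExpanding E f lam)
    (htrans : ShrinkingTarget.IsTransitive f) :
    (∃ (Y : Set M) (N : ℕ), ShrinkingTarget.IsPeriodicPiece f (Real.log lam) Y N) ∧
    ∀ (φ : ℕ → ℕ → ℝ) (z : ℕ → ℕ → M) (s : ℕ → ℕ → ℕ),
      (∀ j n, 0 < φ j n ∧ φ j n ≤ 1) →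
      (∀ j, Tendsto (s j) atTop atTop) →
      -- the transitive case, under the index condition
      (∀ (Y : Set M) (N : ℕ), ShrinkingTarget.IsPeriodicPiece f (Real.log lam) Y N →
        (⋂ j, ShrinkingTarget.indexDiff f (z j) (s j) Y N).Nonempty →
        ShrinkingTarget.TargetBounds f lam (ShrinkingTarget.maxStretch E f)
          (ShrinkingTarget.upperRate φ) (ShrinkingTarget.lowerRate φ)
          (⋂ j, ShrinkingTarget.targetSet f (φ j) (z j) (range (s j)))) ∧
      -- the mixing case
      (ShrinkingTarget.IsMixing f →
        ShrinkingTarget.TargetBounds f lam (ShrinkingTarget.maxStretch E f)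
          (ShrinkingTarget.upperRate φ) (ShrinkingTarget.lowerRate φ)
          (⋂ j, ShrinkingTarget.targetSet f (φ j) (z j) (range (s j)))) ∧
      -- the mixing case with all times allowed
      (ShrinkingTarget.IsMixing f → (∀ j n, 0 < n → n ∈ range (s j)) →
        ShrinkingTarget.TargetBounds f lam (ShrinkingTarget.maxStretch E f)
          (ShrinkingTarget.lowerRate φ) (ShrinkingTarget.lowerRate φ)
          (⋂ j, ShrinkingTarget.targetSet f (φ j) (z j) (range (s j))) ∧
        (ShrinkingTarget.maxStretch E f = lam →
          (ShrinkingTarget.bowenEntropy f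
              (⋂ j, ShrinkingTarget.targetSet f (φ j) (z j) (range (s j))) : EReal)
            = (Real.log (ShrinkingTarget.maxStretch E f) : EReal)
                / (Real.log (ShrinkingTarget.maxStretch E f) + ShrinkingTarget.lowerRate φ)
                * Dynamics.coverEntropy f univ ∧
          (dimH (⋂ j, ShrinkingTarget.targetSet f (φ j) (z j) (range (s j))) : EReal)
            = 1 / (Real.log (ShrinkingTarget.maxStretch E f) + ShrinkingTarget.lowerRate φ)
                * Dynamics.coverEntropy f univ)) := by
  have hM : IsManifold 𝓘(ℝ, E) 1 M := IsManifold.of_le (n := ∞) (by simp)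
  have hR : IsContinuousRiemannianBundle E (fun x : M => TangentSpace 𝓘(ℝ, E) x) :=
    ShrinkingTarget.isContinuousRiemannianBundle_tangentSpace
  have hlam : 0 < lam := by linarith [hf.one_lt]
  have hF := hf.hasContractingLifts
  have hκ : ((lam⁻¹).toNNReal : ℝ) = lam⁻¹ := Real.coe_toNNReal _ (by positivity)
  have hκ' : (((lam⁻¹).toNNReal : ℝ))⁻¹ = lam := by rw [hκ, inv_inv]
  have hL : ((ShrinkingTarget.maxStretch E f).toNNReal : ℝ) = ShrinkingTarget.maxStretch E f :=
    Real.coe_toNNReal _ (by linarith [hf.le_maxStretch])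
  refine ⟨hF.exists_isPeriodicPiece htrans hlam hκ, fun φ z s hφ hs => ⟨?_, ?_, ?_⟩⟩
  · intro Y N hY hind
    obtain ⟨x₀, hx₀⟩ := hY.exists_base_point hF hs hind
    have h := hF.targetBounds_upperRate htrans hφ hx₀
    rwa [hκ', hL] at h
  · intro hmix
    -- Under mixing there is only one class, so any base point is at finite distance from all
    -- targets.
    have h := hF.targetBounds_upperRate htrans (z := z) (S := fun j => range (s j)) hφ
      (x₀ := Classical.arbitrary M) fun j => by
        refine (ShrinkingTarget.infinite_image_of_tendsto (hs j) infinite_univ).mono ?_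
        rintro _ ⟨i, -, rfl⟩
        exact ⟨mem_range_self i, hF.edist_lt_top_of_isMixing hmix _ _⟩
    rwa [hκ', hL] at h
  · intro hmix hall
    have h := hF.targetBounds_lowerRate htrans (hF.edist_lt_top_of_isMixing hmix) z hφ hall
    rw [hκ', hL] at h
    refine ⟨h, fun hLlam => ?_⟩
    rw [hLlam] at h ⊢
    refine ⟨le_antisymm h.entropy_upper h.entropy_lower, ?_⟩
    rw [← ShrinkingTarget.one_div_mul_div_mul (Real.log_pos hf.one_lt)
      (ShrinkingTarget.lowerRate_nonneg hφ)]
    exact le_antisymm h.dim_upper h.dim_lower
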